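/- Let $\beta\in(0,2)$. There exists a constant $C\ge 1$, depending only on $\beta$, such that the following holds for every $d\in\mathbb{N}$, every probability space $(\Omega_0,\mathcal{F}_0,\mathbb{P}_0)$ and every integrable real random variable $X$ on the product probability space $(\Omega_*,\mathcal{F}_*,\mathbb{P}_*)=(\Omega_0^{\mathbb{Z}^d},\mathcal{F}_0^{\mathbb{Z}^d},\mathbb{P}_0^{\mathbb{Z}^d})$. For $\Gamma\subseteq\mathbb{Z}^d$ let $\mathcal{F}_*(\Gamma)$ be the $\sigma$-algebra generated by the coordinate maps $\omega\mapsto\omega(z)$, $z\in\Gamma$, and set $$X_z' := \mathbb{E}_*\!\left[X \,\middle|\, \mathcal{F}_*(\mathbb{Z}^d\setminus\{z\})\right],\qquad \mathbb{V}_*[X] := \sum_{z\in\mathbb{Z}^d}(X-X_z')^2\in[0,\infty].$$ Then $$\mathbb{E}_*\!\left[\exp\!\left(\left|X-\mathbb{E}_*[X]\right|^{\beta}\right)\right]\ \le\ C\;\mathbb{E}_*\!\left[\exp\!\left(\left(C\,\mathbb{V}_*[X]\right)^{\frac{\beta}{2-\beta}}\right)\right]^{\frac{2-\beta}{\beta}},$$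 where both sides take values in $[0,\infty]$ and $\exp(\infty)=\infty$. -/

import Mathlib

open MeasureTheory
open scoped ENNReal

noncomputable section

/-- The product probability measure `P₀^{ℤ^d}` on the space `ℤ^d → Ω₀` of configurations. -/
def productLaw {Ω₀ : Type*} [MeasurableSpace Ω₀] (d : ℕ) (P₀ : Measure Ω₀) :
    Measure ((Fin d → ℤ) → Ω₀) :=
  Measure.infinitePi (fun _ : Fin d → ℤ => P₀)

/-- `X'_z`: the conditional expectation of `X` given all the coordinates other than the one
at `z`. -/
def condExpOff {Ω₀ : Type*} [MeasurableSpace Ω₀] {d : ℕ} (P₀ : Measure Ω₀)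
    (X : ((Fin d → ℤ) → Ω₀) → ℝ) (z : Fin d → ℤ) : ((Fin d → ℤ) → Ω₀) → ℝ :=
  condExp (cylinderEvents (X := fun _ : Fin d → ℤ => Ω₀) {z}ᶜ) (productLaw d P₀) X

/-- `𝕍[X] = ∑_z (X - X'_z)²`, as a `[0,∞]`-valued random variable. -/
def verticalVar {Ω₀ : Type*} [MeasurableSpace Ω₀] {d : ℕ} (P₀ : Measure Ω₀)
    (X : ((Fin d → ℤ) → Ω₀) → ℝ) (ω : (Fin d → ℤ) → Ω₀) : ℝ≥0∞ :=
  ∑' z : Fin d → ℤ, ENNReal.ofReal ((X ω - condExpOff P₀ X z ω) ^ 2)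

end

/-!
For an event `A = {X ≥ 𝔼 X + t}` of probability `e⁻ᵖ`, the point is that `t ^ 2` is at most a
constant times `(p + 1) * v` whenever the square function `𝕍[X]` has mean at most `v` under every
density bounded by `e ^ (2 p + 6)`. If `exp ((C 𝕍[X]) ^ a)` is integrable, where
`a = β / (2 - β)`, then `v` can be taken of order `p ^ (1 / a) / C`, so that `X` has tails
`exp (-c t ^ β)`, which are then integrated.

By discretization, the space may be assumed to be a finite product. Let `h` be a mixture of the
constant `1` and the density of the law conditioned on `A`. It is transported to `1` in two stages,
along densities which remain bounded by `e ^ (2 p + 6)` up to a small mass.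

* Let `T` be the noise operator that resamples each site with a tiny probability `e ^ (-ℓ)`. Solve
  the Schrödinger system `h = f * T g`, `g = (T f) ^ (-(1 - 1/ℓ))`, and follow the densities
  `T_a f * T_{Q/a} g`, where `T_a` keeps each site with probability `a` and `T = T_Q`, from `h` to
  `r = T f * g = (T f) ^ (1/ℓ)`. The latter is regular: averaging it over one site increases it at
  most by a factor `e`. The expected number of resampled sites is `O(p + 1)`. Since resampling the
  site `i` only sees the difference of a function and its average over `i`, this number and the
  Cauchy–Schwarz inequality control the change of the mean of a function along this stage.
* The noise semigroup transports `r` to `1`. Here the entropy production pays for the transport, the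
  total entropy being at most `p`.

Apply this to `G`, the part of `X` between the levels `𝔼 X + t/2` and `𝔼 X + t`: its mean is of
order `t` under `h`, and of order `v / t` under `1` by the Efron–Stein inequality.
-/

namespace NoiseSemigroup

open Finset Function

/-! ### The noise operators of a finite product space -/

section SiteKernel

variable {α : Type*} [Fintype α] {w : α → ℝ} {q : ℝ}

open scoped Classical in
/-- The transition kernel on the alphabet `α` that keeps the current letter with probability `q`
and resamples it from the law `w` otherwise. -/
noncomputable def siteKernel (w : α → ℝ) (q : ℝ) (x y : α) : ℝ :=
  q * (if x = y then 1 else 0) + (1 - q) * w y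

omit [Fintype α] in
lemma siteKernel_apply [DecidableEq α] (w : α → ℝ) (q : ℝ) (x y : α) :
    siteKernel w q x y = q * (if x = y then 1 else 0) + (1 - q) * w y := by
  unfold siteKernel
  congr

lemma le_one_of_mem_stdSimplex (hw : w ∈ stdSimplex ℝ α) (a : α) : w a ≤ 1 := by
  rw [← hw.2]
  exact single_le_sum (f := w) (fun b _ => hw.1 b) (mem_univ a)

lemma siteKernel_nonneg (hw : w ∈ stdSimplex ℝ α) (hq : q ∈ Set.Icc 0 1) (x y : α) :
    0 ≤ siteKernel w q x y := by
  have := hw.1 y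
  have := hq.1
  have := sub_nonneg.2 hq.2
  unfold siteKernel
  positivity

lemma sum_siteKernel (hw : w ∈ stdSimplex ℝ α) (q : ℝ) (x : α) :
    ∑ y, siteKernel w q x y = 1 := by
  classical
  simp [siteKernel_apply, sum_add_distrib, ← mul_sum, hw.2]

lemma siteKernel_le_one (hw : w ∈ stdSimplex ℝ α) (hq : q ∈ Set.Icc 0 1) (x y : α) :
    siteKernel w q x y ≤ 1 := by
  rw [← sum_siteKernel hw q x]
  exact single_le_sum (f := siteKernel w q x) (fun b _ => siteKernel_nonneg hw hq x b)
    (mem_univ y)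

lemma sum_siteKernel_mul (w : α → ℝ) (q : ℝ) (x : α) (u : α → ℝ) :
    ∑ y, siteKernel w q x y * u y = q * u x + (1 - q) * ∑ y, w y * u y := by
  classical
  simp [siteKernel_apply, add_mul, sum_add_distrib, mul_sum, mul_assoc]

lemma sum_weight_mul_siteKernel (hw : w ∈ stdSimplex ℝ α) (q : ℝ) (y : α) :
    ∑ z, w z * siteKernel w q z y = w y := by
  classical
  simp only [siteKernel_apply, mul_add, sum_add_distrib, ← mul_assoc, ← sum_mul, hw.2]
  simp only [mul_ite, mul_one, mul_zero, sum_ite_eq', mem_univ, if_true, one_mul]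
  ring

lemma sum_siteKernel_mul_siteKernel (hw : w ∈ stdSimplex ℝ α) (a b : ℝ) (x y : α) :
    ∑ z, siteKernel w a x z * siteKernel w b z y = siteKernel w (a * b) x y := by
  rw [sum_siteKernel_mul w a x (fun z => siteKernel w b z y), sum_weight_mul_siteKernel hw]
  unfold siteKernel
  ring

omit [Fintype α] in
lemma weight_mul_siteKernel_comm (w : α → ℝ) (q : ℝ) (x y : α) :
    w x * siteKernel w q x y = w y * siteKernel w q y x := by
  unfold siteKernel
  obtain rfl | h := eq_or_ne x y
  · rfl
  · rw [if_neg h, if_neg h.symm]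
    ring

omit [Fintype α] in
lemma siteKernel_one [DecidableEq α] (w : α → ℝ) (x y : α) :
    siteKernel w 1 x y = if x = y then 1 else 0 := by
  simp [siteKernel_apply]

omit [Fintype α] in
lemma siteKernel_zero (w : α → ℝ) (x y : α) : siteKernel w 0 x y = w y := by simp [siteKernel]

end SiteKernel

section Mean

variable {ι α : Type*} [Fintype ι] [DecidableEq ι] [Fintype α] {w : α → ℝ}

/-- Expectation on the product space `ι → α` whose coordinates are independent with law `w`. -/
noncomputable def mean (w : α → ℝ) (u : (ι → α) → ℝ) : ℝ :=
  ∑ x, (∏ i, w (x i)) * u x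

lemma mean_add (w : α → ℝ) (u v : (ι → α) → ℝ) : mean w (u + v) = mean w u + mean w v := by
  simp [mean, mul_add, sum_add_distrib]

lemma mean_sub (w : α → ℝ) (u v : (ι → α) → ℝ) : mean w (u - v) = mean w u - mean w v := by
  simp [mean, mul_sub, sum_sub_distrib]

lemma mean_smul (w : α → ℝ) (c : ℝ) (u : (ι → α) → ℝ) : mean w (c • u) = c * mean w u := by
  simp [mean, mul_sum, mul_left_comm]

lemma mean_sum {κ : Type*} (s : Finset κ) (w : α → ℝ) (u : κ → (ι → α) → ℝ) :
    mean w (fun x => ∑ k ∈ s, u k x) = ∑ k ∈ s, mean w (u k) := by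
  simp only [mean, mul_sum]
  exact sum_comm

lemma mean_mono (hw : w ∈ stdSimplex ℝ α) {u v : (ι → α) → ℝ} (h : ∀ x, u x ≤ v x) :
    mean w u ≤ mean w v :=
  sum_le_sum fun x _ => mul_le_mul_of_nonneg_left (h x) (prod_nonneg fun _ _ => hw.1 _)

lemma mean_nonneg (hw : w ∈ stdSimplex ℝ α) {u : (ι → α) → ℝ} (h : ∀ x, 0 ≤ u x) :
    0 ≤ mean w u :=
  sum_nonneg fun x _ => mul_nonneg (prod_nonneg fun _ _ => hw.1 _) (h x)

lemma mean_const (hw : w ∈ stdSimplex ℝ α) (c : ℝ) : mean w (fun _ : ι → α => c) = c := by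
  simp [mean, ← sum_mul, ← Fintype.prod_sum fun (_ : ι) a => w a, hw.2]

end Mean

section Noise

variable {ι α : Type*} [Fintype ι] {w : α → ℝ} {q : ι → ℝ}

/-- The product of the site kernels, with one parameter for each site. -/
noncomputable def kernel (w : α → ℝ) (q : ι → ℝ) (x y : ι → α) : ℝ :=
  ∏ i, siteKernel w (q i) (x i) (y i)

lemma prod_weight_mul_kernel_comm (w : α → ℝ) (q : ι → ℝ) (x y : ι → α) :
    (∏ i, w (x i)) * kernel w q x y = (∏ i, w (y i)) * kernel w q y x := by
  unfold kernel
  simp only [← prod_mul_distrib]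
  exact prod_congr rfl fun i _ => weight_mul_siteKernel_comm w _ _ _

variable [Fintype α]

/-- The noise operator: the expectation of `u` after each coordinate `i` of `x` has been
resampled from `w` with probability `1 - q i`, independently. -/
noncomputable def noise [DecidableEq ι] (w : α → ℝ) (q : ι → ℝ) (u : (ι → α) → ℝ) (x : ι → α) :
    ℝ :=
  ∑ y, kernel w q x y * u y

lemma kernel_nonneg (hw : w ∈ stdSimplex ℝ α) (hq : q ∈ Set.Icc 0 1) (x y : ι → α) :
    0 ≤ kernel w q x y :=
  prod_nonneg fun i _ => siteKernel_nonneg hw ⟨hq.1 i, hq.2 i⟩ _ _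

variable [DecidableEq ι]

lemma sum_kernel (hw : w ∈ stdSimplex ℝ α) (q : ι → ℝ) (x : ι → α) :
    ∑ y, kernel w q x y = 1 := by
  simp only [kernel, ← Fintype.prod_sum fun i a => siteKernel w (q i) (x i) a, sum_siteKernel hw,
    prod_const_one]

lemma sum_kernel_mul_kernel (hw : w ∈ stdSimplex ℝ α) (a b : ι → ℝ) (x y : ι → α) :
    ∑ z, kernel w a x z * kernel w b z y = kernel w (a * b) x y := by
  simp only [kernel, ← prod_mul_distrib, ← Fintype.prod_sum fun i c =>
    siteKernel w (a i) (x i) c * siteKernel w (b i) c (y i), sum_siteKernel_mul_siteKernel hw,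
    Pi.mul_apply]

lemma noise_noise (hw : w ∈ stdSimplex ℝ α) (a b : ι → ℝ) (u : (ι → α) → ℝ) :
    noise w a (noise w b u) = noise w (a * b) u := by
  ext x
  simp only [noise, mul_sum, ← mul_assoc]
  rw [sum_comm]
  simp only [← sum_mul, sum_kernel_mul_kernel hw]

lemma mean_mul_noise (w : α → ℝ) (q : ι → ℝ) (u v : (ι → α) → ℝ) :
    mean w (u * noise w q v) = mean w (noise w q u * v) := by
  simp only [mean, noise, Pi.mul_apply, mul_sum, sum_mul]
  rw [sum_comm]
  refine sum_congr rfl fun y _ => sum_congr rfl fun x _ => ?_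
  calc (∏ i, w (x i)) * (u x * (kernel w q x y * v y))
      = ((∏ i, w (x i)) * kernel w q x y) * u x * v y := by ring
    _ = (∏ i, w (y i)) * (kernel w q y x * u x * v y) := by
        rw [prod_weight_mul_kernel_comm]
        ring

lemma noise_const (hw : w ∈ stdSimplex ℝ α) (q : ι → ℝ) (c : ℝ) :
    noise w q (fun _ : ι → α => c) = fun _ => c := by
  ext x
  simp [noise, ← sum_mul, sum_kernel hw]

lemma noise_sub (w : α → ℝ) (q : ι → ℝ) (u v : (ι → α) → ℝ) :
    noise w q (u - v) = noise w q u - noise w q v := by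
  ext x
  simp [noise, mul_sub, sum_sub_distrib]

lemma noise_smul (w : α → ℝ) (q : ι → ℝ) (c : ℝ) (u : (ι → α) → ℝ) :
    noise w q (c • u) = c • noise w q u := by
  ext x
  simp [noise, mul_sum, mul_left_comm]

lemma noise_mono (hw : w ∈ stdSimplex ℝ α) (hq : q ∈ Set.Icc 0 1) {u v : (ι → α) → ℝ}
    (h : ∀ x, u x ≤ v x) (x : ι → α) : noise w q u x ≤ noise w q v x :=
  sum_le_sum fun y _ => mul_le_mul_of_nonneg_left (h y) (kernel_nonneg hw hq x y)

lemma noise_nonneg (hw : w ∈ stdSimplex ℝ α) (hq : q ∈ Set.Icc 0 1) {u : (ι → α) → ℝ}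
    (h : ∀ x, 0 ≤ u x) (x : ι → α) : 0 ≤ noise w q u x :=
  sum_nonneg fun y _ => mul_nonneg (kernel_nonneg hw hq x y) (h y)

lemma noise_le_of_forall_le (hw : w ∈ stdSimplex ℝ α) (hq : q ∈ Set.Icc 0 1) {u : (ι → α) → ℝ}
    {c : ℝ} (h : ∀ x, u x ≤ c) (x : ι → α) : noise w q u x ≤ c := by
  simpa [noise_const hw] using noise_mono hw hq h x

lemma le_noise_of_forall_le (hw : w ∈ stdSimplex ℝ α) (hq : q ∈ Set.Icc 0 1) {u : (ι → α) → ℝ}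
    {c : ℝ} (h : ∀ x, c ≤ u x) (x : ι → α) : c ≤ noise w q u x := by
  simpa [noise_const hw] using noise_mono hw hq h x

lemma noise_pos (hw : w ∈ stdSimplex ℝ α) (hq : q ∈ Set.Icc 0 1) {u : (ι → α) → ℝ}
    (h : ∀ x, 0 < u x) (x : ι → α) : 0 < noise w q u x := by
  obtain ⟨y, -, hy⟩ : ∃ y ∈ univ, 0 < kernel w q x y :=
    exists_lt_of_sum_lt (by simp [sum_kernel hw])
  exact sum_pos' (fun y _ => mul_nonneg (kernel_nonneg hw hq x y) (h y).le)
    ⟨y, mem_univ y, mul_pos hy (h y)⟩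

lemma noise_one (w : α → ℝ) (u : (ι → α) → ℝ) : noise w (1 : ι → ℝ) u = u := by
  classical
  ext x
  have hkernel : ∀ y, kernel w (1 : ι → ℝ) x y = if x = y then 1 else 0 := fun y => by
    simp only [kernel, Pi.one_apply, siteKernel_one, prod_ite_zero, prod_const_one,
      funext_iff, mem_univ, true_imp_iff]
  simp [noise, hkernel]

lemma noise_zero (w : α → ℝ) (u : (ι → α) → ℝ) (x : ι → α) :
    noise w (0 : ι → ℝ) u x = mean w u := by
  simp [noise, mean, kernel, siteKernel_zero]

lemma mean_noise (hw : w ∈ stdSimplex ℝ α) (q : ι → ℝ) (u : (ι → α) → ℝ) :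
    mean w (noise w q u) = mean w u := by
  have hone : noise w q (1 : (ι → α) → ℝ) = 1 := noise_const hw q 1
  simpa [hone] using mean_mul_noise w q 1 u

lemma prod_mul_le_noise (hw : w ∈ stdSimplex ℝ α) (hq : q ∈ Set.Icc 0 1) {u : (ι → α) → ℝ}
    (hu : ∀ x, 0 ≤ u x) (x : ι → α) : (∏ i, q i) * u x ≤ noise w q u x := by
  have hdiag : ∏ i, q i ≤ kernel w q x x := by
    refine prod_le_prod (fun i _ => hq.1 i) fun i _ => ?_
    have := mul_nonneg (sub_nonneg.2 (hq.2 i)) (hw.1 (x i))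
    simp only [siteKernel, if_true, Pi.one_apply] at this ⊢
    linarith
  exact (mul_le_mul_of_nonneg_right hdiag (hu x)).trans
    (single_le_sum (f := fun y => kernel w q x y * u y)
      (fun y _ => mul_nonneg (kernel_nonneg hw hq x y) (hu y)) (mem_univ x))

lemma noise_sq_le (hw : w ∈ stdSimplex ℝ α) (hq : q ∈ Set.Icc 0 1) (u : (ι → α) → ℝ)
    (x : ι → α) : (noise w q u x) ^ 2 ≤ noise w q (fun y => u y ^ 2) x := by
  simpa [noise] using (even_two.convexOn_pow (𝕜 := ℝ)).map_sum_le
    (t := univ) (w := kernel w q x) (p := u) (fun y _ => kernel_nonneg hw hq x y)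
    (sum_kernel hw q x) (fun _ _ => Set.mem_univ _)

lemma noise_rpow_le (hw : w ∈ stdSimplex ℝ α) (hq : q ∈ Set.Icc 0 1) {u : (ι → α) → ℝ}
    (hu : ∀ x, 0 ≤ u x) {s : ℝ} (hs : s ∈ Set.Icc 0 1) (x : ι → α) :
    noise w q (fun y => u y ^ s) x ≤ (noise w q u x) ^ s := by
  simpa [noise] using (Real.concaveOn_rpow hs.1 hs.2).le_map_sum
    (t := univ) (w := kernel w q x) (p := u) (fun y _ => kernel_nonneg hw hq x y)
    (sum_kernel hw q x) (fun y _ => hu y)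

lemma continuous_noise (w : α → ℝ) (u : (ι → α) → ℝ) (x : ι → α) :
    Continuous (fun s : ℝ => noise w (fun _ : ι => s) u x) := by
  unfold noise kernel siteKernel
  fun_prop

end Noise

section Avg

variable {ι α : Type*} [DecidableEq ι] [Fintype α] {w : α → ℝ}

/-- Averaging over the coordinate `i`. -/
noncomputable def avg (w : α → ℝ) (i : ι) (u : (ι → α) → ℝ) (x : ι → α) : ℝ :=
  ∑ z, w z * u (update x i z)

lemma avg_update (w : α → ℝ) (i : ι) (u : (ι → α) → ℝ) (x : ι → α) (z : α) :
    avg w i u (update x i z) = avg w i u x := by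
  simp [avg]

lemma avg_mul_of_update_eq (w : α → ℝ) (i : ι) {k : (ι → α) → ℝ}
    (hk : ∀ x z, k (update x i z) = k x) (u : (ι → α) → ℝ) :
    avg w i (k * u) = k * avg w i u := by
  ext x
  simp [avg, hk, mul_sum, mul_left_comm]

lemma avg_sub (w : α → ℝ) (i : ι) (u v : (ι → α) → ℝ) :
    avg w i (u - v) = avg w i u - avg w i v := by
  ext x
  simp [avg, mul_sub, sum_sub_distrib]

lemma avg_nonneg (hw : w ∈ stdSimplex ℝ α) (i : ι) {u : (ι → α) → ℝ} (h : ∀ x, 0 ≤ u x)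
    (x : ι → α) : 0 ≤ avg w i u x :=
  sum_nonneg fun z _ => mul_nonneg (hw.1 z) (h _)

lemma avg_avg (hw : w ∈ stdSimplex ℝ α) (i : ι) (u : (ι → α) → ℝ) :
    avg w i (avg w i u) = avg w i u := by
  ext x
  conv_lhs => rw [avg]
  simp only [avg_update, ← sum_mul, hw.2, one_mul]

lemma avg_pos (hw : w ∈ stdSimplex ℝ α) (i : ι) {u : (ι → α) → ℝ} (h : ∀ x, 0 < u x)
    (x : ι → α) : 0 < avg w i u x := by
  obtain ⟨z, -, hz⟩ : ∃ z ∈ univ, 0 < w z := exists_lt_of_sum_lt (by simp [hw.2])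
  exact sum_pos' (fun a _ => mul_nonneg (hw.1 a) (h _).le) ⟨z, mem_univ z, mul_pos hz (h _)⟩

lemma avg_rpow_le (hw : w ∈ stdSimplex ℝ α) (i : ι) {u : (ι → α) → ℝ} (hu : ∀ x, 0 ≤ u x)
    {s : ℝ} (hs : s ∈ Set.Icc 0 1) (x : ι → α) :
    avg w i (fun y => u y ^ s) x ≤ (avg w i u x) ^ s := by
  simpa [avg] using (Real.concaveOn_rpow hs.1 hs.2).le_map_sum
    (t := univ) (w := w) (p := fun z => u (update x i z)) (fun z _ => hw.1 z) hw.2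
    (fun z _ => hu _)

end Avg

section AvgNoise

variable {ι α : Type*} [Fintype ι] [DecidableEq ι] [Fintype α] {w : α → ℝ} {q : ι → ℝ}

omit [Fintype ι] in
lemma update_mem_Icc (hq : q ∈ Set.Icc 0 1) (i : ι) {c : ℝ} (hc : c ∈ Set.Icc 0 1) :
    update q i c ∈ Set.Icc (0 : ι → ℝ) 1 := by
  constructor <;> intro j <;> obtain rfl | hj := eq_or_ne j i
  · simpa using hc.1
  · simpa [hj] using hq.1 j
  · simpa using hc.2
  · simpa [hj] using hq.2 j

omit [Fintype α] in
lemma kernel_update_left (w : α → ℝ) (q : ι → ℝ) (i : ι) (z : α) (x y : ι → α) :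
    kernel w q (update x i z) y
      = siteKernel w (q i) z (y i) * ∏ j ∈ univ.erase i, siteKernel w (q j) (x j) (y j) := by
  rw [kernel, ← mul_prod_erase _ _ (mem_univ i), update_self]
  congr 1
  exact prod_congr rfl fun j hj => by rw [update_of_ne (ne_of_mem_erase hj)]

omit [Fintype α] in
lemma kernel_update_param (w : α → ℝ) (q : ι → ℝ) (i : ι) (c : ℝ) (x y : ι → α) :
    kernel w (update q i c) x y
      = siteKernel w c (x i) (y i) * ∏ j ∈ univ.erase i, siteKernel w (q j) (x j) (y j) := by
  rw [kernel, ← mul_prod_erase _ _ (mem_univ i), update_self]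
  congr 1
  exact prod_congr rfl fun j hj => by rw [update_of_ne (ne_of_mem_erase hj)]

lemma noise_split (w : α → ℝ) (q : ι → ℝ) (i : ι) (u : (ι → α) → ℝ) (x : ι → α) :
    noise w q u x
      = q i * noise w (update q i 1) u x + (1 - q i) * noise w (update q i 0) u x := by
  classical
  simp only [noise, mul_sum, ← sum_add_distrib]
  refine sum_congr rfl fun y _ => ?_
  have hkernel := kernel_update_param w q i (q i) x y
  rw [update_eq_self] at hkernel
  rw [hkernel, kernel_update_param, kernel_update_param, siteKernel_one, siteKernel_zero,
    siteKernel_apply]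
  ring

lemma avg_noise (hw : w ∈ stdSimplex ℝ α) (i : ι) (q : ι → ℝ) (u : (ι → α) → ℝ) :
    avg w i (noise w q u) = noise w (update q i 0) u := by
  ext x
  simp only [avg, noise, mul_sum]
  rw [sum_comm]
  refine sum_congr rfl fun y _ => ?_
  simp only [kernel_update_left, kernel_update_param, siteKernel_zero, ← mul_assoc, ← sum_mul,
    sum_weight_mul_siteKernel hw]

lemma avg_eq_noise (hw : w ∈ stdSimplex ℝ α) (i : ι) (u : (ι → α) → ℝ) :
    avg w i u = noise w (update 1 i 0) u := by
  rw [← avg_noise hw, noise_one]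

lemma noise_avg (hw : w ∈ stdSimplex ℝ α) (i : ι) (q : ι → ℝ) (u : (ι → α) → ℝ) :
    noise w q (avg w i u) = avg w i (noise w q u) := by
  rw [avg_eq_noise hw, avg_eq_noise hw, noise_noise hw, noise_noise hw, mul_comm]

lemma mean_avg (hw : w ∈ stdSimplex ℝ α) (i : ι) (u : (ι → α) → ℝ) :
    mean w (avg w i u) = mean w u := by
  rw [avg_eq_noise hw, mean_noise hw]

lemma mean_mul_avg (hw : w ∈ stdSimplex ℝ α) (i : ι) (u v : (ι → α) → ℝ) :
    mean w (u * avg w i v) = mean w (avg w i u * v) := by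
  rw [avg_eq_noise hw, avg_eq_noise hw, mean_mul_noise]

lemma mul_avg_noise_le (hw : w ∈ stdSimplex ℝ α) (hq : q ∈ Set.Icc 0 1) (i : ι)
    {u : (ι → α) → ℝ} (hu : ∀ x, 0 ≤ u x) (x : ι → α) :
    (1 - q i) * avg w i (noise w q u) x ≤ noise w q u x := by
  rw [noise_split w q i u x, avg_noise hw]
  have := noise_nonneg hw (update_mem_Icc hq i ⟨zero_le_one, le_rfl⟩) hu x
  linarith [mul_nonneg (hq.1 i) this]

omit [Fintype α] in
lemma hasDerivAt_kernel (w : α → ℝ) (q : ℝ) (x y : ι → α) :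
    HasDerivAt (fun s : ℝ => kernel w (fun _ => s) x y)
      (∑ i, (kernel w (update (fun _ => q) i 1) x y
        - kernel w (update (fun _ => q) i 0) x y)) q := by
  classical
  have hsite : ∀ a b : α, HasDerivAt (fun s : ℝ => siteKernel w s a b)
      (siteKernel w 1 a b - siteKernel w 0 a b) q := fun a b => by
    refine (((hasDerivAt_id q).mul_const (if a = b then (1 : ℝ) else 0)).add
      (((hasDerivAt_id q).const_sub 1).mul_const (w b))).congr_deriv ?_ |>.congr_of_eventuallyEq ?_
    · rw [siteKernel_one, siteKernel_zero]
      ring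
    · exact .of_forall fun s => by simp [siteKernel_apply]
  refine (HasDerivAt.fun_finsetProd (u := (univ : Finset ι))
    fun i _ => hsite (x i) (y i)).congr_deriv (sum_congr rfl fun i _ => ?_)
  rw [kernel_update_param, kernel_update_param, smul_eq_mul]
  ring

lemma hasDerivAt_noise (hw : w ∈ stdSimplex ℝ α) (u : (ι → α) → ℝ) (x : ι → α) {q : ℝ}
    (hq : q ≠ 0) :
    HasDerivAt (fun s : ℝ => noise w (fun _ : ι => s) u x)
      (q⁻¹ * ∑ i, (noise w (fun _ => q) u x - avg w i (noise w (fun _ => q) u) x)) q := by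
  refine (HasDerivAt.fun_sum (u := (univ : Finset (ι → α))) fun y _ =>
    (hasDerivAt_kernel w q x y).mul_const (u y)).congr_deriv ?_
  have hsite : ∀ i, noise w (fun _ => q) u x - avg w i (noise w (fun _ => q) u) x
      = q * (noise w (update (fun _ => q) i 1) u x - noise w (update (fun _ => q) i 0) u x) := by
    intro i
    rw [noise_split w (fun _ => q) i u x, avg_noise hw]
    ring
  simp only [hsite, ← mul_sum]
  rw [inv_mul_cancel_left₀ hq]
  simp only [noise, ← sum_sub_distrib, ← sub_mul, sum_mul]
  exact sum_comm

end AvgNoise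

section Resample

variable {ι α : Type*} {w : α → ℝ}

/-- The law of the letter that replaces the current one; `none` means that it is kept. -/
noncomputable def optWeight (w : α → ℝ) (q : ℝ) : Option α → ℝ
  | none => q
  | some z => (1 - q) * w z

/-- Replace the letters of `x` at the sites where `o` is not `none`. -/
def resample (o : ι → Option α) (x : ι → α) : ι → α := fun i => (o i).getD (x i)

variable [Fintype α]

lemma optWeight_nonneg (hw : w ∈ stdSimplex ℝ α) {q : ℝ} (hq : q ∈ Set.Icc 0 1) :
    ∀ o : Option α, 0 ≤ optWeight w q o
  | none => hq.1
  | some z => mul_nonneg (sub_nonneg.2 hq.2) (hw.1 z)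

variable [Fintype ι] [DecidableEq ι]

lemma kernel_eq_sum_optWeight [DecidableEq α] (w : α → ℝ) (q : ι → ℝ) (x y : ι → α) :
    kernel w q x y
      = ∑ o : ι → Option α, (∏ i, optWeight w (q i) (o i)) * if resample o x = y then 1 else 0 := by
  have hsite : ∀ i, siteKernel w (q i) (x i) (y i)
      = ∑ o, optWeight w (q i) o * if o.getD (x i) = y i then 1 else 0 := fun i => by
    rw [Fintype.sum_option]
    simp [siteKernel_apply, optWeight]
  simp only [kernel, hsite, Fintype.prod_sum, prod_mul_distrib, prod_ite_zero, prod_const_one,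
    funext_iff, resample, mem_univ, true_imp_iff]

lemma noise_eq_sum_resample (w : α → ℝ) (q : ι → ℝ) (u : (ι → α) → ℝ) (x : ι → α) :
    noise w q u x = ∑ o : ι → Option α, (∏ i, optWeight w (q i) (o i)) * u (resample o x) := by
  classical
  simp only [noise, kernel_eq_sum_optWeight, sum_mul]
  rw [sum_comm]
  simp

lemma noise_update_of_eq_one (w : α → ℝ) {q : ι → ℝ} {i : ι} (hi : q i = 1) (u : (ι → α) → ℝ)
    (x : ι → α) (z : α) :
    noise w q u (update x i z) = noise w q (fun y => u (update y i z)) x := by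
  rw [noise_eq_sum_resample, noise_eq_sum_resample]
  refine sum_congr rfl fun o _ => ?_
  cases ho : o i with
  | some a =>
    rw [prod_eq_zero (mem_univ i) (by simp [ho, hi, optWeight]), zero_mul, zero_mul]
  | none =>
    congr 2
    ext j
    obtain rfl | hj := eq_or_ne j i
    · simp [resample, ho]
    · simp [resample, hj]

end Resample

/-! ### Schrödinger factorization of a density -/

section Factorization

variable {ι α : Type*} [Fintype ι] [DecidableEq ι] [Fintype α] {w : α → ℝ}

lemma log_noise_exp_le (hw : w ∈ stdSimplex ℝ α) {q : ι → ℝ} (hq : q ∈ Set.Icc 0 1)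
    {u v : (ι → α) → ℝ} {c : ℝ} (h : ∀ x, u x ≤ v x + c) (x : ι → α) :
    Real.log (noise w q (fun y => Real.exp (u y)) x)
      ≤ Real.log (noise w q (fun y => Real.exp (v y)) x) + c := by
  have hu := noise_pos hw hq (u := fun y => Real.exp (u y)) (fun _ => Real.exp_pos _) x
  have hv := noise_pos hw hq (u := fun y => Real.exp (v y)) (fun _ => Real.exp_pos _) x
  rw [← Real.log_exp c, ← Real.log_mul hv.ne' (Real.exp_pos c).ne', mul_comm]
  refine Real.log_le_log hu ?_
  have hmono := noise_mono hw hq (u := fun y => Real.exp (u y))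
    (v := Real.exp c • fun y => Real.exp (v y)) (fun y => by
      rw [Pi.smul_apply, smul_eq_mul, ← Real.exp_add, add_comm]
      exact Real.exp_le_exp.2 (h y)) x
  rwa [noise_smul] at hmono

lemma abs_log_noise_exp_sub_le (hw : w ∈ stdSimplex ℝ α) {q : ι → ℝ} (hq : q ∈ Set.Icc 0 1)
    {u v : (ι → α) → ℝ} {c : ℝ} (h : ∀ x, |u x - v x| ≤ c) (x : ι → α) :
    |Real.log (noise w q (fun y => Real.exp (u y)) x)
      - Real.log (noise w q (fun y => Real.exp (v y)) x)| ≤ c := by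
  have huv := log_noise_exp_le hw hq (fun x => by linarith [(abs_le.1 (h x)).2] :
    ∀ x, u x ≤ v x + c) x
  have hvu := log_noise_exp_le hw hq (fun x => by linarith [(abs_le.1 (h x)).1] :
    ∀ x, v x ≤ u x + c) x
  exact abs_le.2 ⟨by linarith, by linarith⟩

/-- The logarithm of the solution `f` of `f * T ((T f) ^ (-γ)) = h`, with `T = noise w q`, is a
fixed point of this map. -/
noncomputable def logFactorMap (w : α → ℝ) (q : ι → ℝ) (γ : ℝ) (h u : (ι → α) → ℝ) :
    (ι → α) → ℝ :=
  fun x => Real.log (h x) - Real.log (noise w q (fun y =>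
    Real.exp (-γ * Real.log (noise w q (fun z => Real.exp (u z)) y))) x)

lemma contractingWith_logFactorMap (hw : w ∈ stdSimplex ℝ α) {q : ι → ℝ}
    (hq : q ∈ Set.Icc 0 1) {γ : ℝ} (hγ₀ : 0 ≤ γ) (hγ₁ : γ < 1) (h : (ι → α) → ℝ) :
    ContractingWith γ.toNNReal (logFactorMap w q γ h) := by
  refine ⟨by simpa using hγ₁, LipschitzWith.of_dist_le_mul fun u v => ?_⟩
  rw [Real.coe_toNNReal _ hγ₀]
  refine (dist_pi_le_iff (by positivity)).2 fun x => ?_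
  have hinner := abs_log_noise_exp_sub_le hw hq (u := u) (v := v) (c := dist u v) fun x => by
    rw [← Real.dist_eq]
    exact dist_le_pi_dist u v x
  rw [Real.dist_eq, logFactorMap, logFactorMap, sub_sub_sub_cancel_left, abs_sub_comm]
  refine abs_log_noise_exp_sub_le hw hq (fun y => ?_) x
  rw [← mul_sub, abs_mul, abs_neg, abs_of_nonneg hγ₀]
  exact mul_le_mul_of_nonneg_left (hinner y) hγ₀

lemma exists_mul_noise_rpow_eq (hw : w ∈ stdSimplex ℝ α) {q : ι → ℝ} (hq : q ∈ Set.Icc 0 1)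
    {γ : ℝ} (hγ₀ : 0 ≤ γ) (hγ₁ : γ < 1) {h : (ι → α) → ℝ} (hh : ∀ x, 0 < h x) :
    ∃ f : (ι → α) → ℝ, (∀ x, 0 < f x) ∧
      ∀ x, f x * noise w q (fun y => noise w q f y ^ (-γ)) x = h x := by
  have hcontr := contractingWith_logFactorMap hw hq hγ₀ hγ₁ h
  obtain ⟨u, hu⟩ : ∃ u, logFactorMap w q γ h u = u :=
    ⟨_, hcontr.fixedPoint_isFixedPt⟩
  refine ⟨fun x => Real.exp (u x), fun _ => Real.exp_pos _, fun x => ?_⟩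
  have hrpow : ∀ y, noise w q (fun x => Real.exp (u x)) y ^ (-γ)
      = Real.exp (-γ * Real.log (noise w q (fun z => Real.exp (u z)) y)) := fun y => by
    rw [Real.rpow_def_of_pos (noise_pos hw hq (fun _ => Real.exp_pos _) y), mul_comm]
  have hpos := noise_pos hw hq (u := fun y => Real.exp (-γ * Real.log (noise w q
    (fun z => Real.exp (u z)) y))) (fun _ => Real.exp_pos _) x
  simp only [hrpow]
  conv_lhs => enter [1]; rw [← hu]
  rw [logFactorMap, Real.exp_sub, Real.exp_log (hh x), Real.exp_log hpos,
    div_mul_cancel₀ _ hpos.ne']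

/-- The parameter of the noise operator that resamples each site with probability `e^{-ℓ}`. -/
noncomputable abbrev keepProb (ℓ : ℝ) : ι → ℝ := fun _ => 1 - Real.exp (-ℓ)

/-- The second factor `g = (T f) ^ (-(1 - 1/ℓ))` of the density `f * T g`, where `T` is the noise
operator with parameter `keepProb ℓ`. -/
noncomputable def dualFactor (w : α → ℝ) (ℓ : ℝ) (f : (ι → α) → ℝ) (x : ι → α) : ℝ :=
  noise w (keepProb ℓ) f x ^ (-(1 - ℓ⁻¹))

/-- The density `T f * g = (T f) ^ (1/ℓ)` at the other end of the bridge that starts at `f * T g`,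
where `g = dualFactor w ℓ f`. -/
noncomputable def terminalDensity (w : α → ℝ) (ℓ : ℝ) (f : (ι → α) → ℝ) (x : ι → α) : ℝ :=
  noise w (keepProb ℓ) f x ^ ℓ⁻¹

/-- The positive function `f` solves the Schrödinger system `h = f * T g`, `g = dualFactor w ℓ f`,
with the density `h` at the initial end. -/
structure IsSchrodingerFactor (w : α → ℝ) (ℓ : ℝ) (h f : (ι → α) → ℝ) : Prop where
  pos : ∀ x, 0 < f x
  mul_noise_dualFactor : ∀ x, f x * noise w (keepProb ℓ) (dualFactor w ℓ f) x = h x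

omit [Fintype ι] [DecidableEq ι] in
lemma keepProb_mem_Icc {ℓ : ℝ} (hℓ : 0 ≤ ℓ) : (keepProb ℓ : ι → ℝ) ∈ Set.Icc 0 1 :=
  ⟨fun _ => sub_nonneg.2 (Real.exp_le_one_iff.2 (by linarith)),
    fun _ => sub_le_self _ (Real.exp_pos _).le⟩

lemma exists_isSchrodingerFactor (hw : w ∈ stdSimplex ℝ α) {ℓ : ℝ} (hℓ : 1 ≤ ℓ)
    {h : (ι → α) → ℝ} (hh : ∀ x, 0 < h x) : ∃ f, IsSchrodingerFactor w ℓ h f := by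
  have hℓ₀ : 0 < ℓ := by linarith
  obtain ⟨f, hf, hfh⟩ := exists_mul_noise_rpow_eq hw (keepProb_mem_Icc hℓ₀.le) (γ := 1 - ℓ⁻¹)
    (sub_nonneg.2 (inv_le_one_of_one_le₀ hℓ)) (sub_lt_self _ (inv_pos.2 hℓ₀)) hh
  exact ⟨f, hf, hfh⟩

section Positive

variable {ℓ : ℝ} {f : (ι → α) → ℝ}

lemma noise_keepProb_pos (hw : w ∈ stdSimplex ℝ α) (hℓ : 0 ≤ ℓ) (hf : ∀ x, 0 < f x)
    (x : ι → α) : 0 < noise w (keepProb ℓ) f x :=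
  noise_pos hw (keepProb_mem_Icc hℓ) hf x

lemma dualFactor_pos (hw : w ∈ stdSimplex ℝ α) (hℓ : 0 ≤ ℓ) (hf : ∀ x, 0 < f x)
    (x : ι → α) : 0 < dualFactor w ℓ f x :=
  Real.rpow_pos_of_pos (noise_keepProb_pos hw hℓ hf x) _

lemma terminalDensity_pos (hw : w ∈ stdSimplex ℝ α) (hℓ : 0 ≤ ℓ) (hf : ∀ x, 0 < f x)
    (x : ι → α) : 0 < terminalDensity w ℓ f x :=
  Real.rpow_pos_of_pos (noise_keepProb_pos hw hℓ hf x) _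

lemma noise_mul_dualFactor (hw : w ∈ stdSimplex ℝ α) (hℓ : 0 ≤ ℓ) (hf : ∀ x, 0 < f x)
    (x : ι → α) :
    noise w (keepProb ℓ) f x * dualFactor w ℓ f x = terminalDensity w ℓ f x := by
  have hpos := noise_keepProb_pos hw hℓ hf x
  rw [dualFactor, terminalDensity, neg_sub, mul_comm, ← Real.rpow_add_one hpos.ne', sub_add_cancel]

lemma terminalDensity_rpow (hw : w ∈ stdSimplex ℝ α) (hℓ : 0 < ℓ) (hf : ∀ x, 0 < f x)
    (x : ι → α) : terminalDensity w ℓ f x ^ ℓ = noise w (keepProb ℓ) f x := by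
  rw [terminalDensity, Real.rpow_inv_rpow (noise_keepProb_pos hw hℓ.le hf x).le hℓ.ne']

lemma avg_terminalDensity_le (hw : w ∈ stdSimplex ℝ α) (hℓ : 1 ≤ ℓ) (hf : ∀ x, 0 < f x)
    (i : ι) (x : ι → α) :
    avg w i (terminalDensity w ℓ f) x ≤ Real.exp 1 * terminalDensity w ℓ f x := by
  have hℓ₀ : 0 < ℓ := by linarith
  set v := noise w (keepProb ℓ) f
  have hvpos : ∀ x, 0 < v x := noise_keepProb_pos hw hℓ₀.le hf
  have havg : avg w i v x ≤ Real.exp ℓ * v x := by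
    have h := mul_avg_noise_le hw (keepProb_mem_Icc hℓ₀.le) i (fun x => (hf x).le) x
    rwa [sub_sub_cancel, Real.exp_neg, inv_mul_le_iff₀ (Real.exp_pos ℓ)] at h
  have hθ : ℓ⁻¹ ∈ Set.Icc (0 : ℝ) 1 := ⟨by positivity, inv_le_one_of_one_le₀ hℓ⟩
  calc avg w i (terminalDensity w ℓ f) x
      ≤ avg w i v x ^ ℓ⁻¹ := avg_rpow_le hw i (fun x => (hvpos x).le) hθ x
    _ ≤ (Real.exp ℓ * v x) ^ ℓ⁻¹ :=
        Real.rpow_le_rpow (avg_nonneg hw i (fun x => (hvpos x).le) x) havg hθ.1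
    _ = Real.exp 1 * terminalDensity w ℓ f x := by
        rw [Real.mul_rpow (Real.exp_pos _).le (hvpos x).le, ← Real.exp_mul,
          mul_inv_cancel₀ hℓ₀.ne', terminalDensity]

lemma exp_mul_le_noise_keepProb (hw : w ∈ stdSimplex ℝ α) (hℓ : 0 < ℓ) (hf : ∀ x, 0 < f x)
    {c : ℝ} {x : ι → α} (hx : Real.exp c ≤ terminalDensity w ℓ f x) :
    Real.exp (c * ℓ) ≤ noise w (keepProb ℓ) f x := by
  rw [← terminalDensity_rpow hw hℓ hf, Real.exp_mul]
  exact Real.rpow_le_rpow (Real.exp_pos _).le hx hℓ.le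

end Positive

namespace IsSchrodingerFactor

variable {ℓ p : ℝ} {h f : (ι → α) → ℝ}

lemma mean_terminalDensity (hw : w ∈ stdSimplex ℝ α) (hℓ : 0 ≤ ℓ)
    (hF : IsSchrodingerFactor w ℓ h f) : mean w (terminalDensity w ℓ f) = mean w h := by
  rw [← funext (noise_mul_dualFactor hw hℓ hF.pos), ← funext hF.mul_noise_dualFactor]
  exact (mean_mul_noise w (keepProb ℓ) f (dualFactor w ℓ f)).symm

lemma le_exp_mul_rpow (hw : w ∈ stdSimplex ℝ α) (hℓ : 1 ≤ ℓ)
    (hF : IsSchrodingerFactor w ℓ h f) (hhp : ∀ x, h x ≤ Real.exp p) {M : ℝ}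
    (hM : ∀ x, noise w (keepProb ℓ) f x ≤ M) (x : ι → α) :
    f x ≤ Real.exp p * M ^ (1 - ℓ⁻¹) := by
  have hvpos := noise_keepProb_pos hw (zero_le_one.trans hℓ) hF.pos
  have hM₀ : 0 < M := (hvpos x).trans_le (hM x)
  have hdual : M ^ (-(1 - ℓ⁻¹)) ≤ noise w (keepProb ℓ) (dualFactor w ℓ f) x :=
    le_noise_of_forall_le hw (keepProb_mem_Icc (zero_le_one.trans hℓ)) (fun y =>
      Real.rpow_le_rpow_of_nonpos (hvpos y) (hM y)
        (neg_nonpos.2 (sub_nonneg.2 (inv_le_one_of_one_le₀ hℓ)))) x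
  have hmul : f x * M ^ (-(1 - ℓ⁻¹)) ≤ Real.exp p :=
    (mul_le_mul_of_nonneg_left hdual (hF.pos x).le).trans
      ((hF.mul_noise_dualFactor x).trans_le (hhp x))
  rwa [Real.rpow_neg hM₀.le, ← div_eq_mul_inv, div_le_iff₀ (Real.rpow_pos_of_pos hM₀ _)] at hmul

/-- At a maximum `M` of `T f`, the bound `f ≤ e^p M ^ (1 - 1/ℓ)` gives `M ≤ e^p M ^ (1 - 1/ℓ)`. -/
lemma terminalDensity_le (hw : w ∈ stdSimplex ℝ α) (hℓ : 1 ≤ ℓ)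
    (hF : IsSchrodingerFactor w ℓ h f) (hhp : ∀ x, h x ≤ Real.exp p) (x : ι → α) :
    terminalDensity w ℓ f x ≤ Real.exp p := by
  have hℓ₀ : 0 < ℓ := by linarith
  have hvpos := noise_keepProb_pos hw hℓ₀.le hF.pos
  have : Nonempty (ι → α) := ⟨x⟩
  obtain ⟨y, hy⟩ := Finite.exists_max (noise w (keepProb ℓ) f)
  refine (Real.rpow_le_rpow (hvpos x).le (hy x) (by positivity)).trans ?_
  have hmax : noise w (keepProb ℓ) f y
      ≤ Real.exp p * noise w (keepProb ℓ) f y ^ (1 - ℓ⁻¹) :=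
    noise_le_of_forall_le hw (keepProb_mem_Icc hℓ₀.le) (hF.le_exp_mul_rpow hw hℓ hhp hy) y
  have hsplit : noise w (keepProb ℓ) f y
      = noise w (keepProb ℓ) f y ^ ℓ⁻¹ * noise w (keepProb ℓ) f y ^ (1 - ℓ⁻¹) := by
    rw [← Real.rpow_add (hvpos y), add_sub_cancel, Real.rpow_one]
  nth_rewrite 1 [hsplit] at hmax
  exact le_of_mul_le_mul_right hmax (Real.rpow_pos_of_pos (hvpos y) _)

lemma le_exp (hw : w ∈ stdSimplex ℝ α) (hℓ : 1 ≤ ℓ) (hF : IsSchrodingerFactor w ℓ h f)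
    (hhp : ∀ x, h x ≤ Real.exp p) (x : ι → α) : f x ≤ Real.exp (p * ℓ) := by
  have hℓ₀ : 0 < ℓ := by linarith
  have hM : ∀ x, noise w (keepProb ℓ) f x ≤ Real.exp (p * ℓ) := fun x => by
    rw [← terminalDensity_rpow hw hℓ₀ hF.pos, Real.exp_mul]
    exact Real.rpow_le_rpow (terminalDensity_pos hw hℓ₀.le hF.pos x).le
      (hF.terminalDensity_le hw hℓ hhp x) hℓ₀.le
  refine (hF.le_exp_mul_rpow hw hℓ hhp hM x).trans_eq ?_
  rw [← Real.exp_mul, ← Real.exp_add]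
  congr 1
  field_simp
  ring

end IsSchrodingerFactor

end Factorization

/-! ### Noise tilted by the Hamming distance -/

section Hamming

variable {ι α : Type*} [Fintype ι] [DecidableEq α]

lemma pow_hammingDist (c : ℝ) (x y : ι → α) :
    c ^ hammingDist x y = ∏ i, if x i ≠ y i then c else 1 := by
  simp [prod_ite, hammingDist]

variable [DecidableEq ι] [Fintype α] {w : α → ℝ}

lemma sum_pow_hammingDist_mul_kernel_le (hw : w ∈ stdSimplex ℝ α) {δ : ℝ} (hδ₀ : 0 < δ)
    (hδ₁ : δ ≤ 1) (x : ι → α) :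
    ∑ y, (2 / δ) ^ hammingDist x y * kernel w (fun _ => 1 - δ) x y ≤ 3 ^ Fintype.card ι := by
  have hδ : 1 - δ ∈ Set.Icc (0 : ℝ) 1 := ⟨by linarith, by linarith⟩
  have hsite : ∀ a b, (if a ≠ b then 2 / δ else 1) * siteKernel w (1 - δ) a b
      ≤ (if a = b then 1 else 0) + 2 * w b := fun a b => by
    have hwb := hw.1 b
    obtain rfl | h := eq_or_ne a b
    · simpa using (siteKernel_le_one hw hδ a a).trans (by linarith)
    · rw [if_pos h, if_neg h, siteKernel_apply, if_neg h]
      apply le_of_eq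
      field_simp
      ring
  simp only [pow_hammingDist, kernel, ← prod_mul_distrib]
  rw [← Fintype.prod_sum fun i a => (if x i ≠ a then 2 / δ else 1) * siteKernel w (1 - δ) (x i) a,
    ← card_univ, ← prod_const]
  refine prod_le_prod (fun i _ => sum_nonneg fun a _ => mul_nonneg (by split_ifs <;> positivity)
    (siteKernel_nonneg hw hδ _ _)) fun i _ => (sum_le_sum fun a _ => hsite (x i) a).trans ?_
  rw [sum_add_distrib, ← mul_sum, hw.2, sum_ite_eq, if_pos (mem_univ _)]
  norm_num

variable {ℓ p : ℝ} {m : ℕ} {f : (ι → α) → ℝ}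

lemma sum_far_le (hw : w ∈ stdSimplex ℝ α) (hℓ : 0 ≤ ℓ)
    (hsmall : 3 ^ Fintype.card ι * Real.exp (-ℓ) ≤ 1) (hm : p + 3 ≤ m)
    (hf₀ : ∀ x, 0 ≤ f x) (hf : ∀ x, f x ≤ Real.exp (p * ℓ)) (x : ι → α) :
    ∑ y with m < hammingDist x y, 2 ^ hammingDist x y * (kernel w (keepProb ℓ) x y * f y)
        ≤ Real.exp (-3 * ℓ) := by
  have hk := kernel_nonneg hw (keepProb_mem_Icc hℓ) x
  set δ := Real.exp (-ℓ) with hδ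
  have hδ₀ : 0 < δ := Real.exp_pos _
  have hδ₁ : δ ≤ 1 := Real.exp_le_one_iff.2 (by linarith)
  -- the kernel at distance `d > m` carries `δ ^ d`, of which `δ ^ (m + 1)` is spent on `f`
  have hfar : ∀ y, m < hammingDist x y → (2 : ℝ) ^ hammingDist x y
      ≤ δ ^ (m + 1) * (2 / δ) ^ hammingDist x y := fun y hy => by
    rw [div_pow, mul_div_assoc', le_div_iff₀ (by positivity), mul_comm]
    gcongr ?_ * _
    exact pow_le_pow_of_le_one hδ₀.le hδ₁ hy
  calc ∑ y with m < hammingDist x y, 2 ^ hammingDist x y * (kernel w (keepProb ℓ) x y * f y)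
      ≤ ∑ y with m < hammingDist x y, δ ^ (m + 1) * (2 / δ) ^ hammingDist x y *
          (kernel w (keepProb ℓ) x y * Real.exp (p * ℓ)) := by
        refine sum_le_sum fun y hy => mul_le_mul (hfar y (mem_filter.1 hy).2)
          (mul_le_mul_of_nonneg_left (hf y) (hk y)) (mul_nonneg (hk y) (hf₀ y)) (by positivity)
    _ ≤ ∑ y, δ ^ (m + 1) * (2 / δ) ^ hammingDist x y *
          (kernel w (keepProb ℓ) x y * Real.exp (p * ℓ)) :=
        sum_le_sum_of_subset_of_nonneg (filter_subset _ _) fun y _ _ =>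
          mul_nonneg (by positivity) (mul_nonneg (hk y) (Real.exp_pos _).le)
    _ = δ ^ (m + 1) * Real.exp (p * ℓ) *
          ∑ y, (2 / δ) ^ hammingDist x y * kernel w (fun _ => 1 - δ) x y := by
        rw [mul_sum]
        exact sum_congr rfl fun y _ => by ring
    _ ≤ δ ^ (m + 1) * Real.exp (p * ℓ) * 3 ^ Fintype.card ι :=
        mul_le_mul_of_nonneg_left (sum_pow_hammingDist_mul_kernel_le hw hδ₀ hδ₁ x) (by positivity)
    _ = (3 ^ Fintype.card ι * δ) * (δ ^ m * Real.exp (p * ℓ)) := by ring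
    _ ≤ 1 * (δ ^ m * Real.exp (p * ℓ)) := by gcongr
    _ ≤ Real.exp (-3 * ℓ) := by
        rw [one_mul, hδ, ← Real.exp_nat_mul, ← Real.exp_add]
        refine Real.exp_le_exp.2 ?_
        nlinarith

lemma sum_tilt_mul_kernel_mul_le (hw : w ∈ stdSimplex ℝ α) (hℓ : 0 ≤ ℓ)
    (hsmall : 3 ^ Fintype.card ι * Real.exp (-ℓ) ≤ 1) (hm : p + 3 ≤ m)
    (hf₀ : ∀ x, 0 ≤ f x) (hf : ∀ x, f x ≤ Real.exp (p * ℓ)) {x : ι → α}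
    (hx : Real.exp (-3 * ℓ) ≤ noise w (keepProb ℓ) f x) {c : ℕ → ℝ} {C : ℝ} (hC₀ : 0 ≤ C)
    (hC : ∀ d ≤ m, c d ≤ C) (hc : ∀ d, c d ≤ 2 ^ d) :
    ∑ y, c (hammingDist x y) * (kernel w (keepProb ℓ) x y * f y)
        ≤ (C + 1) * noise w (keepProb ℓ) f x := by
  have hkf : ∀ y, 0 ≤ kernel w (keepProb ℓ) x y * f y := fun y =>
    mul_nonneg (kernel_nonneg hw (keepProb_mem_Icc hℓ) x y) (hf₀ y)
  have hfar : ∑ y with m < hammingDist x y,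
      c (hammingDist x y) * (kernel w (keepProb ℓ) x y * f y) ≤ Real.exp (-3 * ℓ) :=
    (sum_le_sum fun y _ => mul_le_mul_of_nonneg_right (hc _) (hkf y)).trans
      (sum_far_le hw hℓ hsmall hm hf₀ hf x)
  have hnear : ∑ y with ¬ m < hammingDist x y,
      c (hammingDist x y) * (kernel w (keepProb ℓ) x y * f y)
        ≤ C * noise w (keepProb ℓ) f x := by
    rw [noise, mul_sum]
    exact (sum_le_sum fun y hy => mul_le_mul_of_nonneg_right
      (hC _ (not_lt.1 (mem_filter.1 hy).2)) (hkf y)).trans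
      (sum_le_sum_of_subset_of_nonneg (filter_subset _ _) fun y _ _ => mul_nonneg hC₀ (hkf y))
  rw [← sum_filter_add_sum_filter_not univ (fun y => m < hammingDist x y)]
  linarith

lemma sum_two_pow_hammingDist_mul_le (hw : w ∈ stdSimplex ℝ α) (hℓ : 0 ≤ ℓ)
    (hsmall : 3 ^ Fintype.card ι * Real.exp (-ℓ) ≤ 1) (hm : p + 3 ≤ m)
    (hf₀ : ∀ x, 0 ≤ f x) (hf : ∀ x, f x ≤ Real.exp (p * ℓ)) {x : ι → α}
    (hx : Real.exp (-3 * ℓ) ≤ noise w (keepProb ℓ) f x) :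
    ∑ y, 2 ^ hammingDist x y * (kernel w (keepProb ℓ) x y * f y)
        ≤ (2 ^ m + 1) * noise w (keepProb ℓ) f x :=
  sum_tilt_mul_kernel_mul_le (c := fun d => 2 ^ d) hw hℓ hsmall hm hf₀ hf hx (by positivity)
    (fun _ hd => pow_le_pow_right₀ one_le_two hd) fun _ => le_rfl

lemma sum_hammingDist_mul_le (hw : w ∈ stdSimplex ℝ α) (hℓ : 0 ≤ ℓ)
    (hsmall : 3 ^ Fintype.card ι * Real.exp (-ℓ) ≤ 1) (hm : p + 3 ≤ m)
    (hf₀ : ∀ x, 0 ≤ f x) (hf : ∀ x, f x ≤ Real.exp (p * ℓ)) {x : ι → α}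
    (hx : Real.exp (-3 * ℓ) ≤ noise w (keepProb ℓ) f x) :
    ∑ y, (hammingDist x y + 1) * (kernel w (keepProb ℓ) x y * f y)
        ≤ (m + 1 + 1) * noise w (keepProb ℓ) f x :=
  sum_tilt_mul_kernel_mul_le (c := fun d => d + 1) hw hℓ hsmall hm hf₀ hf hx (by positivity)
    (fun _ hd => by gcongr) fun _ => mod_cast Nat.succ_le_of_lt Nat.lt_two_pow_self

end Hamming

/-! ### Densities along the bridge -/

section ResampledNoise

variable {ι α : Type*} [Fintype ι] [DecidableEq ι] [Fintype α] {w : α → ℝ}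

lemma siteKernel_mul_le [DecidableEq α] (hw : w ∈ stdSimplex ℝ α) {a q : ℝ} (hq : 0 ≤ q)
    (hqa : q ≤ a) (ha : a ≤ 1) (x y : α) :
    siteKernel w (a * q) x y ≤ (if x ≠ y then 2 else 1) * siteKernel w q x y := by
  rw [siteKernel_apply, siteKernel_apply]
  have hwy := hw.1 y
  obtain rfl | h := eq_or_ne x y
  · simp only [ne_eq, not_true_eq_false, if_true, if_false]
    nlinarith only [mul_nonneg (mul_nonneg hq (sub_nonneg.2 ha))
      (sub_nonneg.2 (le_one_of_mem_stdSimplex hw x))]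
  · simp only [h, ne_eq, not_false_eq_true, if_true, if_false]
    have : 0 ≤ 2 * (1 - q) - (1 - a * q) := by
      nlinarith only [mul_nonneg hq (sub_nonneg.2 hqa), sq_nonneg (1 - q)]
    nlinarith only [mul_nonneg this hwy]

lemma noise_noise_resample (w : α → ℝ) (a q : ℝ) (f : (ι → α) → ℝ) (o : ι → Option α)
    (x : ι → α) :
    noise w (fun _ => a) (fun y => noise w (fun _ => q) f (resample o y)) x
      = ∑ s, (∏ i, ∑ c, siteKernel w a (x i) c * siteKernel w q ((o i).getD c) (s i)) * f s := by
  simp only [noise, mul_sum, ← mul_assoc]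
  rw [sum_comm]
  refine sum_congr rfl fun s _ => ?_
  rw [← sum_mul, Fintype.prod_sum fun i c =>
    siteKernel w a (x i) c * siteKernel w q ((o i).getD c) (s i)]
  simp only [prod_mul_distrib]
  rfl

lemma noise_noise_resample_le [DecidableEq α] (hw : w ∈ stdSimplex ℝ α) {a q : ℝ} (hq : 0 ≤ q)
    (hqa : q ≤ a) (ha : a ≤ 1) {f : (ι → α) → ℝ} (hf : ∀ x, 0 ≤ f x) (o : ι → Option α)
    (x : ι → α) :
    noise w (fun _ => a) (fun y => noise w (fun _ => q) f (resample o y)) x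
      ≤ ∑ y, 2 ^ hammingDist (resample o x) y *
          (kernel w (fun _ => q) (resample o x) y * f y) := by
  have hk := siteKernel_nonneg hw ⟨hq, hqa.trans ha⟩
  rw [noise_noise_resample]
  refine sum_le_sum fun s _ => ?_
  rw [← mul_assoc]
  refine mul_le_mul_of_nonneg_right ?_ (hf s)
  rw [pow_hammingDist, kernel, ← prod_mul_distrib]
  refine prod_le_prod (fun i _ => sum_nonneg fun c _ => mul_nonneg
    (siteKernel_nonneg hw ⟨hq.trans hqa, ha⟩ _ _) (hk _ _)) fun i _ => ?_
  simp only [resample]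
  obtain ho | ⟨z, ho⟩ := (o i).eq_none_or_eq_some
  · simp only [ho, Option.getD_none, sum_siteKernel_mul_siteKernel hw]
    exact siteKernel_mul_le hw hq hqa ha _ _
  · simp only [ho, Option.getD_some, ← sum_mul, sum_siteKernel hw]
    refine mul_le_mul_of_nonneg_right ?_ (hk _ _)
    split_ifs <;> norm_num

lemma sq_noise_indicator_mul_inv_le (hw : w ∈ stdSimplex ℝ α) {b : ι → ℝ}
    (hb : b ∈ Set.Icc 0 1) {g : (ι → α) → ℝ} (hg : ∀ x, 0 < g x) (s : Set (ι → α))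
    (x y : ι → α) :
    noise w b (s.indicator g) x ^ 2 * (noise w b g y)⁻¹
      ≤ ∑ o : ι → Option α, (∏ i, optWeight w (b i) (o i)) *
          (s.indicator g (resample o x) ^ 2 * (g (resample o y))⁻¹) := by
  have hc : ∀ o : ι → Option α, 0 ≤ ∏ i, optWeight w (b i) (o i) := fun o =>
    prod_nonneg fun i _ => optWeight_nonneg hw ⟨hb.1 i, hb.2 i⟩ (o i)
  rw [← div_eq_mul_inv, div_le_iff₀ (noise_pos hw hb hg y), noise_eq_sum_resample w b _ x,
    noise_eq_sum_resample w b g y]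
  refine sum_sq_le_sum_mul_sum_of_sq_le_mul univ (fun o _ => mul_nonneg (hc o)
    (mul_nonneg (sq_nonneg _) (inv_nonneg.2 (hg _).le)))
    (fun o _ => mul_nonneg (hc o) (hg _).le) fun o _ => le_of_eq ?_
  have := (hg (resample o y)).ne'
  field_simp

/-- Couple `noise w b g y` with `noise w b (s.indicator g) x` by resampling the same sites with the
same letters, and apply the Cauchy-Schwarz inequality. -/
lemma noise_inv_noise_mul_noise_indicator_le (hw : w ∈ stdSimplex ℝ α) {a b : ι → ℝ}
    (ha : a ∈ Set.Icc 0 1) (hb : b ∈ Set.Icc 0 1) {g : (ι → α) → ℝ} (hg : ∀ x, 0 < g x)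
    {s : Set (ι → α)} {K : ℝ} (hK₀ : 0 ≤ K) {x : ι → α}
    (hK : ∀ o : ι → Option α, resample o x ∈ s →
      noise w a (fun y => (g (resample o y))⁻¹) x ≤ K * (g (resample o x))⁻¹) :
    noise w a (fun y => (noise w b g y)⁻¹) x * noise w b (s.indicator g) x ≤ K := by
  set S := noise w b (s.indicator g) x with hS
  have hS₀ : 0 ≤ S :=
    noise_nonneg hw hb (fun y => Set.indicator_nonneg (fun z _ => (hg z).le) y) x
  set c : (ι → Option α) → ℝ := fun o => ∏ i, optWeight w (b i) (o i)
  have hc : ∀ o, 0 ≤ c o := fun o =>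
    prod_nonneg fun i _ => optWeight_nonneg hw ⟨hb.1 i, hb.2 i⟩ (o i)
  set l : (ι → Option α) → ℝ := fun o => s.indicator g (resample o x) with hl
  have hterm : ∀ o, l o ^ 2 * noise w a (fun y => (g (resample o y))⁻¹) x ≤ K * l o := fun o => by
    by_cases ho : resample o x ∈ s
    · have hne := (hg (resample o x)).ne'
      simp only [hl, Set.indicator_of_mem ho]
      refine (mul_le_mul_of_nonneg_left (hK o ho) (sq_nonneg _)).trans_eq ?_
      field_simp
    · simp [hl, ho]
  have hmain : (noise w a (fun y => (noise w b g y)⁻¹) x * S) * S ≤ K * S := by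
    calc (noise w a (fun y => (noise w b g y)⁻¹) x * S) * S
        = noise w a (S ^ 2 • fun y => (noise w b g y)⁻¹) x := by
          rw [noise_smul, Pi.smul_apply, smul_eq_mul]
          ring
      _ ≤ noise w a (fun y => ∑ o, c o * (l o ^ 2 * (g (resample o y))⁻¹)) x :=
          noise_mono hw ha (fun y => sq_noise_indicator_mul_inv_le hw hb hg s x y) x
      _ = ∑ o, c o * (l o ^ 2 * noise w a (fun y => (g (resample o y))⁻¹) x) := by
          simp only [noise, mul_sum]
          rw [sum_comm]
          exact sum_congr rfl fun o _ => sum_congr rfl fun y _ => by ring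
      _ ≤ ∑ o, c o * (K * l o) :=
          sum_le_sum fun o _ => mul_le_mul_of_nonneg_left (hterm o) (hc o)
      _ = K * S := by
          rw [hS, noise_eq_sum_resample w b _ x, mul_sum]
          exact sum_congr rfl fun o _ => by ring
  obtain h | h := hS₀.eq_or_lt
  · rwa [← h, mul_zero]
  · exact le_of_mul_le_mul_right hmain h

end ResampledNoise

section Bridge

variable {ι α : Type*} [Fintype ι] [DecidableEq ι] [Fintype α] {w : α → ℝ}

/-- The densities `T_a f * T_{Q/a} g`, for `Q ≤ a ≤ 1`, interpolate between `T_Q f * g` and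
`f * T_Q g`, where `T_a` is the noise operator with parameter `a` at every site. -/
noncomputable def bridge (w : α → ℝ) (Q : ℝ) (f g : (ι → α) → ℝ) (a : ℝ) : (ι → α) → ℝ :=
  noise w (fun _ => a) f * noise w (fun _ => Q / a) g

lemma bridge_one (w : α → ℝ) (Q : ℝ) (f g : (ι → α) → ℝ) :
    bridge w Q f g 1 = f * noise w (fun _ => Q) g := by
  rw [bridge, div_one]
  exact congrArg (· * _) (noise_one w f)

lemma bridge_self (w : α → ℝ) {Q : ℝ} (hQ : Q ≠ 0) (f g : (ι → α) → ℝ) :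
    bridge w Q f g Q = noise w (fun _ => Q) f * g := by
  rw [bridge, div_self hQ]
  exact congrArg (_ * ·) (noise_one w g)

lemma noise_noise_div (hw : w ∈ stdSimplex ℝ α) (Q : ℝ) {a : ℝ} (ha : a ≠ 0)
    (g : (ι → α) → ℝ) :
    noise w (fun _ => a) (noise w (fun _ => Q / a) g) = noise w (fun _ => Q) g := by
  rw [noise_noise hw]
  congr 1
  exact funext fun _ => mul_div_cancel₀ Q ha

lemma mean_bridge (hw : w ∈ stdSimplex ℝ α) (Q : ℝ) {a : ℝ} (ha : a ≠ 0)
    (f g : (ι → α) → ℝ) :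
    mean w (bridge w Q f g a) = mean w (noise w (fun _ => Q) f * g) := by
  rw [bridge, ← mean_mul_noise, noise_noise_div hw Q ha, mean_mul_noise]

lemma bridge_nonneg (hw : w ∈ stdSimplex ℝ α) {Q a : ℝ} (hQ : 0 ≤ Q) (hQa : Q ≤ a) (ha : a ≤ 1)
    {f g : (ι → α) → ℝ} (hf : ∀ x, 0 ≤ f x) (hg : ∀ x, 0 ≤ g x) (x : ι → α) :
    0 ≤ bridge w Q f g a x :=
  have ha₀ := hQ.trans hQa
  mul_nonneg (noise_nonneg hw ⟨fun _ => ha₀, fun _ => ha⟩ hf x)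
    (noise_nonneg hw ⟨fun _ => div_nonneg hQ ha₀, fun _ => div_le_one_of_le₀ hQa ha₀⟩ hg x)

lemma le_mul_inv_noise_of_mul_noise_le (hw : w ∈ stdSimplex ℝ α) {Q a R : ℝ} (hQ : 0 ≤ Q)
    (hQa : Q ≤ a) (ha₀ : 0 < a) (ha : a ≤ 1) {f g : (ι → α) → ℝ} (hf : ∀ x, 0 ≤ f x)
    (hg : ∀ x, 0 < g x) (hfg : ∀ x, f x * noise w (fun _ => Q) g x ≤ R) (y : ι → α) :
    f y ≤ R * (a ^ Fintype.card ι)⁻¹ * (noise w (fun _ => Q / a) g y)⁻¹ := by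
  have hpos := noise_pos (w := w) (q := fun _ : ι => Q / a) hw
    ⟨fun _ => div_nonneg hQ ha₀.le, fun _ => div_le_one_of_le₀ hQa ha₀.le⟩ hg
  have hdiag : a ^ Fintype.card ι * noise w (fun _ => Q / a) g y ≤ noise w (fun _ => Q) g y := by
    have := prod_mul_le_noise (w := w) (q := fun _ : ι => a) hw ⟨fun _ => ha₀.le, fun _ => ha⟩
      (fun z => (hpos z).le) y
    rwa [noise_noise_div hw Q ha₀.ne', prod_const, card_univ] at this
  rw [mul_assoc, ← mul_inv, ← div_eq_mul_inv, le_div_iff₀ (mul_pos (pow_pos ha₀ _) (hpos y))]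
  exact (mul_le_mul_of_nonneg_left hdiag (hf y)).trans (hfg y)

variable {ℓ p : ℝ} {m : ℕ} {f : (ι → α) → ℝ}

lemma noise_inv_dualFactor_resample_le (hw : w ∈ stdSimplex ℝ α) (hℓ : 1 ≤ ℓ)
    (hsmall : 3 ^ Fintype.card ι * Real.exp (-ℓ) ≤ 1) (hm : p + 3 ≤ m) (hf₀ : ∀ x, 0 < f x)
    (hf : ∀ x, f x ≤ Real.exp (p * ℓ)) {a : ℝ} (ha : 1 - Real.exp (-ℓ) ≤ a) (ha₁ : a ≤ 1)
    {x : ι → α} {o : ι → Option α}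
    (hx : Real.exp (-3 * ℓ) ≤ noise w (keepProb ℓ) f (resample o x)) :
    noise w (fun _ => a) (fun y => (dualFactor w ℓ f (resample o y))⁻¹) x
      ≤ (2 ^ m + 1) * (dualFactor w ℓ f (resample o x))⁻¹ := by
  classical
  have hℓ₀ : 0 ≤ ℓ := zero_le_one.trans hℓ
  have hQ : 0 ≤ 1 - Real.exp (-ℓ) := sub_nonneg.2 (Real.exp_le_one_iff.2 (by linarith))
  have hpos := noise_keepProb_pos hw hℓ₀ hf₀
  have hγ : 1 - ℓ⁻¹ ∈ Set.Icc (0 : ℝ) 1 :=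
    ⟨sub_nonneg.2 (inv_le_one_of_one_le₀ hℓ), sub_le_self _ (by positivity)⟩
  have ha_mem : (fun _ => a : ι → ℝ) ∈ Set.Icc 0 1 := ⟨fun _ => hQ.trans ha, fun _ => ha₁⟩
  have hinv : ∀ y, (dualFactor w ℓ f y)⁻¹ = noise w (keepProb ℓ) f y ^ (1 - ℓ⁻¹) := fun y => by
    rw [dualFactor, Real.rpow_neg (hpos y).le, inv_inv]
  have htilt : noise w (fun _ => a) (fun y => noise w (keepProb ℓ) f (resample o y)) x
      ≤ (2 ^ m + 1) * noise w (keepProb ℓ) f (resample o x) :=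
    (noise_noise_resample_le hw hQ ha ha₁ (fun y => (hf₀ y).le) o x).trans
      (sum_two_pow_hammingDist_mul_le hw hℓ₀ hsmall hm (fun y => (hf₀ y).le) hf hx)
  have hC : (1 : ℝ) ≤ 2 ^ m + 1 := le_add_of_nonneg_left (by positivity)
  simp only [hinv]
  calc noise w (fun _ => a) (fun y => noise w (keepProb ℓ) f (resample o y) ^ (1 - ℓ⁻¹)) x
      ≤ noise w (fun _ => a) (fun y => noise w (keepProb ℓ) f (resample o y)) x ^ (1 - ℓ⁻¹) :=
        noise_rpow_le hw ha_mem (fun y => (hpos _).le) hγ x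
    _ ≤ ((2 ^ m + 1) * noise w (keepProb ℓ) f (resample o x)) ^ (1 - ℓ⁻¹) :=
        Real.rpow_le_rpow (noise_nonneg hw ha_mem (fun y => (hpos _).le) x) htilt hγ.1
    _ = (2 ^ m + 1) ^ (1 - ℓ⁻¹) * noise w (keepProb ℓ) f (resample o x) ^ (1 - ℓ⁻¹) :=
        Real.mul_rpow (by positivity) (hpos _).le
    _ ≤ (2 ^ m + 1) * noise w (keepProb ℓ) f (resample o x) ^ (1 - ℓ⁻¹) := by
        refine mul_le_mul_of_nonneg_right ?_ (Real.rpow_nonneg (hpos _).le _)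
        simpa using Real.rpow_le_rpow_of_exponent_le hC hγ.2

lemma bridge_indicator_dualFactor_le (hw : w ∈ stdSimplex ℝ α) (hℓ : 1 ≤ ℓ)
    (hsmall : 3 ^ Fintype.card ι * Real.exp (-ℓ) ≤ 1) (hm : p + 3 ≤ m) (hf₀ : ∀ x, 0 < f x)
    (hf : ∀ x, f x ≤ Real.exp (p * ℓ)) {R : ℝ} (hR : 0 ≤ R)
    (hfR : ∀ x, f x * noise w (keepProb ℓ) (dualFactor w ℓ f) x ≤ R) {s : Set (ι → α)}
    (hs : ∀ x ∈ s, Real.exp (-3 * ℓ) ≤ noise w (keepProb ℓ) f x)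
    {a : ℝ} (ha : 1 - Real.exp (-ℓ) ≤ a) (ha₁ : a ≤ 1) (x : ι → α) :
    bridge w (1 - Real.exp (-ℓ)) f (s.indicator (dualFactor w ℓ f)) a x
      ≤ R * (a ^ Fintype.card ι)⁻¹ * (2 ^ m + 1) := by
  have hℓ₀ : 0 ≤ ℓ := zero_le_one.trans hℓ
  set Q := 1 - Real.exp (-ℓ)
  set g := dualFactor w ℓ f
  have hQ : 0 < Q := sub_pos.2 (Real.exp_lt_one_iff.2 (by linarith))
  have ha₀ : 0 < a := hQ.trans_le ha
  have hg := dualFactor_pos hw hℓ₀ hf₀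
  have ha_mem : (fun _ => a : ι → ℝ) ∈ Set.Icc 0 1 := ⟨fun _ => ha₀.le, fun _ => ha₁⟩
  have hb_mem : (fun _ => Q / a : ι → ℝ) ∈ Set.Icc 0 1 :=
    ⟨fun _ => div_nonneg hQ.le ha₀.le, fun _ => div_le_one_of_le₀ ha ha₀.le⟩
  have hharm : noise w (fun _ => a) (fun y => (noise w (fun _ => Q / a) g y)⁻¹) x
      * noise w (fun _ => Q / a) (s.indicator g) x ≤ 2 ^ m + 1 :=
    noise_inv_noise_mul_noise_indicator_le hw ha_mem hb_mem hg (by positivity) fun o ho =>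
      noise_inv_dualFactor_resample_le hw hℓ hsmall hm hf₀ hf ha ha₁ (hs _ ho)
  have hTf : noise w (fun _ => a) f x ≤ R * (a ^ Fintype.card ι)⁻¹ *
      noise w (fun _ => a) (fun y => (noise w (fun _ => Q / a) g y)⁻¹) x := by
    rw [← smul_eq_mul, ← Pi.smul_apply, ← noise_smul]
    exact noise_mono hw ha_mem (le_mul_inv_noise_of_mul_noise_le hw hQ.le ha ha₀ ha₁
      (fun y => (hf₀ y).le) hg hfR) x
  refine (mul_le_mul_of_nonneg_right hTf (noise_nonneg hw hb_mem
    (fun y => Set.indicator_nonneg (fun z _ => (hg z).le) y) x)).trans ?_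
  rw [mul_assoc]
  exact mul_le_mul_of_nonneg_left hharm (by positivity)

end Bridge

section ResamplingRate

variable {ι α : Type*} [Fintype ι] [DecidableEq ι] [Fintype α] {w : α → ℝ}

omit [Fintype ι] [DecidableEq ι] in
lemma mul_weight_le_siteKernel [DecidableEq α] (hw : w ∈ stdSimplex ℝ α) {δ : ℝ} (hδ₀ : 0 ≤ δ)
    (hδ₁ : δ < 1) (x y : α) :
    δ * w y ≤ ((if x ≠ y then 1 else 0) + δ / (1 - δ)) * siteKernel w (1 - δ) x y := by
  have hwy := hw.1 y
  have hwy₁ := le_one_of_mem_stdSimplex hw y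
  have hδ : 0 < 1 - δ := sub_pos.2 hδ₁
  rw [siteKernel_apply]
  obtain rfl | h := eq_or_ne x y
  · simp only [ne_eq, not_true_eq_false, if_true, if_false, zero_add, mul_one]
    rw [div_mul_eq_mul_div, le_div_iff₀ hδ, mul_assoc]
    refine mul_le_mul_of_nonneg_left ?_ hδ₀
    nlinarith
  · simp only [h, ne_eq, not_false_eq_true, if_true, if_false]
    have : 0 ≤ δ / (1 - δ) * (δ * w y) := by positivity
    nlinarith

lemma mul_sum_kernel_update_zero_le [DecidableEq α] (hw : w ∈ stdSimplex ℝ α) {δ : ℝ} (hδ₀ : 0 ≤ δ)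
    (hδ₁ : δ < 1) (hcard : (Fintype.card ι : ℝ) * δ ≤ 1 - δ) (x y : ι → α) :
    δ * ∑ i, kernel w (update (fun _ => 1 - δ) i 0) x y
      ≤ (hammingDist x y + 1) * kernel w (fun _ => 1 - δ) x y := by
  have hδ : 1 - δ ∈ Set.Icc (0 : ℝ) 1 := ⟨sub_nonneg.2 hδ₁.le, sub_le_self _ hδ₀⟩
  have hsite : ∀ i, δ * kernel w (update (fun _ => 1 - δ) i 0) x y
      ≤ ((if x i ≠ y i then 1 else 0) + δ / (1 - δ)) * kernel w (fun _ => 1 - δ) x y := by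
    intro i
    have hkernel := kernel_update_param w (fun _ : ι => 1 - δ) i (1 - δ) x y
    rw [update_eq_self] at hkernel
    rw [hkernel, kernel_update_param, siteKernel_zero, ← mul_assoc, ← mul_assoc]
    exact mul_le_mul_of_nonneg_right (mul_weight_le_siteKernel hw hδ₀ hδ₁ _ _)
      (prod_nonneg fun j _ => siteKernel_nonneg hw hδ _ _)
  have hdist : ∑ i, (if x i ≠ y i then (1 : ℝ) else 0) = hammingDist x y := by
    rw [sum_boole]
    rfl
  have hratio : (Fintype.card ι : ℝ) * (δ / (1 - δ)) ≤ 1 := by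
    rwa [mul_div_assoc', div_le_one (sub_pos.2 hδ₁)]
  rw [mul_sum]
  refine (sum_le_sum fun i _ => hsite i).trans ?_
  rw [← sum_mul, sum_add_distrib, hdist, sum_const, card_univ, nsmul_eq_mul]
  gcongr
  exact kernel_nonneg hw ⟨fun _ => hδ.1, fun _ => hδ.2⟩ x y

lemma exp_neg_mul_sum_avg_noise_le (hw : w ∈ stdSimplex ℝ α) {ℓ p : ℝ} {m : ℕ} (hℓ : 0 < ℓ)
    (hsmall : 3 ^ Fintype.card ι * Real.exp (-ℓ) ≤ 1) (hm : p + 3 ≤ m) {f : (ι → α) → ℝ}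
    (hf₀ : ∀ x, 0 ≤ f x) (hf : ∀ x, f x ≤ Real.exp (p * ℓ)) {x : ι → α}
    (hx : Real.exp (-3 * ℓ) ≤ noise w (keepProb ℓ) f x) :
    Real.exp (-ℓ) * ∑ i, avg w i (noise w (keepProb ℓ) f) x
      ≤ (m + 2) * noise w (keepProb ℓ) f x := by
  classical
  have hδ₁ : Real.exp (-ℓ) < 1 := Real.exp_lt_one_iff.2 (by linarith)
  have hcard : (Fintype.card ι : ℝ) * Real.exp (-ℓ) ≤ 1 - Real.exp (-ℓ) := by
    have h : (Fintype.card ι : ℝ) + 1 ≤ 3 ^ Fintype.card ι := by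
      exact_mod_cast Nat.succ_le_of_lt (Nat.lt_pow_self (by norm_num : 1 < 3))
    nlinarith [Real.exp_pos (-ℓ)]
  calc Real.exp (-ℓ) * ∑ i, avg w i (noise w (keepProb ℓ) f) x
      = ∑ y, (Real.exp (-ℓ) * ∑ i, kernel w (update (keepProb ℓ) i 0) x y) * f y := by
        simp only [avg_noise hw, noise, mul_sum, sum_mul]
        rw [sum_comm]
        simp only [mul_assoc]
    _ ≤ ∑ y, (hammingDist x y + 1) * (kernel w (keepProb ℓ) x y * f y) := by
        refine sum_le_sum fun y _ => ?_
        rw [← mul_assoc]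
        exact mul_le_mul_of_nonneg_right
          (mul_sum_kernel_update_zero_le hw (Real.exp_pos _).le hδ₁ hcard x y) (hf₀ y)
    _ ≤ (m + 1 + 1) * noise w (keepProb ℓ) f x :=
        sum_hammingDist_mul_le hw hℓ.le hsmall hm hf₀ hf hx
    _ = (m + 2) * noise w (keepProb ℓ) f x := by ring

/-- Up to the factor `1 - e^{-ℓ}`, the left-hand side is the expected number of sites that are
resampled along the bridge. -/
lemma exp_neg_mul_sum_mean_mul_avg_noise_le (hw : w ∈ stdSimplex ℝ α) {ℓ p : ℝ} {m : ℕ}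
    (hℓ : 0 < ℓ) (hsmall : 3 ^ Fintype.card ι * Real.exp (-ℓ) ≤ 1) (hm : p + 3 ≤ m)
    {f g : (ι → α) → ℝ} (hf₀ : ∀ x, 0 ≤ f x) (hf : ∀ x, f x ≤ Real.exp (p * ℓ))
    (hg₀ : ∀ x, 0 ≤ g x) (hg : ∀ x, g x ≠ 0 → Real.exp (-3 * ℓ) ≤ noise w (keepProb ℓ) f x)
    (hfg : mean w (noise w (keepProb ℓ) f * g) ≤ 1) :
    Real.exp (-ℓ) * ∑ i, mean w (f * avg w i (noise w (keepProb ℓ) g)) ≤ m + 2 := by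
  have hsym : ∀ i, mean w (f * avg w i (noise w (keepProb ℓ) g))
      = mean w (g * avg w i (noise w (keepProb ℓ) f)) := fun i => by
    rw [avg_noise hw, avg_noise hw, mean_mul_noise, mul_comm]
  have hpt : ∀ x, g x * (Real.exp (-ℓ) * ∑ i, avg w i (noise w (keepProb ℓ) f) x)
      ≤ (m + 2) * (noise w (keepProb ℓ) f x * g x) := fun x => by
    obtain hx | hx := eq_or_ne (g x) 0
    · simp [hx]
    · refine (mul_le_mul_of_nonneg_left (exp_neg_mul_sum_avg_noise_le hw hℓ hsmall hm hf₀ hf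
        (hg x hx)) (hg₀ x)).trans_eq ?_
      ring
  calc Real.exp (-ℓ) * ∑ i, mean w (f * avg w i (noise w (keepProb ℓ) g))
      = mean w (fun x => g x * (Real.exp (-ℓ) * ∑ i, avg w i (noise w (keepProb ℓ) f) x)) := by
        simp only [hsym]
        rw [← mean_sum, ← mean_smul]
        congr 1
        ext x
        simp only [Pi.smul_apply, Pi.mul_apply, smul_eq_mul, mul_sum]
        exact sum_congr rfl fun i _ => by ring
    _ ≤ mean w (((m : ℝ) + 2) • (noise w (keepProb ℓ) f * g)) := mean_mono hw hpt
    _ = (m + 2) * mean w (noise w (keepProb ℓ) f * g) := mean_smul _ _ _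
    _ ≤ m + 2 := mul_le_of_le_one_right (by positivity) hfg

end ResamplingRate

/-! ### Transport along the bridge -/

section Transport

lemma abs_mul_le_of_mul_le {D e g c κ : ℝ} (he : 0 ≤ e) (hc : 0 < c) (hκ : 0 < κ)
    (h : c * e ≤ g) : |D| * e ≤ (√c)⁻¹ * (κ / 2 * (D ^ 2 * g) + (2 * κ)⁻¹ * e) := by
  have hsc : 0 < √c := Real.sqrt_pos.2 hc
  have hsq : (|D| * √c) ^ 2 = D ^ 2 * c := by rw [mul_pow, sq_abs, Real.sq_sqrt hc.le]
  have hyoung : |D| * √c ≤ κ / 2 * (|D| * √c) ^ 2 + (2 * κ)⁻¹ := by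
    have hdiff : κ / 2 * (|D| * √c) ^ 2 + (2 * κ)⁻¹ - |D| * √c
        = (κ * (|D| * √c) - 1) ^ 2 / (2 * κ) := by
      field_simp
      ring
    have : 0 ≤ (κ * (|D| * √c) - 1) ^ 2 / (2 * κ) := by positivity
    linarith
  rw [inv_mul_eq_div, le_div_iff₀ hsc]
  calc |D| * e * √c = |D| * √c * e := by ring
    _ ≤ (κ / 2 * (|D| * √c) ^ 2 + (2 * κ)⁻¹) * e := mul_le_mul_of_nonneg_right hyoung he
    _ = κ / 2 * (D ^ 2 * (c * e)) + (2 * κ)⁻¹ * e := by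
      rw [hsq]
      ring
    _ ≤ κ / 2 * (D ^ 2 * g) + (2 * κ)⁻¹ * e := by gcongr

lemma sub_le_sub_of_hasDerivAt_le {F F' S S' : ℝ → ℝ} {l r : ℝ} (hlr : l ≤ r)
    (hF : ContinuousOn F (Set.Icc l r)) (hS : ContinuousOn S (Set.Icc l r))
    (hF' : ∀ a ∈ Set.Ioo l r, HasDerivAt F (F' a) a)
    (hS' : ∀ a ∈ Set.Ioo l r, HasDerivAt S (S' a) a) (hle : ∀ a ∈ Set.Ioo l r, F' a ≤ S' a) :
    F r - F l ≤ S r - S l := by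
  have hanti : AntitoneOn (F - S) (Set.Icc l r) := by
    refine antitoneOn_of_hasDerivWithinAt_nonpos (convex_Icc l r) (hF.sub hS) (f' := F' - S')
      (fun a ha => ?_) fun a ha => ?_ <;> rw [interior_Icc] at ha
    · exact ((hF' a ha).sub (hS' a ha)).hasDerivWithinAt
    · exact sub_nonpos.2 (hle a ha)
  have := hanti (Set.left_mem_Icc.2 hlr) (Set.right_mem_Icc.2 hlr) hlr
  simp only [Pi.sub_apply] at this
  linarith

lemma sub_le_of_hasDerivAt_le_inv_sqrt {F F' : ℝ → ℝ} {l r C : ℝ} (hlr : l ≤ r)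
    (hF : ContinuousOn F (Set.Icc l r)) (hF' : ∀ a ∈ Set.Ioo l r, HasDerivAt F (F' a) a)
    (hC : ∀ a ∈ Set.Ioo l r, F' a ≤ C * ((√(a - l))⁻¹ + (√(r - a))⁻¹)) :
    F r - F l ≤ C * (4 * √(r - l)) := by
  set S : ℝ → ℝ := fun a => C * (2 * √(a - l) - 2 * √(r - a)) with hS
  have hS' : ∀ a ∈ Set.Ioo l r, HasDerivAt S (C * ((√(a - l))⁻¹ + (√(r - a))⁻¹)) a := by
    intro a ha
    have hl := ((hasDerivAt_id a).sub_const l).sqrt (sub_pos.2 ha.1).ne'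
    have hr := ((hasDerivAt_id a).const_sub r).sqrt (sub_pos.2 ha.2).ne'
    refine (((hl.const_mul 2).sub (hr.const_mul 2)).const_mul C).congr_deriv ?_
    simp only [id]
    ring
  have hle := sub_le_sub_of_hasDerivAt_le hlr hF (by fun_prop) hF' hS' hC
  simp only [hS, sub_self, Real.sqrt_zero] at hle
  linarith

variable {ι α : Type*} [Fintype ι] [DecidableEq ι] [Fintype α] {w : α → ℝ}
  {f g G : (ι → α) → ℝ}

lemma mean_mul_mul_avg_comm (hw : w ∈ stdSimplex ℝ α) (i : ι) {k : (ι → α) → ℝ}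
    (hk : ∀ x z, k (update x i z) = k x) (f g : (ι → α) → ℝ) :
    mean w (k * (f * avg w i g)) = mean w (k * (g * avg w i f)) := by
  rw [← mul_assoc, mean_mul_avg hw, avg_mul_of_update_eq w i hk, mul_assoc, mul_comm g]

omit [Fintype ι] in
lemma mul_mul_avg_sub_le (hw : w ∈ stdSimplex ℝ α) (i : ι) (hf : ∀ x, 0 ≤ f x)
    (hg : ∀ x, 0 ≤ g x) {c c' κ : ℝ} (hc : 0 < c) (hc' : 0 < c') (hκ : 0 < κ)
    (hfc : ∀ x, c * avg w i f x ≤ f x) (hgc : ∀ x, c' * avg w i g x ≤ g x) (D : ℝ)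
    (x : ι → α) :
    D * (f x * avg w i g x - g x * avg w i f x)
      ≤ ((√c)⁻¹ + (√c')⁻¹) * (κ / 2) * (D ^ 2 * (f x * g x))
        + ((√c')⁻¹ * (2 * κ)⁻¹ * (f x * avg w i g x)
          + (√c)⁻¹ * (2 * κ)⁻¹ * (g x * avg w i f x)) := by
  have hfg := mul_le_mul_of_nonneg_left (abs_mul_le_of_mul_le (D := D)
    (avg_nonneg hw i hg x) hc' hκ (hgc x)) (hf x)
  have hgf := mul_le_mul_of_nonneg_left (abs_mul_le_of_mul_le (D := D)
    (avg_nonneg hw i hf x) hc hκ (hfc x)) (hg x)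
  have hfg₀ := mul_le_mul_of_nonneg_right (le_abs_self D) (mul_nonneg (hf x) (avg_nonneg hw i hg x))
  have hgf₀ := mul_le_mul_of_nonneg_right (neg_abs_le D) (mul_nonneg (hg x) (avg_nonneg hw i hf x))
  linarith

/-- Since `f * avg g - g * avg f` is orthogonal to every `k` that ignores the site `i`, the
function `G` can be centred at `k`. -/
lemma mean_mul_avg_sub_le (hw : w ∈ stdSimplex ℝ α) {k : (ι → α) → ℝ} (i : ι)
    (hf : ∀ x, 0 ≤ f x) (hg : ∀ x, 0 ≤ g x) (hk : ∀ x z, k (update x i z) = k x) {c c' κ : ℝ}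
    (hc : 0 < c) (hc' : 0 < c') (hκ : 0 < κ) (hfc : ∀ x, c * avg w i f x ≤ f x)
    (hgc : ∀ x, c' * avg w i g x ≤ g x) :
    mean w (G * (f * avg w i g - g * avg w i f))
      ≤ ((√c)⁻¹ + (√c')⁻¹) * (κ / 2 * mean w ((G - k) ^ 2 * (f * g))
        + (2 * κ)⁻¹ * mean w (f * avg w i g)) := by
  have hcentre : mean w (G * (f * avg w i g - g * avg w i f))
      = mean w ((G - k) * (f * avg w i g - g * avg w i f)) := by
    rw [sub_mul, mean_sub, mul_sub k, mean_sub w (k * _), mean_mul_mul_avg_comm hw i hk, sub_self,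
      sub_zero]
  have hsymm : mean w (g * avg w i f) = mean w (f * avg w i g) := by
    rw [mean_mul_avg hw, mul_comm]
  calc mean w (G * (f * avg w i g - g * avg w i f))
      ≤ mean w ((((√c)⁻¹ + (√c')⁻¹) * (κ / 2)) • ((G - k) ^ 2 * (f * g))
          + (((√c')⁻¹ * (2 * κ)⁻¹) • (f * avg w i g)
            + ((√c)⁻¹ * (2 * κ)⁻¹) • (g * avg w i f))) := by
        rw [hcentre]
        exact mean_mono hw fun x =>
          mul_mul_avg_sub_le hw i hf hg hc hc' hκ hfc hgc (G x - k x) x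
    _ = ((√c)⁻¹ + (√c')⁻¹) * (κ / 2 * mean w ((G - k) ^ 2 * (f * g))
          + (2 * κ)⁻¹ * mean w (f * avg w i g)) := by
        rw [mean_add, mean_add, mean_smul, mean_smul, mean_smul, hsymm]
        ring

lemma hasDerivAt_mean (w : α → ℝ) {u : ℝ → (ι → α) → ℝ} {u' : (ι → α) → ℝ} {q : ℝ}
    (h : ∀ x, HasDerivAt (fun s => u s x) (u' x) q) :
    HasDerivAt (fun s => mean w (u s)) (mean w u') q :=
  HasDerivAt.fun_sum fun x _ => (h x).const_mul _

lemma continuousOn_mean (w : α → ℝ) {u : ℝ → (ι → α) → ℝ} {s : Set ℝ}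
    (h : ∀ x, ContinuousOn (fun q => u q x) s) : ContinuousOn (fun q => mean w (u q)) s :=
  continuousOn_finsetSum _ fun x _ => continuousOn_const.mul (h x)

variable {Q a : ℝ}

lemma continuousOn_mean_mul_bridge (w : α → ℝ) (hQ : 0 < Q) (f g G : (ι → α) → ℝ) :
    ContinuousOn (fun a => mean w (G * bridge w Q f g a)) (Set.Icc Q 1) :=
  continuousOn_mean w fun x => continuousOn_const.mul
    ((continuous_noise w f x).continuousOn.mul
      ((continuous_noise w g x).comp_continuousOn
        (continuousOn_const.div continuousOn_id fun _ ha => (hQ.trans_le ha.1).ne')))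

lemma hasDerivAt_bridge (hw : w ∈ stdSimplex ℝ α) (hQ : Q ≠ 0) (ha : a ≠ 0)
    (f g : (ι → α) → ℝ) (x : ι → α) :
    HasDerivAt (fun s => bridge w Q f g s x)
      (a⁻¹ * ∑ i, (noise w (fun _ => a) f * avg w i (noise w (fun _ => Q / a) g)
        - noise w (fun _ => Q / a) g * avg w i (noise w (fun _ => a) f)) x) a := by
  have hdiv : HasDerivAt (fun s : ℝ => Q / s) (-(Q / a ^ 2)) a := by
    simpa only [div_eq_mul_inv, mul_neg] using (hasDerivAt_inv ha).const_mul Q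
  have hf := hasDerivAt_noise hw f x ha
  have hg := (hasDerivAt_noise hw g x (div_ne_zero hQ ha)).comp a hdiv
  refine (hf.mul hg).congr_deriv ?_
  simp only [Function.comp_apply, Pi.sub_apply, Pi.mul_apply, sum_sub_distrib, sum_const, card_univ,
    nsmul_eq_mul, ← mul_sum]
  field_simp
  ring

lemma hasDerivAt_mean_mul_bridge (hw : w ∈ stdSimplex ℝ α) (hQ : Q ≠ 0) (ha : a ≠ 0)
    (f g G : (ι → α) → ℝ) :
    HasDerivAt (fun s => mean w (G * bridge w Q f g s))
      (a⁻¹ * ∑ i, mean w (G * (noise w (fun _ => a) f * avg w i (noise w (fun _ => Q / a) g)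
        - noise w (fun _ => Q / a) g * avg w i (noise w (fun _ => a) f)))) a := by
  refine (hasDerivAt_mean w fun x =>
    (hasDerivAt_bridge hw hQ ha f g x).const_mul (G x)).congr_deriv ?_
  rw [← mean_sum, ← mean_smul]
  congr 1
  ext x
  simp only [Pi.smul_apply, Pi.mul_apply, smul_eq_mul, ← mul_sum]
  ring

lemma mean_noise_mul_avg_noise_div (hw : w ∈ stdSimplex ℝ α) (ha : a ≠ 0)
    (f g : (ι → α) → ℝ) (i : ι) :
    mean w (noise w (fun _ => a) f * avg w i (noise w (fun _ => Q / a) g))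
      = mean w (f * avg w i (noise w (fun _ => Q) g)) := by
  rw [← mean_mul_noise, noise_avg hw, noise_noise_div hw Q ha]

lemma sum_mean_mul_avg_sub_le (hw : w ∈ stdSimplex ℝ α) {k : ι → (ι → α) → ℝ}
    (hf : ∀ x, 0 ≤ f x) (hg : ∀ x, 0 ≤ g x) (hk : ∀ i x z, k i (update x i z) = k i x)
    {v κ : ℝ} (hκ : 0 < κ) (hQ : 0 < Q) (ha : a ∈ Set.Ioo Q 1)
    (hv : mean w ((∑ i, (G - k i) ^ 2) * bridge w Q f g a) ≤ v) :
    ∑ i, mean w (G * (noise w (fun _ => a) f * avg w i (noise w (fun _ => Q / a) g)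
        - noise w (fun _ => Q / a) g * avg w i (noise w (fun _ => a) f)))
      ≤ ((√(a - Q))⁻¹ + (√(1 - a))⁻¹) *
        (κ / 2 * v + (2 * κ)⁻¹ * ∑ i, mean w (f * avg w i (noise w (fun _ => Q) g))) := by
  have ha₀ : 0 < a := hQ.trans ha.1
  have ha_mem : (fun _ => a : ι → ℝ) ∈ Set.Icc 0 1 := ⟨fun _ => ha₀.le, fun _ => ha.2.le⟩
  have hb_mem : (fun _ => Q / a : ι → ℝ) ∈ Set.Icc 0 1 :=
    ⟨fun _ => div_nonneg hQ.le ha₀.le, fun _ => div_le_one_of_le₀ ha.1.le ha₀.le⟩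
  have hg₀ := noise_nonneg hw hb_mem hg
  have hQa : a - Q ≤ 1 - Q / a := by
    rw [one_sub_div ha₀.ne', le_div_iff₀ ha₀]
    exact mul_le_of_le_one_right (sub_nonneg.2 ha.1.le) ha.2.le
  have hsite := fun i => mean_mul_avg_sub_le (G := G) hw i (noise_nonneg hw ha_mem hf) hg₀ (hk i)
    (sub_pos.2 ha.2) (sub_pos.2 ha.1) hκ (mul_avg_noise_le hw ha_mem i hf) fun x =>
    (mul_le_mul_of_nonneg_right hQa (avg_nonneg hw i hg₀ x)).trans
      (mul_avg_noise_le hw hb_mem i hg x)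
  refine (sum_le_sum fun i _ => hsite i).trans ?_
  simp only [mean_noise_mul_avg_noise_div hw ha₀.ne']
  rw [← mul_sum, sum_add_distrib, ← mul_sum, ← mul_sum, ← mean_sum, add_comm (√(1 - a))⁻¹]
  gcongr
  refine (le_of_eq (congrArg (mean w) (funext fun x => ?_))).trans hv
  simp only [bridge, Pi.mul_apply, Finset.sum_apply, sum_mul]

/-- The derivative of `mean w (G * bridge w (1 - δ) f g a)` in `a` has square-root singularities at
both ends, which are integrable and contribute the factor `√δ`; this is balanced against the rate
`N / δ` of resampling by taking the weight `μ / √δ` in Young's inequality. -/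
lemma mean_mul_bridge_one_sub_le (hw : w ∈ stdSimplex ℝ α) {k : ι → (ι → α) → ℝ}
    (hf : ∀ x, 0 ≤ f x) (hg : ∀ x, 0 ≤ g x) (hk : ∀ i x z, k i (update x i z) = k i x)
    {δ v N μ : ℝ} (hδ₀ : 0 < δ) (hδ₁ : δ < 1) (hμ : 0 < μ)
    (hN : δ * ∑ i, mean w (f * avg w i (noise w (fun _ => 1 - δ) g)) ≤ N)
    (hv₀ : 0 ≤ v) (hv : ∀ a ∈ Set.Ioo (1 - δ) 1,
      mean w ((∑ i, (G - k i) ^ 2) * bridge w (1 - δ) f g a) ≤ v) :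
    mean w (G * (f * noise w (fun _ => 1 - δ) g)) - mean w (G * (noise w (fun _ => 1 - δ) f * g))
      ≤ (1 - δ)⁻¹ * (2 * μ * v + 2 * N / μ) := by
  set Q := 1 - δ
  have hQ : 0 < Q := sub_pos.2 hδ₁
  have hκ : 0 < μ / √δ := div_pos hμ (Real.sqrt_pos.2 hδ₀)
  set n := ∑ i, mean w (f * avg w i (noise w (fun _ => Q) g))
  have hn₀ : 0 ≤ n := sum_nonneg fun i _ => mean_nonneg hw fun x => mul_nonneg (hf x)
    (avg_nonneg hw i (noise_nonneg hw ⟨fun _ => hQ.le, fun _ => sub_le_self _ hδ₀.le⟩ hg) x)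
  have htransport := sub_le_of_hasDerivAt_le_inv_sqrt (sub_le_self 1 hδ₀.le)
    (continuousOn_mean_mul_bridge w hQ f g G)
    (fun a ha => hasDerivAt_mean_mul_bridge hw hQ.ne' (hQ.trans ha.1).ne' f g G)
    (C := Q⁻¹ * (μ / √δ / 2 * v + (2 * (μ / √δ))⁻¹ * n)) fun a ha => by
      rw [mul_assoc, mul_comm (_ + _ * n)]
      exact (mul_le_mul_of_nonneg_left (sum_mean_mul_avg_sub_le hw hf hg hk hκ hQ ha (hv a ha))
        (inv_pos.2 (hQ.trans ha.1)).le).trans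
        (mul_le_mul_of_nonneg_right (inv_anti₀ hQ ha.1.le) (by positivity))
  rw [bridge_one, bridge_self w hQ.ne', sub_sub_cancel] at htransport
  refine htransport.trans ?_
  rw [mul_assoc]
  refine mul_le_mul_of_nonneg_left ?_ (inv_pos.2 hQ).le
  calc (μ / √δ / 2 * v + (2 * (μ / √δ))⁻¹ * n) * (4 * √δ) = 2 * μ * v + 2 * (δ * n) / μ := by
        have hsq := Real.sq_sqrt hδ₀.le
        field_simp
        rw [hsq]
        ring
    _ ≤ 2 * μ * v + 2 * N / μ := by gcongr

end Transport

/-! ### Entropy along the noise semigroup -/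

section EntropyProduction

lemma mul_log_tangent {a b A B : ℝ} (ha : 0 < a) (hb : 0 < b) (hA : 0 < A) (hB : 0 < B) :
    a * (Real.log A - Real.log B) + a - A / B * b ≤ a * (Real.log a - Real.log b) := by
  have hlog := Real.log_le_sub_one_of_pos (x := A * b / (B * a)) (by positivity)
  rw [Real.log_div (by positivity) (by positivity), Real.log_mul hA.ne' hb.ne',
    Real.log_mul hB.ne' ha.ne'] at hlog
  have hcancel : a * (A * b / (B * a) - 1) = A / B * b - a := by field_simp
  linarith [mul_le_mul_of_nonneg_left hlog ha.le]

lemma log_sum_inequality {κ : Type*} (s : Finset κ) {k a b : κ → ℝ} (hk : ∀ y ∈ s, 0 ≤ k y)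
    (ha : ∀ y ∈ s, 0 < a y) (hb : ∀ y ∈ s, 0 < b y) (hA : 0 < ∑ y ∈ s, k y * a y)
    (hB : 0 < ∑ y ∈ s, k y * b y) :
    (∑ y ∈ s, k y * a y) * (Real.log (∑ y ∈ s, k y * a y) - Real.log (∑ y ∈ s, k y * b y))
      ≤ ∑ y ∈ s, k y * (a y * (Real.log (a y) - Real.log (b y))) := by
  set A := ∑ y ∈ s, k y * a y with hA_def
  set B := ∑ y ∈ s, k y * b y with hB_def
  calc A * (Real.log A - Real.log B)
      = A * (Real.log A - Real.log B) + A - A / B * B := by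
        rw [div_mul_cancel₀ A hB.ne', add_sub_cancel_right]
    _ = ∑ y ∈ s, k y * (a y * (Real.log A - Real.log B) + a y - A / B * b y) := by
        conv_lhs => rw [hA_def, hB_def]
        rw [sum_mul, mul_sum, ← sum_add_distrib, ← sum_sub_distrib]
        exact sum_congr rfl fun y _ => by ring
    _ ≤ ∑ y ∈ s, k y * (a y * (Real.log (a y) - Real.log (b y))) :=
        sum_le_sum fun y hy =>
          mul_le_mul_of_nonneg_left (mul_log_tangent (ha y hy) (hb y hy) hA hB) (hk y hy)

lemma sub_mul_log_le {a b c : ℝ} (ha : 0 < a) (hb : 0 < b) (hc : c ∈ Set.Icc 0 1) :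
    (a - b) * Real.log (c * a + (1 - c) * b) ≤ (a - b) * Real.log a := by
  have hc' := sub_nonneg.2 hc.2
  obtain hab | hab := le_total a b
  · refine mul_le_mul_of_nonpos_left (Real.log_le_log ha ?_) (sub_nonpos.2 hab)
    nlinarith
  · refine mul_le_mul_of_nonneg_left (Real.log_le_log ?_ ?_) (sub_nonneg.2 hab)
    · nlinarith [mul_nonneg hc.1 (sub_nonneg.2 hab)]
    · nlinarith

variable {ι α : Type*} [Fintype ι] [DecidableEq ι] [Fintype α] {w : α → ℝ}

/-- The entropy `∫ h log h` of a density `h` with respect to the product of the weights `w`. -/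
noncomputable def entropy (w : α → ℝ) (h : (ι → α) → ℝ) : ℝ := mean w (h * (Real.log ∘ h))

/-- The entropy production of the density `h` at the site `i`: the rate at which resampling this
site decreases the entropy. -/
noncomputable def entropyProd (w : α → ℝ) (i : ι) (h : (ι → α) → ℝ) : ℝ :=
  mean w ((h - avg w i h) * (Real.log ∘ h))

lemma entropy_one (w : α → ℝ) : entropy w (fun _ : ι → α => 1) = 0 := by simp [entropy, mean]

lemma entropy_le_of_le_exp (hw : w ∈ stdSimplex ℝ α) {h : (ι → α) → ℝ} (hh : ∀ x, 0 < h x)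
    (hmean : mean w h = 1) {p : ℝ} (hp : ∀ x, h x ≤ Real.exp p) : entropy w h ≤ p := by
  calc entropy w h ≤ mean w (p • h) := mean_mono hw fun x => by
        rw [Pi.smul_apply, smul_eq_mul, mul_comm p]
        exact mul_le_mul_of_nonneg_left ((Real.log_le_iff_le_exp (hh x)).2 (hp x)) (hh x).le
    _ = p := by rw [mean_smul, hmean, mul_one]

lemma entropy_nonneg (hw : w ∈ stdSimplex ℝ α) {h : (ι → α) → ℝ} (hh : ∀ x, 0 < h x)
    (hmean : mean w h = 1) : 0 ≤ entropy w h := by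
  calc 0 = mean w (h - fun _ => 1) := by rw [mean_sub, hmean, mean_const hw, sub_self]
    _ ≤ entropy w h := mean_mono hw fun x => by
        have := mul_le_mul_of_nonneg_left (Real.one_sub_inv_le_log_of_pos (hh x)) (hh x).le
        rwa [mul_sub, mul_inv_cancel₀ (hh x).ne', mul_one] at this

lemma mean_mul_sub_avg_eq_zero (hw : w ∈ stdSimplex ℝ α) (i : ι) {k : (ι → α) → ℝ}
    (hk : ∀ x z, k (update x i z) = k x) (u : (ι → α) → ℝ) :
    mean w (k * (u - avg w i u)) = 0 := by
  rw [← mean_avg hw i, avg_mul_of_update_eq w i hk, avg_sub, avg_avg hw, sub_self, mul_zero]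
  exact mean_const hw 0

lemma entropyProd_eq (hw : w ∈ stdSimplex ℝ α) (i : ι) (h : (ι → α) → ℝ) :
    entropyProd w i h = mean w (fun x => ∑ z, w z *
      (h (update x i z) * (Real.log (h (update x i z)) - Real.log (h x)))) := by
  have hsum : (fun x => ∑ z, w z *
      (h (update x i z) * (Real.log (h (update x i z)) - Real.log (h x))))
      = avg w i (h * (Real.log ∘ h)) - avg w i h * (Real.log ∘ h) := by
    ext x
    simp only [avg, Pi.sub_apply, Pi.mul_apply, comp_apply, sum_mul, ← sum_sub_distrib]
    exact sum_congr rfl fun z _ => by ring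
  rw [hsum, mean_sub, mean_avg hw, ← mean_sub, entropyProd, sub_mul]

lemma entropyProd_noise_le_of_eq_one (hw : w ∈ stdSimplex ℝ α) {q : ι → ℝ}
    (hq : q ∈ Set.Icc 0 1) {i : ι} (hi : q i = 1) {h : (ι → α) → ℝ} (hh : ∀ x, 0 < h x) :
    entropyProd w i (noise w q h) ≤ entropyProd w i h := by
  set u : α → (ι → α) → ℝ := fun z x =>
    h (update x i z) * (Real.log (h (update x i z)) - Real.log (h x))
  have hnoise : ∀ x, noise w q (fun x => ∑ z, w z * u z x) x = ∑ z, w z * noise w q (u z) x := by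
    intro x
    simp only [noise, mul_sum]
    rw [sum_comm]
    exact sum_congr rfl fun z _ => sum_congr rfl fun y _ => by ring
  rw [entropyProd_eq hw, entropyProd_eq hw, ← mean_noise hw q (fun x => ∑ z, w z * u z x)]
  refine mean_mono hw fun x => ?_
  rw [hnoise]
  refine sum_le_sum fun z _ => mul_le_mul_of_nonneg_left ?_ (hw.1 z)
  rw [noise_update_of_eq_one w hi]
  exact log_sum_inequality univ (fun y _ => kernel_nonneg hw hq x y) (fun y _ => hh _)
    (fun y _ => hh y) (noise_pos hw hq (fun y => hh (update y i z)) x) (noise_pos hw hq hh x)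

lemma noise_sub_avg_noise (hw : w ∈ stdSimplex ℝ α) (q : ι → ℝ) (i : ι) (u : (ι → α) → ℝ) :
    noise w q u - avg w i (noise w q u)
      = q i • (noise w (update q i 1) u - avg w i (noise w (update q i 1) u)) := by
  ext x
  rw [avg_noise hw, avg_noise hw, update_idem, Pi.sub_apply, noise_split w q i u x]
  simp only [Pi.smul_apply, Pi.sub_apply, smul_eq_mul]
  ring

lemma entropyProd_noise_le (hw : w ∈ stdSimplex ℝ α) {q : ι → ℝ} (hq : q ∈ Set.Icc 0 1) (i : ι)
    {h : (ι → α) → ℝ} (hh : ∀ x, 0 < h x) :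
    entropyProd w i (noise w q h) ≤ q i * entropyProd w i h := by
  have hq' : update q i 1 ∈ Set.Icc (0 : ι → ℝ) 1 := update_mem_Icc hq i ⟨zero_le_one, le_rfl⟩
  set h' := noise w (update q i 1) h
  have hpos : ∀ x, 0 < h' x := noise_pos hw hq' hh
  calc entropyProd w i (noise w q h)
      = q i * mean w ((h' - avg w i h') * (Real.log ∘ noise w q h)) := by
        rw [entropyProd, noise_sub_avg_noise hw, smul_mul_assoc, mean_smul]
    _ ≤ q i * entropyProd w i h' := by
        refine mul_le_mul_of_nonneg_left (mean_mono hw fun x => ?_) (hq.1 i)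
        simp only [Pi.mul_apply, Pi.sub_apply, comp_apply]
        rw [noise_split w q i h x, avg_noise hw i (update q i 1), update_idem]
        exact sub_mul_log_le (hpos x)
          (noise_pos hw (update_mem_Icc hq i ⟨le_rfl, zero_le_one⟩) hh x) ⟨hq.1 i, hq.2 i⟩
    _ ≤ q i * entropyProd w i h := mul_le_mul_of_nonneg_left
        (entropyProd_noise_le_of_eq_one hw hq' (update_self i 1 q) hh) (hq.1 i)

section Derivative

variable {r : (ι → α) → ℝ} {q : ℝ}

lemma hasDerivAt_mean_mul_noise (hw : w ∈ stdSimplex ℝ α) (G r : (ι → α) → ℝ) (hq : q ≠ 0) :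
    HasDerivAt (fun s => mean w (G * noise w (fun _ => s) r))
      (q⁻¹ * ∑ i, mean w (G * (noise w (fun _ => q) r - avg w i (noise w (fun _ => q) r)))) q := by
  refine (hasDerivAt_mean w fun x =>
    (hasDerivAt_noise hw r x hq).const_mul (G x)).congr_deriv ?_
  rw [← mean_sum, ← mean_smul]
  congr 1
  ext x
  simp only [Pi.smul_apply, Pi.mul_apply, Pi.sub_apply, smul_eq_mul, ← mul_sum]
  ring

lemma continuous_mean_mul_noise (w : α → ℝ) (G r : (ι → α) → ℝ) :
    Continuous (fun s : ℝ => mean w (G * noise w (fun _ => s) r)) :=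
  continuousOn_univ.1 <| continuousOn_mean w fun x =>
    continuousOn_const.mul (continuous_noise w r x).continuousOn

lemma continuousOn_entropy_noise (hw : w ∈ stdSimplex ℝ α) (hr : ∀ x, 0 < r x) :
    ContinuousOn (fun q => entropy w (noise w (fun _ => q) r)) (Set.Icc 0 1) :=
  continuousOn_mean w fun x =>
    have hx := (continuous_noise w r x).continuousOn
    hx.mul (hx.log fun _ hq =>
      (noise_pos hw ⟨fun _ => hq.1, fun _ => hq.2⟩ hr x).ne')

lemma hasDerivAt_entropy_noise (hw : w ∈ stdSimplex ℝ α) (hr : ∀ x, 0 < r x)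
    (hq : q ∈ Set.Ioc 0 1) :
    HasDerivAt (fun q => entropy w (noise w (fun _ => q) r))
      (q⁻¹ * ∑ i, entropyProd w i (noise w (fun _ => q) r)) q := by
  set h := noise w (fun _ => q) r with hh
  have hpos : ∀ x, 0 < h x := noise_pos hw ⟨fun _ => hq.1.le, fun _ => hq.2⟩ hr
  refine (hasDerivAt_mean w fun x =>
    have hx := hasDerivAt_noise hw r x hq.1.ne'
    hx.mul (hx.log (hpos x).ne')).congr_deriv ?_
  have hmass : ∀ i, mean w (h - avg w i h) = 0 := fun i => by
    rw [mean_sub, mean_avg hw, sub_self]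
  calc mean w _
      = mean w (q⁻¹ • fun x => ∑ i, ((h - avg w i h) * (Real.log ∘ h) + (h - avg w i h)) x) := by
        congr 1
        ext x
        have := (hpos x).ne'
        simp only [← hh, Pi.smul_apply, Pi.add_apply, Pi.mul_apply, Pi.sub_apply, comp_apply,
          smul_eq_mul, sum_add_distrib, ← sum_mul]
        field_simp
    _ = q⁻¹ * ∑ i, entropyProd w i h := by
        rw [mean_smul, mean_sum]
        simp only [mean_add, hmass, add_zero, entropyProd]

lemma entropy_le_sum_entropyProd (hw : w ∈ stdSimplex ℝ α) (hr : ∀ x, 0 < r x)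
    (hmean : mean w r = 1) : entropy w r ≤ ∑ i, entropyProd w i r := by
  have hle := sub_le_sub_of_hasDerivAt_le zero_le_one (continuousOn_entropy_noise hw hr)
    (continuous_mul_const (∑ i, entropyProd w i r)).continuousOn
    (fun q hq => hasDerivAt_entropy_noise hw hr ⟨hq.1, hq.2.le⟩)
    (fun q _ => hasDerivAt_mul_const _) fun q hq => by
      rw [inv_mul_le_iff₀ hq.1, mul_sum]
      exact sum_le_sum fun i _ =>
        entropyProd_noise_le hw ⟨fun _ => hq.1.le, fun _ => hq.2.le⟩ i hr
  have hone : noise w (fun _ => 1) r = r := noise_one w r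
  have hzero : noise w (fun _ => 0) r = fun _ => 1 := funext fun x => (noise_zero w r x).trans hmean
  rw [hone, hzero, entropy_one] at hle
  linarith

end Derivative

end EntropyProduction

/-! ### Transport along the noise semigroup -/

section Semigroup

lemma sub_le_two_mul_mul_log_sub {h m : ℝ} (hh : 0 < h) (hm : h ≤ m)
    (hmh : m ≤ Real.exp 1 * h) : m - h ≤ 2 * h * (Real.log m - Real.log h) := by
  set y := Real.log m - Real.log h with hy
  have hy₀ : 0 ≤ y := sub_nonneg.2 (Real.log_le_log hh hm)
  have hy₁ : y ≤ 1 := by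
    have := Real.log_le_log (hh.trans_le hm) hmh
    rw [Real.log_mul (Real.exp_pos 1).ne' hh.ne', Real.log_exp] at this
    linarith
  have hexp : Real.exp y = m / h := by
    rw [hy, Real.exp_sub, Real.exp_log hh, Real.exp_log (hh.trans_le hm)]
  have hchord := convexOn_exp.2 (Set.mem_univ (0 : ℝ)) (Set.mem_univ (1 : ℝ))
    (sub_nonneg.2 hy₁) hy₀ (by ring)
  simp only [smul_eq_mul, mul_zero, mul_one, zero_add, Real.exp_zero, hexp] at hchord
  have hratio : m / h ≤ 1 + 2 * y := by nlinarith [Real.exp_one_lt_d9]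
  rw [div_le_iff₀ hh] at hratio
  linarith

lemma sq_sub_le_mul_log {h m : ℝ} (hh : 0 < h) (hm : 0 < m) (hmh : m ≤ Real.exp 1 * h) :
    (h - m) ^ 2 ≤ 2 * h * ((h - m) * (Real.log h - Real.log m)) := by
  suffices hstep : |h - m| * |h - m| ≤ |h - m| * (2 * h * |Real.log h - Real.log m|) by
    have hsign : 0 ≤ (h - m) * (Real.log h - Real.log m) := by
      obtain hle | hle := le_total m h
      · exact mul_nonneg (sub_nonneg.2 hle) (sub_nonneg.2 (Real.log_le_log hm hle))
      · exact mul_nonneg_of_nonpos_of_nonpos (sub_nonpos.2 hle)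
          (sub_nonpos.2 (Real.log_le_log hh hle))
    rw [← abs_of_nonneg hsign, abs_mul, sq, ← abs_mul_abs_self]
    linarith
  refine mul_le_mul_of_nonneg_left ?_ (abs_nonneg _)
  obtain hle | hle := le_total m h
  · have hlog := Real.one_sub_inv_le_log_of_pos (div_pos hh hm)
    rw [inv_div, Real.log_div hh.ne' hm.ne'] at hlog
    have hmul := mul_le_mul_of_nonneg_left hlog hh.le
    rw [mul_sub, mul_div_cancel₀ m hh.ne', mul_one] at hmul
    rw [abs_of_nonneg (sub_nonneg.2 hle),
      abs_of_nonneg (sub_nonneg.2 (Real.log_le_log hm hle))]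
    linarith
  · rw [abs_sub_comm, abs_sub_comm (Real.log h), abs_of_nonneg (sub_nonneg.2 hle),
      abs_of_nonneg (sub_nonneg.2 (Real.log_le_log hh hle))]
    exact sub_le_two_mul_mul_log_sub hh hle hmh

lemma mul_sub_le_sq_add_mul_log {h m D lam : ℝ} (hh : 0 < h) (hm : 0 < m)
    (hmh : m ≤ Real.exp 1 * h) (hlam : 0 < lam) :
    D * (h - m) ≤ lam / 2 * (D ^ 2 * h)
      + lam⁻¹ * ((h - m) * (Real.log h - Real.log m)) := by
  have hsq := mul_le_mul_of_nonneg_left (sq_sub_le_mul_log hh hm hmh)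
    (by positivity : 0 ≤ (2 * lam * h)⁻¹)
  have hyoung : 0 ≤ (2 * lam * h)⁻¹ * (lam * h * D - (h - m)) ^ 2 := by positivity
  have hexpand : (2 * lam * h)⁻¹ * (lam * h * D - (h - m)) ^ 2
      = lam / 2 * (D ^ 2 * h) + (2 * lam * h)⁻¹ * (h - m) ^ 2 - D * (h - m) := by
    field_simp
    ring
  have hcancel : (2 * lam * h)⁻¹ * (2 * h * ((h - m) * (Real.log h - Real.log m)))
      = lam⁻¹ * ((h - m) * (Real.log h - Real.log m)) := by field_simp
  linarith

variable {ι α : Type*} [Fintype ι] [DecidableEq ι] [Fintype α] {w : α → ℝ} {lam : ℝ}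
  {G h r : (ι → α) → ℝ}

lemma mean_mul_sub_avg_le (hw : w ∈ stdSimplex ℝ α) (i : ι) {k : (ι → α) → ℝ}
    (hk : ∀ x z, k (update x i z) = k x) (hh : ∀ x, 0 < h x)
    (hreg : ∀ x, avg w i h x ≤ Real.exp 1 * h x) (hlam : 0 < lam) :
    mean w (G * (h - avg w i h))
      ≤ lam / 2 * mean w ((G - k) ^ 2 * h) + lam⁻¹ * entropyProd w i h := by
  have hcenter := mean_mul_sub_avg_eq_zero hw i hk h
  have hcenter_log := mean_mul_sub_avg_eq_zero hw i (k := Real.log ∘ avg w i h)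
    (fun x z => by rw [comp_apply, avg_update, comp_apply]) h
  calc mean w (G * (h - avg w i h))
      = mean w ((G - k) * (h - avg w i h)) := by rw [sub_mul, mean_sub, hcenter, sub_zero]
    _ ≤ mean w ((lam / 2) • ((G - k) ^ 2 * h)
          + lam⁻¹ • ((h - avg w i h) * (Real.log ∘ h)
            - (Real.log ∘ avg w i h) * (h - avg w i h))) := mean_mono hw fun x =>
        (mul_sub_le_sq_add_mul_log (hh x) (avg_pos hw i hh x) (hreg x) hlam).trans_eq (by
          simp only [Pi.add_apply, Pi.smul_apply, Pi.mul_apply, Pi.sub_apply, Pi.pow_apply,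
            comp_apply, smul_eq_mul]
          ring)
    _ = _ := by
        rw [mean_add, mean_smul, mean_smul, mean_sub, hcenter_log, sub_zero, entropyProd]

lemma sum_mean_mul_sub_avg_le (hw : w ∈ stdSimplex ℝ α) {k : ι → (ι → α) → ℝ}
    (hk : ∀ i x z, k i (update x i z) = k i x) (hh : ∀ x, 0 < h x)
    (hreg : ∀ i x, avg w i h x ≤ Real.exp 1 * h x) (hlam : 0 < lam) :
    ∑ i, mean w (G * (h - avg w i h))
      ≤ lam / 2 * mean w ((∑ i, (G - k i) ^ 2) * h) + lam⁻¹ * ∑ i, entropyProd w i h := by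
  have hsum : (∑ i, (G - k i) ^ 2) * h = fun x => ∑ i, ((G - k i) ^ 2 * h) x := by
    ext x
    simp only [Pi.mul_apply, Finset.sum_apply, sum_mul]
  rw [hsum, mean_sum, mul_sum, mul_sum, ← sum_add_distrib]
  exact sum_le_sum fun i _ => mean_mul_sub_avg_le hw i (hk i) hh (hreg i) hlam

lemma avg_noise_le_of_avg_le (hw : w ∈ stdSimplex ℝ α) {q : ι → ℝ} (hq : q ∈ Set.Icc 0 1)
    {i : ι} {c : ℝ} (hreg : ∀ x, avg w i h x ≤ c * h x) (x : ι → α) :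
    avg w i (noise w q h) x ≤ c * noise w q h x := by
  rw [← noise_avg hw]
  refine (noise_mono hw hq (v := c • h) hreg x).trans_eq ?_
  rw [noise_smul, Pi.smul_apply, smul_eq_mul]

lemma continuousOn_entropy_noise_div_sqrt (hw : w ∈ stdSimplex ℝ α) (hr : ∀ x, 0 < r x)
    (hmean : mean w r = 1) :
    ContinuousOn (fun q => entropy w (noise w (fun _ => q) r) / √q) (Set.Icc 0 1) := by
  have hent := continuousOn_entropy_noise hw hr
  intro q hq
  obtain rfl | hq₀ := eq_or_ne q 0
  · set E := ∑ i, entropyProd w i r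
    have hupper : ∀ s ∈ Set.Icc (0 : ℝ) 1,
        entropy w (noise w (fun _ => s) r) / √s ≤ √s * E := fun s hs => by
      have hs' : (fun _ : ι => s) ∈ Set.Icc (0 : ι → ℝ) 1 := ⟨fun _ => hs.1, fun _ => hs.2⟩
      have hle : entropy w (noise w (fun _ => s) r) ≤ s * E :=
        (entropy_le_sum_entropyProd hw (noise_pos hw hs' hr)
          ((mean_noise hw _ r).trans hmean)).trans
          (by rw [mul_sum]; exact sum_le_sum fun i _ => entropyProd_noise_le hw hs' i hr)
      calc entropy w (noise w (fun _ => s) r) / √s ≤ s * E / √s := by gcongr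
        _ = √s * E := by rw [mul_div_right_comm, Real.div_sqrt]
    have hlower : ∀ s ∈ Set.Icc (0 : ℝ) 1, 0 ≤ entropy w (noise w (fun _ => s) r) / √s :=
      fun s hs => div_nonneg (entropy_nonneg hw
        (noise_pos hw ⟨fun _ => hs.1, fun _ => hs.2⟩ hr) ((mean_noise hw _ r).trans hmean))
        (Real.sqrt_nonneg s)
    have hlim : Filter.Tendsto (fun s : ℝ => √s * E) (nhdsWithin 0 (Set.Icc 0 1)) (nhds 0) := by
      have : Continuous fun s : ℝ => √s * E := by fun_prop
      simpa using (this.tendsto 0).mono_left nhdsWithin_le_nhds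
    simpa [ContinuousWithinAt] using tendsto_of_tendsto_of_tendsto_of_le_of_le'
      tendsto_const_nhds hlim (Filter.eventually_of_mem self_mem_nhdsWithin hlower)
      (Filter.eventually_of_mem self_mem_nhdsWithin hupper)
  · exact (hent q hq).div Real.continuous_sqrt.continuousWithinAt
      (Real.sqrt_ne_zero'.2 (hq.1.lt_of_ne' hq₀))

lemma inv_mul_sum_mean_mul_sub_avg_le (hw : w ∈ stdSimplex ℝ α) {k : ι → (ι → α) → ℝ}
    (hk : ∀ i x z, k i (update x i z) = k i x) (hh : ∀ x, 0 < h x) (hmean : mean w h = 1)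
    (hreg : ∀ i x, avg w i h x ≤ Real.exp 1 * h x) (hlam : 0 < lam) {q v : ℝ} (hq : 0 < q)
    (hv : mean w ((∑ i, (G - k i) ^ 2) * h) ≤ v) :
    q⁻¹ * ∑ i, mean w (G * (h - avg w i h))
      ≤ lam * v * (1 / (2 * √q)) + 2 / lam *
        ((q⁻¹ * (∑ i, entropyProd w i h) * √q - entropy w h * (1 / (2 * √q))) / √q ^ 2) := by
  have hs : 0 < √q := Real.sqrt_pos.2 hq
  have hstep := sum_mean_mul_sub_avg_le (G := G) hw hk hh hreg (mul_pos hlam hs)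
  have hsobolev := entropy_le_sum_entropyProd hw hh hmean
  set J := ∑ i, entropyProd w i h
  have hinv : q⁻¹ = (√q ^ 2)⁻¹ := by rw [Real.sq_sqrt hq.le]
  calc q⁻¹ * ∑ i, mean w (G * (h - avg w i h))
      ≤ q⁻¹ * (lam * √q / 2 * v + (lam * √q)⁻¹ * J) :=
        mul_le_mul_of_nonneg_left (hstep.trans (by gcongr)) (inv_nonneg.2 hq.le)
    _ = lam * v * (1 / (2 * √q)) + 2 / lam *
          ((q⁻¹ * J * √q - J * (1 / (2 * √q))) / √q ^ 2) := by
        rw [hinv]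
        field_simp
        ring
    _ ≤ lam * v * (1 / (2 * √q)) + 2 / lam *
          ((q⁻¹ * J * √q - entropy w h * (1 / (2 * √q))) / √q ^ 2) := by gcongr

/-- The entropy produced along the semigroup pays for the transport. The weight `1 / √q` makes the
entropy production integrable at `q = 0`, where the modified logarithmic Sobolev inequality
absorbs the term coming from its derivative. -/
lemma mean_mul_sub_mean_le (hw : w ∈ stdSimplex ℝ α) {k : ι → (ι → α) → ℝ}
    (hk : ∀ i x z, k i (update x i z) = k i x) (hr : ∀ x, 0 < r x) (hmean : mean w r = 1)
    (hreg : ∀ i x, avg w i r x ≤ Real.exp 1 * r x) (hlam : 0 < lam) {v : ℝ}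
    (hv : ∀ q ∈ Set.Ioo (0 : ℝ) 1,
      mean w ((∑ i, (G - k i) ^ 2) * noise w (fun _ => q) r) ≤ v) :
    mean w (G * r) - mean w G ≤ lam * v + 2 / lam * entropy w r := by
  set T : ℝ → (ι → α) → ℝ := fun q => noise w (fun _ => q) r
  have hone : T 1 = r := noise_one w r
  have hzero : T 0 = fun _ => 1 := funext fun x => (noise_zero w r x).trans hmean
  have hle := sub_le_sub_of_hasDerivAt_le zero_le_one
    (continuous_mean_mul_noise w G r).continuousOn
    (S := fun q => lam * v * √q + 2 / lam * (entropy w (T q) / √q))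
    ((Real.continuous_sqrt.const_mul _).continuousOn.add
      (continuousOn_const.mul (continuousOn_entropy_noise_div_sqrt hw hr hmean)))
    (fun q hq => hasDerivAt_mean_mul_noise hw G r hq.1.ne')
    (fun q hq => ((Real.hasDerivAt_sqrt hq.1.ne').const_mul _).add
      (((hasDerivAt_entropy_noise hw hr ⟨hq.1, hq.2.le⟩).div
        (Real.hasDerivAt_sqrt hq.1.ne') (Real.sqrt_ne_zero'.2 hq.1)).const_mul _))
    fun q hq => ?_
  · simp only [Real.sqrt_one, Real.sqrt_zero, div_one, div_zero, mul_zero, add_zero, mul_one,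
      sub_zero] at hle
    have hG : mean w (G * T 0) = mean w G := by
      rw [hzero]
      exact congrArg _ (mul_one G)
    rwa [← hG, ← hone]
  · have hq' : (fun _ : ι => q) ∈ Set.Icc (0 : ι → ℝ) 1 :=
      ⟨fun _ => hq.1.le, fun _ => hq.2.le⟩
    exact inv_mul_sum_mean_mul_sub_avg_le hw hk (noise_pos hw hq' hr)
      ((mean_noise hw _ r).trans hmean) (fun i => avg_noise_le_of_avg_le hw hq' (hreg i))
      hlam hq.1 (hv q hq)

lemma mean_mul_noise_le_mean_sq (hw : w ∈ stdSimplex ℝ α) {q : ι → ℝ} (hq : q ∈ Set.Icc 0 1)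
    (u : (ι → α) → ℝ) : mean w (u * noise w q u) ≤ mean w (u ^ 2) := by
  have hhalf : mean w (u * noise w q u)
      ≤ mean w ((1 / 2 : ℝ) • (u ^ 2 + noise w q (u ^ 2))) := mean_mono hw fun x => by
    have hjensen : noise w q u x ^ 2 ≤ noise w q (u ^ 2) x := noise_sq_le hw hq u x
    simp only [Pi.mul_apply, Pi.smul_apply, Pi.add_apply, Pi.pow_apply, smul_eq_mul]
    linarith [two_mul_le_add_sq (u x) (noise w q u x)]
  rw [mean_smul, mean_add, mean_noise hw] at hhalf
  linarith

lemma variance_le_sum_mean_sq (hw : w ∈ stdSimplex ℝ α) (u : (ι → α) → ℝ) :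
    mean w (u * u) - mean w u ^ 2 ≤ ∑ i, mean w ((u - avg w i u) ^ 2) := by
  have hle := sub_le_sub_of_hasDerivAt_le zero_le_one
    (continuous_mean_mul_noise w u u).continuousOn
    (continuous_mul_const (∑ i, mean w ((u - avg w i u) ^ 2))).continuousOn
    (fun q hq => hasDerivAt_mean_mul_noise hw u u hq.1.ne')
    (fun q _ => hasDerivAt_mul_const _) fun q hq => by
      rw [inv_mul_le_iff₀ hq.1, mul_sum]
      refine sum_le_sum fun i _ => ?_
      have hq' : update (fun _ => q) i 1 ∈ Set.Icc (0 : ι → ℝ) 1 :=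
        update_mem_Icc ⟨fun _ => hq.1.le, fun _ => hq.2.le⟩ i ⟨zero_le_one, le_rfl⟩
      set Q := update (fun _ : ι => q) i 1
      have hcenter : mean w (u * (noise w Q u - avg w i (noise w Q u)))
          = mean w ((u - avg w i u) * noise w Q (u - avg w i u)) := by
        rw [noise_sub, noise_avg hw, sub_mul, mean_sub,
          mean_mul_sub_avg_eq_zero hw i (avg_update w i u), sub_zero]
      rw [noise_sub_avg_noise hw, mul_smul_comm, mean_smul, hcenter]
      exact mul_le_mul_of_nonneg_left (mean_mul_noise_le_mean_sq hw hq' _) hq.1.le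
  have hone : noise w (fun _ => 1) u = u := noise_one w u
  have hzero : noise w (fun _ => 0) u = fun _ => mean w u := funext fun x => noise_zero w u x
  have hsq : mean w (u * fun _ => mean w u) = mean w u ^ 2 := by
    have hcomm : (u * fun _ => mean w u) = mean w u • u := by
      ext x
      exact mul_comm _ _
    rw [hcomm, mean_smul, sq]
  rw [hone, hzero, hsq] at hle
  linarith

end Semigroup

/-! ### Deviations on a finite product space -/

section Deviation

noncomputable section Clip

/-- Truncation to the interval `[0, b]`. -/
def clip (b y : ℝ) : ℝ := max 0 (min y b)

lemma clip_nonneg (b y : ℝ) : 0 ≤ clip b y := le_max_left _ _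

lemma clip_le {b : ℝ} (hb : 0 ≤ b) (y : ℝ) : clip b y ≤ b := max_le hb (min_le_right _ _)

lemma clip_of_le {b y : ℝ} (hb : 0 ≤ b) (h : b ≤ y) : clip b y = b := by
  rw [clip, min_eq_right h, max_eq_right hb]

lemma sq_clip_sub_clip_le (b y z : ℝ) : (clip b y - clip b z) ^ 2 ≤ (y - z) ^ 2 := by
  refine sq_le_sq.2 ((abs_max_sub_max_le_max 0 (min y b) 0 (min z b)).trans ?_)
  rw [sub_self, abs_zero, max_eq_right (abs_nonneg _)]
  refine (abs_min_sub_min_le_max y b z b).trans_eq ?_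
  rw [sub_self, abs_zero, max_eq_left (abs_nonneg _)]

lemma clip_sub_le_sq {t : ℝ} (ht : 0 < t) (y : ℝ) :
    clip (t / 2) (y - t / 2) ≤ (2 * t)⁻¹ * y ^ 2 := by
  refine max_le (by positivity) ((min_le_left _ _).trans ?_)
  rw [le_inv_mul_iff₀ (by positivity)]
  linarith [sq_nonneg (y - t)]

end Clip

section Numerics

lemma three_pow_mul_exp_neg_le {n : ℕ} {ℓ : ℝ} (hℓ : 2 * n + 2 ≤ ℓ) :
    3 ^ n * Real.exp (-ℓ) ≤ 1 / 4 := by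
  have hfour : (4 : ℝ) ≤ Real.exp 1 ^ 2 := by nlinarith [Real.exp_one_gt_d9]
  rw [Real.exp_neg, ← div_eq_mul_inv, div_le_div_iff₀ (Real.exp_pos ℓ) (by norm_num), one_mul]
  calc (3 : ℝ) ^ n * 4 ≤ 4 ^ n * 4 := by gcongr; norm_num
    _ = 4 ^ (n + 1) := (pow_succ _ _).symm
    _ ≤ (Real.exp 1 ^ 2) ^ (n + 1) := by gcongr
    _ = Real.exp (2 * n + 2) := by
        rw [← pow_mul, Real.exp_one_pow]
        push_cast
        ring_nf
    _ ≤ Real.exp ℓ := Real.exp_le_exp.2 hℓ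

lemma inv_pow_le_two {n : ℕ} {ℓ a : ℝ} (hℓ : 2 * n + 2 ≤ ℓ) (ha : 1 - Real.exp (-ℓ) ≤ a) :
    (a ^ n)⁻¹ ≤ 2 := by
  have hδ := Real.exp_pos (-ℓ)
  have hpow := three_pow_mul_exp_neg_le hℓ
  have hn : (n : ℝ) * Real.exp (-ℓ) ≤ 3 ^ n * Real.exp (-ℓ) := by
    gcongr
    exact_mod_cast (Nat.lt_pow_self (by norm_num)).le
  have hone : 1 * Real.exp (-ℓ) ≤ 3 ^ n * Real.exp (-ℓ) := by
    gcongr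
    exact one_le_pow₀ (by norm_num)
  have hbernoulli := one_add_mul_le_pow (a := -Real.exp (-ℓ)) (by linarith) n
  have hmono : (1 + -Real.exp (-ℓ)) ^ n ≤ a ^ n := pow_le_pow_left₀ (by linarith) (by linarith) n
  refine inv_le_of_inv_le₀ two_pos ?_
  linarith

lemma exp_mul_two_pow_le {p : ℝ} {m : ℕ} (hm : (m : ℝ) ≤ p + 4) :
    Real.exp p * 2 * (2 ^ m + 1) ≤ Real.exp (2 * p + 6) := by
  have hone : (1 : ℝ) ≤ 2 ^ m := one_le_pow₀ one_le_two
  have hpow : (2 : ℝ) ^ (m + 2) ≤ Real.exp (p + 6) := by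
    calc (2 : ℝ) ^ (m + 2) ≤ Real.exp 1 ^ (m + 2) := by gcongr; linarith [Real.exp_one_gt_d9]
      _ = Real.exp (m + 2) := by rw [Real.exp_one_pow]; push_cast; rfl
      _ ≤ Real.exp (p + 6) := Real.exp_le_exp.2 (by linarith)
  calc Real.exp p * 2 * (2 ^ m + 1) ≤ Real.exp p * 2 ^ (m + 2) := by
        rw [mul_assoc, pow_add]
        exact mul_le_mul_of_nonneg_left (by linarith) (Real.exp_pos p).le
    _ ≤ Real.exp p * Real.exp (p + 6) := by gcongr
    _ = Real.exp (2 * p + 6) := by rw [← Real.exp_add]; ring_nf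

lemma exp_neg_three_le : Real.exp (-3) ≤ 1 / 20 := by
  have he := Real.exp_one_gt_d9
  have hcube : Real.exp 3 = Real.exp 1 ^ 3 := by rw [Real.exp_one_pow]; norm_num
  rw [Real.exp_neg, one_div, hcube]
  refine inv_anti₀ (by norm_num) ?_
  calc (20 : ℝ) ≤ 2.718 ^ 3 := by norm_num
    _ ≤ Real.exp 1 ^ 3 := by gcongr; linarith

end Numerics

section Densities

variable {ι α : Type*} {w : α → ℝ} {p : ℝ} {A : Set (ι → α)}

/-- For a set `A` of probability `e⁻ᵖ`, the mixture with weights `3/4` and `1/4` of the normalized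
indicator of `A` and the constant density. -/
noncomputable def mixtureDensity (p : ℝ) (A : Set (ι → α)) : (ι → α) → ℝ :=
  (3 / 4 * Real.exp p) • A.indicator 1 + fun _ => 1 / 4

lemma mixtureDensity_pos (p : ℝ) (A : Set (ι → α)) (x : ι → α) : 0 < mixtureDensity p A x := by
  have : 0 ≤ A.indicator (1 : (ι → α) → ℝ) x := Set.indicator_nonneg (fun _ _ => zero_le_one) x
  simp only [mixtureDensity, Pi.add_apply, Pi.smul_apply, smul_eq_mul]
  positivity

lemma mixtureDensity_le_exp (hp : 0 ≤ p) (x : ι → α) : mixtureDensity p A x ≤ Real.exp p := by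
  have hone : A.indicator (1 : (ι → α) → ℝ) x ≤ 1 :=
    Set.indicator_le_self' (fun _ _ => zero_le_one) x
  have hexp : 1 ≤ Real.exp p := Real.one_le_exp hp
  simp only [mixtureDensity, Pi.add_apply, Pi.smul_apply, smul_eq_mul]
  nlinarith [mul_le_mul_of_nonneg_left hone (Real.exp_pos p).le]

variable [Fintype ι] [DecidableEq ι] [Fintype α]

lemma mean_mixtureDensity (hw : w ∈ stdSimplex ℝ α)
    (hA : mean w (A.indicator 1) = Real.exp (-p)) : mean w (mixtureDensity p A) = 1 := by
  rw [mixtureDensity, mean_add, mean_smul, mean_const hw, hA, mul_assoc, ← Real.exp_add,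
    add_neg_cancel, Real.exp_zero]
  norm_num

lemma le_mean_mul_mixtureDensity (hw : w ∈ stdSimplex ℝ α)
    (hA : mean w (A.indicator 1) = Real.exp (-p)) {G : (ι → α) → ℝ} (hG : ∀ x, 0 ≤ G x) {c : ℝ}
    (hGA : ∀ x ∈ A, c ≤ G x) : 3 / 4 * c ≤ mean w (G * mixtureDensity p A) := by
  have hle : mean w ((3 / 4 * c * Real.exp p) • A.indicator 1)
      ≤ mean w (G * mixtureDensity p A) := by
    refine mean_mono hw fun x => ?_
    simp only [mixtureDensity, Pi.smul_apply, Pi.mul_apply, Pi.add_apply, smul_eq_mul]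
    by_cases hx : x ∈ A
    · rw [Set.indicator_of_mem hx, Pi.one_apply]
      nlinarith [hG x, mul_le_mul_of_nonneg_right (hGA x hx) (Real.exp_pos p).le]
    · rw [Set.indicator_of_notMem hx]
      linarith [hG x]
  rwa [mean_smul, hA, mul_assoc, ← Real.exp_add, add_neg_cancel, Real.exp_zero, mul_one] at hle

/-- The function `G` and the approximations `k i` have a square function `∑ i, (G - k i) ^ 2` of
mean at most `v` under every (sub)density bounded by `M`. -/
def SquareFunctionBound (w : α → ℝ) (G : (ι → α) → ℝ) (k : ι → (ι → α) → ℝ) (M v : ℝ) : Prop :=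
  ∀ ρ : (ι → α) → ℝ, (∀ x, 0 ≤ ρ x) → (∀ x, ρ x ≤ M) → mean w ρ ≤ 1 →
    mean w ((∑ i, (G - k i) ^ 2) * ρ) ≤ v

lemma SquareFunctionBound.clip (hw : w ∈ stdSimplex ℝ α) {F : (ι → α) → ℝ}
    {k : ι → (ι → α) → ℝ} {M v : ℝ} (h : SquareFunctionBound w F k M v) (b a : ℝ) :
    SquareFunctionBound w (fun x => clip b (F x - a)) (fun i x => clip b (k i x - a)) M v := by
  intro ρ hρ hρM hmean
  refine (mean_mono hw fun x => mul_le_mul_of_nonneg_right ?_ (hρ x)).trans (h ρ hρ hρM hmean)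
  simp only [Finset.sum_apply, Pi.pow_apply, Pi.sub_apply]
  refine sum_le_sum fun i _ => (sq_clip_sub_clip_le b _ _).trans_eq ?_
  rw [sub_sub_sub_cancel_right]

end Densities

section TruncatedDual

variable {ι α : Type*} [Fintype ι] [DecidableEq ι] [Fintype α] {w : α → ℝ} {ℓ p v lam : ℝ}
  {h f G : (ι → α) → ℝ} {k : ι → (ι → α) → ℝ}

/-- The dual factor restricted to the region where the terminal density is at least `e⁻³`. The
bridge density built from it is bounded, and the part removed has small total mass. -/
noncomputable def truncatedDual (w : α → ℝ) (ℓ : ℝ) (f : (ι → α) → ℝ) : (ι → α) → ℝ :=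
  {x | Real.exp (-3) ≤ terminalDensity w ℓ f x}.indicator (dualFactor w ℓ f)

lemma truncatedDual_nonneg (hw : w ∈ stdSimplex ℝ α) (hℓ : 0 ≤ ℓ) (hf : ∀ x, 0 < f x)
    (x : ι → α) : 0 ≤ truncatedDual w ℓ f x :=
  Set.indicator_nonneg (fun y _ => (dualFactor_pos hw hℓ hf y).le) x

lemma truncatedDual_le (hw : w ∈ stdSimplex ℝ α) (hℓ : 0 ≤ ℓ) (hf : ∀ x, 0 < f x)
    (x : ι → α) : truncatedDual w ℓ f x ≤ dualFactor w ℓ f x :=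
  Set.indicator_le_self' (fun y _ => (dualFactor_pos hw hℓ hf y).le) x

lemma noise_mul_truncatedDual_le (hw : w ∈ stdSimplex ℝ α) (hℓ : 0 ≤ ℓ) (hf : ∀ x, 0 < f x)
    (x : ι → α) :
    noise w (keepProb ℓ) f x * truncatedDual w ℓ f x ≤ terminalDensity w ℓ f x := by
  rw [← noise_mul_dualFactor hw hℓ hf]
  exact mul_le_mul_of_nonneg_left (truncatedDual_le hw hℓ hf x)
    (noise_keepProb_pos hw hℓ hf x).le

lemma noise_mul_dualFactor_sub_truncatedDual_le (hw : w ∈ stdSimplex ℝ α) (hℓ : 0 ≤ ℓ)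
    (hf : ∀ x, 0 < f x) (x : ι → α) :
    noise w (keepProb ℓ) f x * (dualFactor w ℓ f x - truncatedDual w ℓ f x) ≤ Real.exp (-3) := by
  by_cases hx : x ∈ {x | Real.exp (-3) ≤ terminalDensity w ℓ f x}
  · rw [truncatedDual, Set.indicator_of_mem hx, sub_self, mul_zero]
    exact (Real.exp_pos _).le
  · rw [truncatedDual, Set.indicator_of_notMem hx, sub_zero, noise_mul_dualFactor hw hℓ hf]
    exact (not_le.1 hx).le

lemma exp_le_noise_of_truncatedDual_ne_zero (hw : w ∈ stdSimplex ℝ α) (hℓ : 0 < ℓ)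
    (hf : ∀ x, 0 < f x) {x : ι → α} (hx : truncatedDual w ℓ f x ≠ 0) :
    Real.exp (-3 * ℓ) ≤ noise w (keepProb ℓ) f x :=
  exp_mul_le_noise_keepProb hw hℓ hf
    (Set.mem_of_indicator_ne_zero (s := {x | Real.exp (-3) ≤ terminalDensity w ℓ f x}) hx)

namespace IsSchrodingerFactor

lemma mean_noise_mul_truncatedDual_le (hw : w ∈ stdSimplex ℝ α) (hℓ : 0 ≤ ℓ)
    (hF : IsSchrodingerFactor w ℓ h f) :
    mean w (noise w (keepProb ℓ) f * truncatedDual w ℓ f) ≤ mean w h :=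
  (mean_mono hw (noise_mul_truncatedDual_le hw hℓ hF.pos)).trans_eq
    (hF.mean_terminalDensity hw hℓ)

lemma mean_mul_le_mean_mul_truncatedDual (hw : w ∈ stdSimplex ℝ α) (hℓ : 0 ≤ ℓ)
    (hF : IsSchrodingerFactor w ℓ h f) {c : ℝ} (hc : 0 ≤ c) (hGc : ∀ x, G x ≤ c) :
    mean w (G * h) ≤ mean w (G * (f * noise w (keepProb ℓ) (truncatedDual w ℓ f))) + c / 20 := by
  set D := dualFactor w ℓ f - truncatedDual w ℓ f
  have hD : ∀ x, 0 ≤ D x := fun x => sub_nonneg.2 (truncatedDual_le hw hℓ hF.pos x)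
  have hsplit : mean w (G * h) - mean w (G * (f * noise w (keepProb ℓ) (truncatedDual w ℓ f)))
      = mean w (G * (f * noise w (keepProb ℓ) D)) := by
    rw [← mean_sub, noise_sub, ← mul_sub, mul_sub f,
      show f * noise w (keepProb ℓ) (dualFactor w ℓ f) = h from funext hF.mul_noise_dualFactor]
  have hloss : mean w (f * noise w (keepProb ℓ) D) ≤ 1 / 20 := by
    rw [mean_mul_noise]
    refine (mean_mono hw (noise_mul_dualFactor_sub_truncatedDual_le hw hℓ hF.pos)).trans ?_
    rw [mean_const hw]
    exact exp_neg_three_le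
  have hle : mean w (G * (f * noise w (keepProb ℓ) D))
      ≤ mean w (c • (f * noise w (keepProb ℓ) D)) :=
    mean_mono hw fun x => mul_le_mul_of_nonneg_right (hGc x)
      (mul_nonneg (hF.pos x).le (noise_nonneg hw (keepProb_mem_Icc hℓ) hD x))
  rw [mean_smul] at hle
  linarith [mul_le_mul_of_nonneg_left hloss hc]

lemma bridge_truncatedDual_le (hw : w ∈ stdSimplex ℝ α) (hℓ : 2 * Fintype.card ι + 2 ≤ ℓ)
    (hF : IsSchrodingerFactor w ℓ h f) (hp : 0 ≤ p) (hhp : ∀ x, h x ≤ Real.exp p) {a : ℝ}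
    (ha : 1 - Real.exp (-ℓ) ≤ a) (ha₁ : a ≤ 1) (x : ι → α) :
    bridge w (1 - Real.exp (-ℓ)) f (truncatedDual w ℓ f) a x ≤ Real.exp (2 * p + 6) := by
  have hℓ₁ : 1 ≤ ℓ := by linarith [(Fintype.card ι).cast_nonneg (α := ℝ)]
  have hceil : (⌈p + 3⌉₊ : ℝ) ≤ p + 4 := by
    linarith [Nat.ceil_lt_add_one (show 0 ≤ p + 3 by linarith)]
  calc bridge w (1 - Real.exp (-ℓ)) f (truncatedDual w ℓ f) a x
      ≤ Real.exp p * (a ^ Fintype.card ι)⁻¹ * (2 ^ ⌈p + 3⌉₊ + 1) :=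
        bridge_indicator_dualFactor_le hw hℓ₁ ((three_pow_mul_exp_neg_le hℓ).trans (by norm_num))
          (Nat.le_ceil _) hF.pos (hF.le_exp hw hℓ₁ hhp) (Real.exp_pos p).le
          (fun y => (hF.mul_noise_dualFactor y).trans_le (hhp y))
          (fun y hy => exp_mul_le_noise_keepProb hw (by linarith) hF.pos hy) ha ha₁ x
    _ ≤ Real.exp p * 2 * (2 ^ ⌈p + 3⌉₊ + 1) := by
        gcongr
        exact inv_pow_le_two hℓ ha
    _ ≤ Real.exp (2 * p + 6) := exp_mul_two_pow_le hceil

lemma mean_mul_sub_terminalDensity_le (hw : w ∈ stdSimplex ℝ α)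
    (hℓ : 2 * Fintype.card ι + 2 ≤ ℓ) (hF : IsSchrodingerFactor w ℓ h f) (hp : 0 ≤ p)
    (hhp : ∀ x, h x ≤ Real.exp p) (hmean : mean w h = 1) (hG : ∀ x, 0 ≤ G x)
    (hk : ∀ i x z, k i (update x i z) = k i x) (hlam : 0 < lam) (hv₀ : 0 ≤ v)
    (hv : SquareFunctionBound w G k (Real.exp (2 * p + 6)) v) :
    mean w (G * (f * noise w (keepProb ℓ) (truncatedDual w ℓ f)))
        - mean w (G * terminalDensity w ℓ f) ≤ 4 * lam * v + 4 * (p + 6) / lam := by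
  have hℓ₀ : 0 < ℓ := by linarith [(Fintype.card ι).cast_nonneg (α := ℝ)]
  have hsmall := three_pow_mul_exp_neg_le hℓ
  have hδ : Real.exp (-ℓ) ≤ 1 / 4 := by
    refine le_trans ?_ hsmall
    exact le_mul_of_one_le_left (Real.exp_pos _).le (one_le_pow₀ (by norm_num))
  have hceil : (⌈p + 3⌉₊ : ℝ) ≤ p + 4 := by
    linarith [Nat.ceil_lt_add_one (show 0 ≤ p + 3 by linarith)]
  have hg₀ := truncatedDual_nonneg hw hℓ₀.le hF.pos
  have hmass := (hF.mean_noise_mul_truncatedDual_le hw hℓ₀.le).trans_eq hmean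
  have hjumps := exp_neg_mul_sum_mean_mul_avg_noise_le hw hℓ₀ (hsmall.trans (by norm_num))
    (Nat.le_ceil (p + 3)) (fun x => (hF.pos x).le) (hF.le_exp hw (by linarith) hhp) hg₀
    (fun x => exp_le_noise_of_truncatedDual_ne_zero hw hℓ₀ hF.pos) hmass
  have hbridge := mean_mul_bridge_one_sub_le hw (fun x => (hF.pos x).le) hg₀ hk
    (Real.exp_pos (-ℓ)) (by linarith) hlam hjumps hv₀ fun a ha => by
      have ha₀ : 0 < a := by linarith [ha.1]
      exact hv _ (bridge_nonneg hw (by linarith) ha.1.le ha.2.le (fun x => (hF.pos x).le) hg₀)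
        (hF.bridge_truncatedDual_le hw hℓ hp hhp ha.1.le ha.2.le)
        ((mean_bridge hw _ ha₀.ne' _ _).trans_le hmass)
  have hend : mean w (G * (noise w (keepProb ℓ) f * truncatedDual w ℓ f))
      ≤ mean w (G * terminalDensity w ℓ f) := mean_mono hw fun x =>
    mul_le_mul_of_nonneg_left (noise_mul_truncatedDual_le hw hℓ₀.le hF.pos x) (hG x)
  calc _ ≤ _ := sub_le_sub_left hend _
    _ ≤ _ := hbridge
    _ ≤ 2 * (2 * lam * v + 2 * (p + 6) / lam) := by
        have hinv : (1 - Real.exp (-ℓ))⁻¹ ≤ 2 := inv_le_of_inv_le₀ two_pos (by linarith)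
        have hcount : 2 * ((⌈p + 3⌉₊ : ℝ) + 2) / lam ≤ 2 * (p + 6) / lam := by
          rw [div_le_div_iff_of_pos_right hlam]
          linarith
        gcongr
    _ = 4 * lam * v + 4 * (p + 6) / lam := by ring

lemma mean_mul_terminalDensity_sub_le (hw : w ∈ stdSimplex ℝ α) (hℓ : 1 ≤ ℓ)
    (hF : IsSchrodingerFactor w ℓ h f) (hp : 0 ≤ p) (hhp : ∀ x, h x ≤ Real.exp p)
    (hmean : mean w h = 1) (hk : ∀ i x z, k i (update x i z) = k i x) (hlam : 0 < lam)
    (hv : SquareFunctionBound w G k (Real.exp (2 * p + 6)) v) :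
    mean w (G * terminalDensity w ℓ f) - mean w G ≤ lam * v + 2 / lam * p := by
  have hℓ₀ : 0 ≤ ℓ := zero_le_one.trans hℓ
  have hr := terminalDensity_pos hw hℓ₀ hF.pos
  have hr₁ := (hF.mean_terminalDensity hw hℓ₀).trans hmean
  have hrp := hF.terminalDensity_le hw hℓ hhp
  refine (mean_mul_sub_mean_le hw hk hr hr₁ (avg_terminalDensity_le hw hℓ hF.pos) hlam (v := v)
    fun q hq => ?_).trans ?_
  · have hq' : (fun _ : ι => q) ∈ Set.Icc 0 1 := ⟨fun _ => hq.1.le, fun _ => hq.2.le⟩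
    exact hv _ (noise_nonneg hw hq' fun x => (hr x).le)
      (noise_le_of_forall_le hw hq' fun x => (hrp x).trans (Real.exp_le_exp.2 (by linarith)))
      ((mean_noise hw _ _).trans hr₁).le
  · gcongr
    exact entropy_le_of_le_exp hw hr hr₁ hrp

end IsSchrodingerFactor

end TruncatedDual

variable {ι α : Type*} [Fintype ι] [DecidableEq ι] [Fintype α] {w : α → ℝ} {p v : ℝ}

lemma mean_mul_sub_mean_le_sqrt (hw : w ∈ stdSimplex ℝ α) {h G : (ι → α) → ℝ}
    {k : ι → (ι → α) → ℝ} {c : ℝ} (hh : ∀ x, 0 < h x) (hmean : mean w h = 1) (hp : 0 ≤ p)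
    (hhp : ∀ x, h x ≤ Real.exp p) (hG : ∀ x, 0 ≤ G x) (hc : 0 ≤ c) (hGc : ∀ x, G x ≤ c)
    (hk : ∀ i x z, k i (update x i z) = k i x) (hv₀ : 0 < v)
    (hv : SquareFunctionBound w G k (Real.exp (2 * p + 6)) v) :
    mean w (G * h) - mean w G ≤ 31 * √((p + 1) * v) + c / 20 := by
  have hℓ : 1 ≤ 2 * (Fintype.card ι : ℝ) + 2 := by
    linarith [(Fintype.card ι).cast_nonneg (α := ℝ)]
  obtain ⟨f, hF⟩ := exists_isSchrodingerFactor hw hℓ hh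
  set lam := √((p + 1) / v)
  have hlam : 0 < lam := Real.sqrt_pos.2 (by positivity)
  have hlam_mul : lam * v = √((p + 1) * v) := by
    rw [← Real.sqrt_mul_self hv₀.le, ← Real.sqrt_mul (by positivity), Real.sqrt_mul_self hv₀.le]
    congr 1
    field_simp
  have hdiv_lam : (p + 1) / lam = √((p + 1) * v) := by
    rw [← hlam_mul, div_eq_iff hlam.ne', mul_right_comm, Real.mul_self_sqrt (by positivity),
      div_mul_cancel₀ _ hv₀.ne']
  have hsplit := hF.mean_mul_le_mean_mul_truncatedDual hw (zero_le_one.trans hℓ) hc hGc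
  have hbridge := hF.mean_mul_sub_terminalDensity_le hw le_rfl hp hhp hmean hG hk hlam hv₀.le hv
  have hsemigroup :=
    hF.mean_mul_terminalDensity_sub_le hw hℓ hp hhp hmean hk hlam hv
  have hsum : 4 * (p + 6) / lam + 2 / lam * p ≤ 26 * ((p + 1) / lam) := by
    rw [div_mul_eq_mul_div, ← add_div, ← mul_div_assoc]
    gcongr
    linarith
  linarith

lemma mean_clip_le (hw : w ∈ stdSimplex ℝ α) {F : (ι → α) → ℝ} {t M : ℝ} (ht : 0 < t)
    (hM : 1 ≤ M) (hv : SquareFunctionBound w F (fun i => avg w i F) M v) :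
    mean w (fun x => clip (t / 2) (F x - (mean w F + t / 2))) ≤ (2 * t)⁻¹ * v := by
  have hES : mean w (F * F) - mean w F ^ 2 ≤ v := by
    have hone := hv (fun _ => 1) (fun _ => zero_le_one) (fun _ => hM) (mean_const hw 1).le
    refine (variance_le_sum_mean_sq hw F).trans (le_of_eq_of_le ?_ hone)
    rw [← mean_sum]
    congr 1
    ext x
    simp
  have hvar : mean w (fun x => (F x - mean w F) ^ 2) = mean w (F * F) - mean w F ^ 2 := by
    have hexpand : (fun x => (F x - mean w F) ^ 2)
        = F * F - (2 * mean w F) • F + fun _ => mean w F ^ 2 := by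
      ext x
      simp only [Pi.add_apply, Pi.sub_apply, Pi.mul_apply, Pi.smul_apply, smul_eq_mul]
      ring
    rw [hexpand, mean_add, mean_sub, mean_smul, mean_const hw]
    ring
  calc mean w (fun x => clip (t / 2) (F x - (mean w F + t / 2)))
      ≤ mean w ((2 * t)⁻¹ • fun x => (F x - mean w F) ^ 2) :=
        mean_mono hw fun x => by
          rw [← sub_sub]
          exact clip_sub_le_sq ht _
    _ = (2 * t)⁻¹ * (mean w (F * F) - mean w F ^ 2) := by rw [mean_smul, hvar]
    _ ≤ (2 * t)⁻¹ * v := by gcongr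

/-- Transport the clipped function `G` from the mixture density on the deviation set, where its
mean is of order `t`, to the uniform density, where its mean is of order `v / t`. -/
theorem deviation_le (hw : w ∈ stdSimplex ℝ α) {F : (ι → α) → ℝ} {t : ℝ} (ht : 0 < t)
    (hp : 0 ≤ p) (hv₀ : 0 < v)
    (hA : mean w ({x | mean w F + t ≤ F x}.indicator 1) = Real.exp (-p))
    (hv : SquareFunctionBound w F (fun i => avg w i F) (Real.exp (2 * p + 6)) v) :
    t ≤ 100 * √((p + 1) * v) := by
  set b := mean w F + t / 2 with hb
  set G : (ι → α) → ℝ := fun x => clip (t / 2) (F x - b)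
  set Y := √((p + 1) * v)
  have hY : 0 < Y := Real.sqrt_pos.2 (by positivity)
  have hG : ∀ x, 0 ≤ G x := fun x => clip_nonneg _ _
  have hlower : 3 / 4 * (t / 2) ≤ mean w (G * mixtureDensity p {x | mean w F + t ≤ F x}) := by
    refine le_mean_mul_mixtureDensity hw hA hG fun x hx => (clip_of_le (by positivity) ?_).ge
    rw [Set.mem_ofPred_eq] at hx
    linarith
  have htransport := mean_mul_sub_mean_le_sqrt hw (mixtureDensity_pos p _)
    (mean_mixtureDensity hw hA) hp (mixtureDensity_le_exp hp) hG (by positivity)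
    (fun x => clip_le (by positivity) _)
    (fun i x z => congrArg (fun y => clip (t / 2) (y - b)) (avg_update w i F x z)) hv₀
    (hv.clip hw (t / 2) b)
  have hclip : mean w G ≤ (2 * t)⁻¹ * v := mean_clip_le hw ht (Real.one_le_exp (by linarith)) hv
  by_contra! hlt
  have hvY : v ≤ Y ^ 2 := by
    rw [Real.sq_sqrt (by positivity)]
    exact le_mul_of_one_le_left hv₀.le (by linarith)
  have hsmall : (2 * t)⁻¹ * v ≤ Y := by
    rw [inv_mul_le_iff₀ (by positivity)]
    nlinarith [mul_lt_mul_of_pos_right hlt hY]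
  linarith

end Deviation

/-! ### Approximation by functions of finitely many discretized coordinates -/

section Discretization

variable {I Ω₀ : Type*}

/-- The configuration seen on a finite set of sites and through a finite-valued map `κ`. -/
def quant (s : Finset I) {k : ℕ} (κ : Ω₀ → Fin k) (ω : I → Ω₀) : s → Fin k := fun i => κ (ω i)

variable [MeasurableSpace Ω₀]

lemma measurable_quant (s : Finset I) {k : ℕ} {κ : Ω₀ → Fin k} (hκ : Measurable κ) :
    Measurable (quant (I := I) s κ) :=
  measurable_pi_iff.2 fun _ => hκ.comp (measurable_pi_apply _)

/-- A function of finitely many coordinates, each seen through a measurable map to a finite set.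
One map for all coordinates suffices, since finitely many can be merged into one. -/
def IsDiscrete (Y : (I → Ω₀) → ℝ) : Prop :=
  ∃ (s : Finset I) (k : ℕ) (κ : Ω₀ → Fin k) (g : (s → Fin k) → ℝ),
    Measurable κ ∧ Y = fun ω => g (quant s κ ω)

lemma IsDiscrete.measurable {Y : (I → Ω₀) → ℝ} (hY : IsDiscrete Y) : Measurable Y := by
  obtain ⟨s, k, κ, g, hκ, rfl⟩ := hY
  exact (measurable_of_finite g).comp (measurable_quant s hκ)

lemma IsDiscrete.map₂ (φ : ℝ → ℝ → ℝ) {Y Z : (I → Ω₀) → ℝ} (hY : IsDiscrete Y)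
    (hZ : IsDiscrete Z) : IsDiscrete (fun ω => φ (Y ω) (Z ω)) := by
  classical
  obtain ⟨s, k, κ, g, hκ, rfl⟩ := hY
  obtain ⟨s', k', κ', g', hκ', rfl⟩ := hZ
  refine ⟨s ∪ s', k * k', fun a => finProdFinEquiv (κ a, κ' a),
    fun x => φ (g fun i => (finProdFinEquiv.symm (x ⟨i, mem_union_left _ i.2⟩)).1)
      (g' fun i => (finProdFinEquiv.symm (x ⟨i, mem_union_right _ i.2⟩)).2), ?_, ?_⟩
  · exact (measurable_of_finite _).comp (hκ.prodMk hκ')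
  · ext ω
    simp only [quant, Equiv.symm_apply_apply]
    rfl

lemma isDiscrete_const (c : ℝ) : IsDiscrete (fun _ : I → Ω₀ => c) :=
  ⟨∅, 1, fun _ => 0, fun _ => c, measurable_const, rfl⟩

/-- The ring of sets whose indicator is a function of finitely many discretized coordinates. -/
def discreteSets (I Ω₀ : Type*) [MeasurableSpace Ω₀] : Set (Set (I → Ω₀)) :=
  {A | IsDiscrete (A.indicator (1 : (I → Ω₀) → ℝ))}

lemma IsDiscrete.mem_discreteSets {Y : (I → Ω₀) → ℝ} (hY : IsDiscrete Y) {A : Set (I → Ω₀)}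
    (hA : Y = A.indicator 1) : A ∈ discreteSets I Ω₀ :=
  show IsDiscrete (A.indicator 1) from hA ▸ hY

lemma eval_preimage_mem_discreteSets (i : I) {A : Set Ω₀} (hA : MeasurableSet A) :
    Function.eval i ⁻¹' A ∈ discreteSets I Ω₀ := by
  classical
  refine ⟨{i}, 2, fun a => if a ∈ A then 1 else 0,
    fun x => if x ⟨i, mem_singleton_self i⟩ = 1 then 1 else 0,
    Measurable.ite hA measurable_const measurable_const, ?_⟩
  ext ω
  by_cases h : ω i ∈ A <;> simp [quant, Set.indicator, h]

lemma isSetRing_discreteSets : IsSetRing (discreteSets I Ω₀) where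
  empty_mem := (isDiscrete_const 0).mem_discreteSets (Set.indicator_empty _).symm
  union_mem A B hA hB := by
    refine (IsDiscrete.map₂ (fun a b => a + b - a * b) hA hB).mem_discreteSets ?_
    ext ω
    by_cases hωA : ω ∈ A <;> by_cases hωB : ω ∈ B <;> simp [Set.indicator, hωA, hωB]
  sdiff_mem A B hA hB := by
    refine (IsDiscrete.map₂ (fun a b => a - a * b) hA hB).mem_discreteSets ?_
    ext ω
    by_cases hωA : ω ∈ A <;> by_cases hωB : ω ∈ B <;> simp [Set.indicator, hωA, hωB]

lemma measurableSet_of_mem_discreteSets {A : Set (I → Ω₀)} (hA : A ∈ discreteSets I Ω₀) :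
    MeasurableSet A :=
  (measurable_indicator_const_iff (1 : ℝ)).1 (IsDiscrete.measurable hA)

lemma generateFrom_discreteSets :
    (MeasurableSpace.pi : MeasurableSpace (I → Ω₀))
      = MeasurableSpace.generateFrom (discreteSets I Ω₀) := by
  refine le_antisymm (iSup_le fun i => ?_)
    (MeasurableSpace.generateFrom_le fun A => measurableSet_of_mem_discreteSets)
  rintro _ ⟨A, hA, rfl⟩
  exact MeasurableSpace.measurableSet_generateFrom (eval_preimage_mem_discreteSets i hA)

lemma exists_isDiscrete_eLpNorm_sub_indicator_le (μ : Measure (I → Ω₀)) [IsFiniteMeasure μ]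
    (c : ℝ) {A : Set (I → Ω₀)} (hA : MeasurableSet A) {ε : ℝ≥0∞} (hε : ε ≠ 0) :
    ∃ Y, eLpNorm (Y - A.indicator fun _ => c) 1 μ ≤ ε ∧ IsDiscrete Y := by
  obtain ⟨η, hη, hηε⟩ := exists_eLpNorm_indicator_le (μ := μ) ENNReal.one_ne_top c hε
  obtain ⟨B, hB, hBA⟩ := exists_measure_symmDiff_lt_of_generateFrom_isSetRing (μ := μ)
    isSetRing_discreteSets ⟨{Set.univ}, Set.countable_singleton _,
      Set.singleton_subset_iff.2
        ((isDiscrete_const 1).mem_discreteSets (Set.indicator_univ _).symm),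
      by simp⟩
    generateFrom_discreteSets hA (ENNReal.coe_pos.2 hη)
  refine ⟨B.indicator fun _ => c, ?_, ?_⟩
  · rw [eLpNorm_indicator_sub_indicator]
    exact hηε _ hBA.le
  · convert IsDiscrete.map₂ (fun a _ => c * a) hB hB with ω
    simp [Set.indicator]

lemma exists_isDiscrete_eLpNorm_sub_le (μ : Measure (I → Ω₀)) [IsFiniteMeasure μ]
    {X : (I → Ω₀) → ℝ} (hX : Integrable X μ) {ε : ℝ≥0∞} (hε : ε ≠ 0) :
    ∃ Y, eLpNorm (X - Y) 1 μ ≤ ε ∧ IsDiscrete Y :=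
  MemLp.induction_dense ENNReal.one_ne_top IsDiscrete
    (fun c _ hA _ _ hε => exists_isDiscrete_eLpNorm_sub_indicator_le μ c hA hε)
    (fun _ _ hf hg => IsDiscrete.map₂ (· + ·) hf hg)
    (fun _ hf => hf.measurable.aestronglyMeasurable) (memLp_one_iff_integrable.2 hX) hε

end Discretization

/-! ### Averages over the cells of a discretization -/

section FiberMean

variable {Ω T : Type*} [MeasurableSpace Ω] {μ : Measure Ω} {X : Ω → ℝ} {π : Ω → T}

lemma setLIntegral_preimage_singleton [MeasurableSpace T] [MeasurableSingletonClass T]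
    (hπ : Measurable π) (F : T → Ω → ℝ≥0∞) (a : T) :
    ∫⁻ ω in π ⁻¹' {a}, F (π ω) ω ∂μ = ∫⁻ ω in π ⁻¹' {a}, F a ω ∂μ := by
  refine setLIntegral_congr_fun (hπ (measurableSet_singleton a)) fun ω hω => ?_
  have hω : π ω = a := hω
  simp only [hω]

omit [MeasurableSpace Ω] in
lemma pairwise_disjoint_preimage_singleton (π : Ω → T) :
    Pairwise (Disjoint on fun a => π ⁻¹' {a}) :=
  fun _ _ hab => (Set.disjoint_singleton.2 hab).preimage π

lemma sum_setIntegral_preimage_singleton [Fintype T] [MeasurableSpace T]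
    [MeasurableSingletonClass T] (hπ : Measurable π) (hX : Integrable X μ) :
    ∑ a, ∫ ω in π ⁻¹' {a}, X ω ∂μ = ∫ ω, X ω ∂μ := by
  rw [← integral_iUnion_fintype (fun a => hπ (measurableSet_singleton a))
    (pairwise_disjoint_preimage_singleton π) fun _ => hX.integrableOn]
  rw [← Set.preimage_iUnion, Set.iUnion_of_singleton, Set.preimage_univ, Measure.restrict_univ]

lemma sum_setLIntegral_preimage_singleton [Fintype T] [MeasurableSpace T]
    [MeasurableSingletonClass T] (hπ : Measurable π) (f : Ω → ℝ≥0∞) :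
    ∑ a, ∫⁻ ω in π ⁻¹' {a}, f ω ∂μ = ∫⁻ ω, f ω ∂μ := by
  rw [← tsum_fintype (L := SummationFilter.unconditional _),
    ← lintegral_iUnion (fun a => hπ (measurableSet_singleton a))
      (pairwise_disjoint_preimage_singleton π)]
  rw [← Set.preimage_iUnion, Set.iUnion_of_singleton, Set.preimage_univ, Measure.restrict_univ]

lemma ofReal_integral_le_lintegral (hX : Integrable X μ) :
    ENNReal.ofReal (∫ ω, X ω ∂μ) ≤ ∫⁻ ω, ENNReal.ofReal (X ω) ∂μ := by
  rw [integral_eq_lintegral_pos_part_sub_lintegral_neg_part hX]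
  exact (ENNReal.ofReal_le_ofReal (sub_le_self _ ENNReal.toReal_nonneg)).trans
    ENNReal.ofReal_toReal_le

lemma ofReal_measureReal_mul_sq_setAverage_le [IsFiniteMeasure μ] (hX : Integrable X μ)
    (A : Set Ω) :
    ENNReal.ofReal (μ.real A * (⨍ ω in A, X ω ∂μ) ^ 2)
      ≤ ∫⁻ ω in A, ENNReal.ofReal (X ω ^ 2) ∂μ := by
  set D := ⨍ ω in A, X ω ∂μ with hD
  have hlin : ∫ ω in A, (2 * D * X ω - D ^ 2) ∂μ = μ.real A * D ^ 2 := by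
    rw [integral_sub (hX.integrableOn.const_mul _) (integrable_const _), integral_const_mul,
      ← measure_smul_setAverage X (measure_ne_top μ A), ← hD, setIntegral_const]
    simp only [smul_eq_mul]
    ring
  rw [← hlin]
  refine (ofReal_integral_le_lintegral
    ((hX.integrableOn.const_mul _).sub (integrable_const _))).trans
    (lintegral_mono fun ω => ENNReal.ofReal_le_ofReal ?_)
  simp only [Pi.sub_apply]
  linarith [sq_nonneg (X ω - D)]

/-- The mean of `X` on the fibers of `π`, that is, `𝔼[X | π]` as a function of the value of `π`;
it is `0` on the null fibers. -/
noncomputable def fiberMean (μ : Measure Ω) (π : Ω → T) (X : Ω → ℝ) (a : T) : ℝ :=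
  ⨍ ω in π ⁻¹' {a}, X ω ∂μ

lemma measureReal_mul_fiberMean [IsFiniteMeasure μ] (X : Ω → ℝ) (π : Ω → T) (a : T) :
    μ.real (π ⁻¹' {a}) * fiberMean μ π X a = ∫ ω in π ⁻¹' {a}, X ω ∂μ :=
  measure_smul_setAverage X (measure_ne_top μ _)

lemma lintegral_enorm_sub_fiberMean_le [IsFiniteMeasure μ] [Finite T] [MeasurableSpace T]
    [MeasurableSingletonClass T] (hπ : Measurable π) (hX : Integrable X μ) (g : T → ℝ) :
    ∫⁻ ω, ‖X ω - fiberMean μ π X (π ω)‖ₑ ∂μ ≤ 2 * ∫⁻ ω, ‖X ω - g (π ω)‖ₑ ∂μ := by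
  have := Fintype.ofFinite T
  have hmean : ∫⁻ ω, ‖g (π ω) - fiberMean μ π X (π ω)‖ₑ ∂μ ≤ ∫⁻ ω, ‖X ω - g (π ω)‖ₑ ∂μ := by
    rw [← sum_setLIntegral_preimage_singleton hπ,
      ← sum_setLIntegral_preimage_singleton hπ fun ω => ‖X ω - g (π ω)‖ₑ]
    refine sum_le_sum fun a _ => ?_
    rw [setLIntegral_preimage_singleton hπ (fun a _ => ‖g a - fiberMean μ π X a‖ₑ),
      setLIntegral_preimage_singleton hπ fun a ω => ‖X ω - g a‖ₑ]
    calc ∫⁻ _ in π ⁻¹' {a}, ‖g a - fiberMean μ π X a‖ₑ ∂μ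
        = ‖∫ ω in π ⁻¹' {a}, (X ω - g a) ∂μ‖ₑ := by
          rw [integral_sub hX.integrableOn (integrable_const _), ← measureReal_mul_fiberMean,
            setIntegral_const, smul_eq_mul, ← mul_sub, enorm_mul, setLIntegral_const, mul_comm,
            enorm_sub_rev, Real.enorm_of_nonneg measureReal_nonneg, ofReal_measureReal]
      _ ≤ ∫⁻ ω in π ⁻¹' {a}, ‖X ω - g a‖ₑ ∂μ := enorm_integral_le_lintegral_enorm _
  have hmeas : AEMeasurable (fun ω => ‖X ω - g (π ω)‖ₑ) μ :=
    (hX.aemeasurable.sub ((measurable_of_finite g).comp hπ).aemeasurable).enorm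
  calc ∫⁻ ω, ‖X ω - fiberMean μ π X (π ω)‖ₑ ∂μ
      ≤ ∫⁻ ω, (‖X ω - g (π ω)‖ₑ + ‖g (π ω) - fiberMean μ π X (π ω)‖ₑ) ∂μ := by
        refine lintegral_mono fun ω => ?_
        rw [← sub_add_sub_cancel (X ω) (g (π ω))]
        exact enorm_add_le _ _
    _ = ∫⁻ ω, ‖X ω - g (π ω)‖ₑ ∂μ + ∫⁻ ω, ‖g (π ω) - fiberMean μ π X (π ω)‖ₑ ∂μ :=
        lintegral_add_left' hmeas _
    _ ≤ 2 * ∫⁻ ω, ‖X ω - g (π ω)‖ₑ ∂μ := by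
        rw [two_mul]
        gcongr

end FiberMean

section Cells

variable {I Ω₀ : Type*} [MeasurableSpace Ω₀]

/-- The law `P₀^I` of independent sites indexed by `I`: `productLaw` for an arbitrary set of
sites. -/
noncomputable abbrev siteLaw (I : Type*) (P₀ : Measure Ω₀) : Measure (I → Ω₀) :=
  Measure.infinitePi fun _ => P₀

/-- The conditional expectation of `X` given all sites but `i`: `condExpOff` for an arbitrary set
of sites. -/
noncomputable def siteCondExp (P₀ : Measure Ω₀) (X : (I → Ω₀) → ℝ) (i : I) : (I → Ω₀) → ℝ :=
  condExp (cylinderEvents (X := fun _ => Ω₀) {i}ᶜ) (siteLaw I P₀) X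

/-- The `[0, ∞]`-valued square function `∑ (X - X'ᵢ)²`: `verticalVar` for an arbitrary set of
sites. -/
noncomputable def squareFn (P₀ : Measure Ω₀) (X : (I → Ω₀) → ℝ) (ω : I → Ω₀) : ℝ≥0∞ :=
  ∑' i, ENNReal.ofReal ((X ω - siteCondExp P₀ X i ω) ^ 2)

/-- The law of a discretized coordinate. -/
noncomputable def cellWeight (P₀ : Measure Ω₀) {k : ℕ} (κ : Ω₀ → Fin k) (c : Fin k) : ℝ :=
  P₀.real (κ ⁻¹' {c})

variable (P₀ : Measure Ω₀) [IsProbabilityMeasure P₀] {X : (I → Ω₀) → ℝ}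

lemma indep_comap_cylinderEvents_compl (i : I) :
    ProbabilityTheory.Indep (MeasurableSpace.comap (fun ω : I → Ω₀ => ω i) inferInstance)
      (cylinderEvents (X := fun _ => Ω₀) {i}ᶜ) (siteLaw I P₀) := by
  have hindep := ProbabilityTheory.iIndepFun_infinitePi (ι := I) (P := fun _ => P₀)
    (X := fun _ x => x) fun _ => measurable_id
  simpa [cylinderEvents] using ProbabilityTheory.indep_iSup_of_disjoint
    (m := fun j => MeasurableSpace.comap (fun ω : I → Ω₀ => ω j) inferInstance)
    (fun j => (measurable_pi_apply j).comap_le) hindep.iIndep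
    (S := {i}) (T := {i}ᶜ) disjoint_compl_right

lemma measureReal_eval_preimage (i : I) {A : Set Ω₀} (hA : MeasurableSet A) :
    (siteLaw I P₀).real (eval i ⁻¹' A) = P₀.real A := by
  rw [← map_measureReal_apply (measurable_pi_apply i) hA,
    Measure.infinitePi_map_eval (fun _ : I => P₀) i]

lemma setIntegral_eval_preimage_inter (i : I) {A : Set Ω₀} (hA : MeasurableSet A)
    {B : Set (I → Ω₀)} (hB : MeasurableSet[cylinderEvents (X := fun _ => Ω₀) {i}ᶜ] B)
    (hXm : Measurable[cylinderEvents (X := fun _ => Ω₀) {i}ᶜ] X)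
    (hX : Integrable X (siteLaw I P₀)) :
    ∫ ω in eval i ⁻¹' A ∩ B, X ω ∂siteLaw I P₀ = P₀.real A * ∫ ω in B, X ω ∂siteLaw I P₀ := by
  have hA' : MeasurableSet (eval i ⁻¹' A : Set (I → Ω₀)) := measurable_pi_apply i hA
  have hB' : MeasurableSet B := cylinderEvents_le_pi _ hB
  have hindep : ProbabilityTheory.IndepFun
      ((eval i ⁻¹' A).indicator (1 : (I → Ω₀) → ℝ)) (B.indicator X) (siteLaw I P₀) := by
    refine ProbabilityTheory.indep_of_indep_of_le_left (ProbabilityTheory.indep_of_indep_of_le_right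
      (indep_comap_cylinderEvents_compl P₀ i) ?_) ?_
    · exact (hXm.indicator hB).comap_le
    · exact (Measurable.indicator (m := MeasurableSpace.comap _ _) measurable_const
        ⟨A, hA, rfl⟩).comap_le
  have hmul := hindep.integral_mul_eq_mul_integral
    (measurable_const.indicator hA').aestronglyMeasurable
    (hX.indicator hB').aestronglyMeasurable
  rw [integral_indicator hB', integral_indicator_one hA', measureReal_eval_preimage P₀ i hA]
    at hmul
  rw [← hmul, ← integral_indicator (hA'.inter hB')]
  congr 1 with ω
  by_cases hωA : ω ∈ eval i ⁻¹' A <;> by_cases hωB : ω ∈ B <;> simp [Set.indicator, hωA, hωB]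

variable (s : Finset I) {k : ℕ} {κ : Ω₀ → Fin k}

lemma cellWeight_mem_stdSimplex (hκ : Measurable κ) :
    cellWeight P₀ κ ∈ stdSimplex ℝ (Fin k) := by
  refine ⟨fun _ => measureReal_nonneg, ?_⟩
  simpa [cellWeight] using
    sum_setIntegral_preimage_singleton (μ := P₀) hκ (integrable_const (1 : ℝ))

lemma measureReal_quant_preimage (hκ : Measurable κ) (a : s → Fin k) :
    (siteLaw I P₀).real (quant s κ ⁻¹' {a}) = ∏ i, cellWeight P₀ κ (a i) := by
  classical
  set t : I → Set Ω₀ := fun i => if h : i ∈ s then κ ⁻¹' {a ⟨i, h⟩} else Set.univ with ht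
  have ht_mem (i : s) : t i = κ ⁻¹' {a i} := by simp only [ht, i.2, dif_pos]
  have hcell : quant s κ ⁻¹' {a} = Set.pi s t := by
    ext ω
    rw [Set.mem_pi, Set.mem_preimage, Set.mem_singleton_iff, funext_iff, Subtype.forall]
    exact forall₂_congr fun i hi => by rw [ht_mem ⟨i, hi⟩]; rfl
  rw [hcell, measureReal_def, Measure.infinitePi_pi, ENNReal.toReal_prod, ← prod_coe_sort]
  · exact prod_congr rfl fun i _ => by rw [ht_mem, cellWeight, measureReal_def]
  · exact fun i hi => ht_mem ⟨i, hi⟩ ▸ hκ (measurableSet_singleton _)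

variable [DecidableEq I]

lemma mean_cellWeight (hκ : Measurable κ) (u : (s → Fin k) → ℝ) :
    mean (cellWeight P₀ κ) u = ∫ ω, u (quant s κ ω) ∂siteLaw I P₀ := by
  have hm := measurable_quant (I := I) s hκ
  have hu_int : Integrable (fun ω => u (quant s κ ω)) (siteLaw I P₀) :=
    (Integrable.of_finite (f := u)).comp_measurable hm
  rw [← sum_setIntegral_preimage_singleton hm hu_int, mean]
  refine sum_congr rfl fun a _ => ?_
  rw [← measureReal_quant_preimage P₀ s hκ, setIntegral_congr_fun (hm (measurableSet_singleton a))
    (g := fun _ => u a) fun ω hω => congrArg u hω, setIntegral_const, smul_eq_mul]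

/-- The conditional mean of `X` on the cells of the discretization. -/
noncomputable def cellMean (κ : Ω₀ → Fin k) (X : (I → Ω₀) → ℝ) : (s → Fin k) → ℝ :=
  fiberMean (siteLaw I P₀) (quant s κ) X

lemma mean_cellMean (hκ : Measurable κ) (hX : Integrable X (siteLaw I P₀)) :
    mean (cellWeight P₀ κ) (cellMean P₀ s κ X) = ∫ ω, X ω ∂siteLaw I P₀ := by
  rw [← sum_setIntegral_preimage_singleton (measurable_quant s hκ) hX, mean]
  refine sum_congr rfl fun a _ => ?_
  rw [← measureReal_quant_preimage P₀ s hκ, cellMean, measureReal_mul_fiberMean]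

/-- The cell of `a` with the constraint at site `i` removed. -/
def cellOff (κ : Ω₀ → Fin k) (a : s → Fin k) (i : s) : Set (I → Ω₀) :=
  {ω | ∀ j ≠ i, quant s κ ω j = a j}

omit [DecidableEq I] in
lemma measurableSet_cellOff (hκ : Measurable κ) (a : s → Fin k) (i : s) :
    MeasurableSet[cylinderEvents (X := fun _ => Ω₀) {(i : I)}ᶜ] (cellOff s κ a i) := by
  simp only [cellOff, Set.ofPred_forall]
  refine MeasurableSet.iInter fun j => MeasurableSet.iInter fun hj => ?_
  have hj' : (j : I) ∈ ({(i : I)}ᶜ : Set I) := fun h => hj (Subtype.ext h)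
  exact (hκ.comp (measurable_cylinderEvent_apply (X := fun _ => Ω₀) hj'))
    (measurableSet_singleton (a j))

omit [MeasurableSpace Ω₀] [DecidableEq I] in
lemma eval_preimage_inter_cellOff (κ : Ω₀ → Fin k) (a : s → Fin k) (i : s) :
    eval (i : I) ⁻¹' (κ ⁻¹' {a i}) ∩ cellOff s κ a i = quant s κ ⁻¹' {a} := by
  ext ω
  refine ⟨fun ⟨hi, hoff⟩ => funext fun j => ?_, fun h => ⟨congrFun h i, fun j _ => congrFun h j⟩⟩
  obtain rfl | hj := eq_or_ne j i
  · exact hi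
  · exact hoff j hj

omit [MeasurableSpace Ω₀] in
lemma cellOff_eq_iUnion (κ : Ω₀ → Fin k) (a : s → Fin k) (i : s) :
    cellOff s κ a i = ⋃ z, quant s κ ⁻¹' {update a i z} := by
  ext ω
  refine ⟨fun h => Set.mem_iUnion.2 ⟨quant s κ ω i, ?_⟩, fun h j hj => ?_⟩
  · exact (eq_update_iff.2 ⟨rfl, h⟩ : quant s κ ω = update a i (quant s κ ω i))
  · obtain ⟨z, hz⟩ := Set.mem_iUnion.1 h
    exact (eq_update_iff.1 hz).2 j hj

omit [IsProbabilityMeasure P₀] in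
lemma setIntegral_cellOff (hκ : Measurable κ) (hX : Integrable X (siteLaw I P₀))
    (a : s → Fin k) (i : s) :
    ∫ ω in cellOff s κ a i, X ω ∂siteLaw I P₀
      = ∑ z, ∫ ω in quant s κ ⁻¹' {update a i z}, X ω ∂siteLaw I P₀ := by
  rw [cellOff_eq_iUnion, integral_iUnion_fintype
    (fun z => measurable_quant s hκ (measurableSet_singleton _)) ?_ fun z => hX.integrableOn]
  exact fun z z' hz => pairwise_disjoint_preimage_singleton _ ((update_injective a i).ne hz)

lemma cellWeight_mul_measureReal_quant_preimage (hκ : Measurable κ) (a : s → Fin k) (i : s)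
    (z : Fin k) :
    cellWeight P₀ κ (a i) * (siteLaw I P₀).real (quant s κ ⁻¹' {update a i z})
      = (siteLaw I P₀).real (quant s κ ⁻¹' {a}) * cellWeight P₀ κ z := by
  have hprod : ∏ j ∈ univ.erase i, cellWeight P₀ κ (update a i z j)
      = ∏ j ∈ univ.erase i, cellWeight P₀ κ (a j) :=
    prod_congr rfl fun j hj => by rw [update_of_ne (ne_of_mem_erase hj)]
  rw [measureReal_quant_preimage P₀ s hκ, measureReal_quant_preimage P₀ s hκ,
    ← mul_prod_erase univ _ (mem_univ i), hprod, update_self,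
    ← mul_prod_erase univ (fun j => cellWeight P₀ κ (a j)) (mem_univ i)]
  ring

lemma setIntegral_siteCondExp_cell (hκ : Measurable κ) (hX : Integrable X (siteLaw I P₀))
    (a : s → Fin k) (i : s) :
    ∫ ω in quant s κ ⁻¹' {a}, siteCondExp P₀ X i ω ∂siteLaw I P₀
      = (siteLaw I P₀).real (quant s κ ⁻¹' {a})
        * avg (cellWeight P₀ κ) i (cellMean P₀ s κ X) a := by
  rw [← eval_preimage_inter_cellOff s κ a i, siteCondExp, setIntegral_eval_preimage_inter P₀ _
    (hκ (measurableSet_singleton _)) (measurableSet_cellOff s hκ a i)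
    stronglyMeasurable_condExp.measurable integrable_condExp,
    setIntegral_condExp cylinderEvents_le_pi hX (measurableSet_cellOff s hκ a i),
    setIntegral_cellOff P₀ s hκ hX, eval_preimage_inter_cellOff, avg, mul_sum, mul_sum]
  refine sum_congr rfl fun z _ => ?_
  rw [← measureReal_mul_fiberMean, ← mul_assoc, ← mul_assoc, cellMean,
    ← cellWeight_mul_measureReal_quant_preimage P₀ s hκ, cellWeight]

lemma ofReal_measureReal_mul_sq_cellMean_sub_avg_le (hκ : Measurable κ)
    (hX : Integrable X (siteLaw I P₀)) (a : s → Fin k) (i : s) :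
    ENNReal.ofReal ((siteLaw I P₀).real (quant s κ ⁻¹' {a})
      * (cellMean P₀ s κ X a - avg (cellWeight P₀ κ) i (cellMean P₀ s κ X) a) ^ 2)
      ≤ ∫⁻ ω in quant s κ ⁻¹' {a}, ENNReal.ofReal ((X ω - siteCondExp P₀ X i ω) ^ 2)
        ∂siteLaw I P₀ := by
  have hX' : Integrable (siteCondExp P₀ X i) (siteLaw I P₀) := integrable_condExp
  by_cases hnull : (siteLaw I P₀).real (quant s κ ⁻¹' {a}) = 0
  · simp [hnull]
  have hmean : ⨍ ω in quant s κ ⁻¹' {a}, (X - siteCondExp P₀ X i) ω ∂siteLaw I P₀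
      = cellMean P₀ s κ X a - avg (cellWeight P₀ κ) i (cellMean P₀ s κ X) a := by
    refine mul_left_cancel₀ hnull ?_
    rw [← smul_eq_mul, measure_smul_setAverage _ (measure_ne_top _ _),
      integral_sub' hX.integrableOn hX'.integrableOn, setIntegral_siteCondExp_cell P₀ s hκ hX,
      ← measureReal_mul_fiberMean, cellMean]
    ring
  rw [← hmean]
  exact ofReal_measureReal_mul_sq_setAverage_le (hX.sub hX') _

end Cells

section CellDeviation

variable {I Ω₀ : Type*} [MeasurableSpace Ω₀] (P₀ : Measure Ω₀) [IsProbabilityMeasure P₀]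
  {X : (I → Ω₀) → ℝ} (s : Finset I) {k : ℕ} {κ : Ω₀ → Fin k} [DecidableEq I]

lemma ofReal_measureReal_mul_sum_sq_le_setLIntegral_squareFn (hκ : Measurable κ)
    (hX : Integrable X (siteLaw I P₀)) (a : s → Fin k) :
    ENNReal.ofReal ((siteLaw I P₀).real (quant s κ ⁻¹' {a})
      * ∑ i, (cellMean P₀ s κ X a - avg (cellWeight P₀ κ) i (cellMean P₀ s κ X) a) ^ 2)
      ≤ ∫⁻ ω in quant s κ ⁻¹' {a}, squareFn P₀ X ω ∂siteLaw I P₀ := by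
  rw [mul_sum, ENNReal.ofReal_sum_of_nonneg
    fun i _ => mul_nonneg measureReal_nonneg (sq_nonneg _)]
  refine (sum_le_sum fun i _ =>
    ofReal_measureReal_mul_sq_cellMean_sub_avg_le P₀ s hκ hX a i).trans ?_
  have hmeas (i : I) : AEMeasurable
      (fun ω => ENNReal.ofReal ((X ω - siteCondExp P₀ X i ω) ^ 2)) (siteLaw I P₀) :=
    ((hX.aemeasurable.sub integrable_condExp.aemeasurable).pow_const 2).ennreal_ofReal
  rw [← lintegral_finsetSum' _ fun (i : s) _ => (hmeas i).restrict]
  refine lintegral_mono fun ω => ?_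
  rw [sum_coe_sort s fun i : I => ENNReal.ofReal ((X ω - siteCondExp P₀ X i ω) ^ 2)]
  exact ENNReal.sum_le_tsum s

lemma ofReal_mean_sum_sq_mul_le_lintegral_squareFn (hκ : Measurable κ)
    (hX : Integrable X (siteLaw I P₀)) {ρ : (s → Fin k) → ℝ} (hρ : ∀ a, 0 ≤ ρ a) :
    ENNReal.ofReal (mean (cellWeight P₀ κ)
      ((∑ i, (cellMean P₀ s κ X - avg (cellWeight P₀ κ) i (cellMean P₀ s κ X)) ^ 2) * ρ))
      ≤ ∫⁻ ω, ENNReal.ofReal (ρ (quant s κ ω)) * squareFn P₀ X ω ∂siteLaw I P₀ := by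
  have hm := measurable_quant (I := I) s hκ
  simp only [mean, ← measureReal_quant_preimage P₀ s hκ, Pi.mul_apply, Finset.sum_apply,
    Pi.pow_apply, Pi.sub_apply]
  rw [← sum_setLIntegral_preimage_singleton hm, ENNReal.ofReal_sum_of_nonneg fun a _ =>
    mul_nonneg measureReal_nonneg (mul_nonneg (sum_nonneg fun _ _ => sq_nonneg _) (hρ a))]
  refine sum_le_sum fun a _ => ?_
  rw [setLIntegral_preimage_singleton hm fun a ω => ENNReal.ofReal (ρ a) * squareFn P₀ X ω,
    lintegral_const_mul' _ _ ENNReal.ofReal_ne_top, ← mul_assoc, mul_comm,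
    ENNReal.ofReal_mul (hρ a)]
  gcongr
  exact ofReal_measureReal_mul_sum_sq_le_setLIntegral_squareFn P₀ s hκ hX a

lemma lintegral_density_mul_le {Ω : Type*} [MeasurableSpace Ω] {μ : Measure Ω}
    {ρ V : Ω → ℝ≥0∞} (hρm : Measurable ρ) {R : ℝ≥0∞} (hR : R ≠ ∞) (hρR : ∀ ω, ρ ω ≤ R)
    (hρ : ∫⁻ ω, ρ ω ∂μ ≤ 1) (M : ℝ≥0∞) :
    ∫⁻ ω, ρ ω * V ω ∂μ ≤ M + R * ∫⁻ ω, {ω | M < V ω}.indicator V ω ∂μ := by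
  have hsplit (ω) : ρ ω * V ω ≤ M * ρ ω + R * {ω | M < V ω}.indicator V ω := by
    by_cases hω : ω ∈ {ω | M < V ω}
    · rw [Set.indicator_of_mem hω]
      exact (mul_le_mul_left (hρR ω) _).trans le_add_self
    · rw [Set.indicator_of_notMem hω, mul_zero, add_zero, mul_comm]
      exact mul_le_mul_left (not_lt.1 hω) _
  calc ∫⁻ ω, ρ ω * V ω ∂μ
      ≤ ∫⁻ ω, (M * ρ ω + R * {ω | M < V ω}.indicator V ω) ∂μ := lintegral_mono hsplit
    _ = M * ∫⁻ ω, ρ ω ∂μ + R * ∫⁻ ω, {ω | M < V ω}.indicator V ω ∂μ := by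
        rw [lintegral_add_left (hρm.const_mul _), lintegral_const_mul _ hρm,
          lintegral_const_mul' _ _ hR]
    _ ≤ M + R * ∫⁻ ω, {ω | M < V ω}.indicator V ω ∂μ := by
        gcongr
        exact mul_le_of_le_one_right' hρ

lemma squareFunctionBound_cellMean (hκ : Measurable κ) (hX : Integrable X (siteLaw I P₀))
    {R v : ℝ} (hv₀ : 0 ≤ v) {M : ℝ≥0∞}
    (hv : M + ENNReal.ofReal R *
      ∫⁻ ω, {ω | M < squareFn P₀ X ω}.indicator (squareFn P₀ X) ω ∂siteLaw I P₀
        ≤ ENNReal.ofReal v) :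
    SquareFunctionBound (cellWeight P₀ κ) (cellMean P₀ s κ X)
      (fun i => avg (cellWeight P₀ κ) i (cellMean P₀ s κ X)) R v := by
  intro ρ hρ₀ hρR hρ₁
  have hm := measurable_quant (I := I) s hκ
  have hρ_int : Integrable (fun ω => ρ (quant s κ ω)) (siteLaw I P₀) :=
    (Integrable.of_finite (f := ρ)).comp_measurable hm
  have hmass : ∫⁻ ω, ENNReal.ofReal (ρ (quant s κ ω)) ∂siteLaw I P₀ ≤ 1 := by
    rw [← ofReal_integral_eq_lintegral_ofReal hρ_int (.of_forall fun ω => hρ₀ _),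
      ← mean_cellWeight P₀ s hκ]
    exact ENNReal.ofReal_le_one.2 hρ₁
  rw [← ENNReal.ofReal_le_ofReal_iff hv₀]
  exact (ofReal_mean_sum_sq_mul_le_lintegral_squareFn P₀ s hκ hX hρ₀).trans
    ((lintegral_density_mul_le ((measurable_of_finite ρ).comp hm).ennreal_ofReal
      ENNReal.ofReal_ne_top (fun ω => ENNReal.ofReal_le_ofReal (hρR _)) hmass M).trans hv)

omit [DecidableEq I] in
theorem cellMean_deviation_le (hκ : Measurable κ) (hX : Integrable X (siteLaw I P₀))
    {t p v : ℝ} (ht : 0 < t) (hp : 0 ≤ p) (hv₀ : 0 < v) {M : ℝ≥0∞}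
    (hA : (siteLaw I P₀).real {ω | ∫ ω, X ω ∂siteLaw I P₀ + t ≤ cellMean P₀ s κ X (quant s κ ω)}
      = Real.exp (-p))
    (hv : M + ENNReal.ofReal (Real.exp (2 * p + 6)) *
      ∫⁻ ω, {ω | M < squareFn P₀ X ω}.indicator (squareFn P₀ X) ω ∂siteLaw I P₀
        ≤ ENNReal.ofReal v) :
    t ≤ 100 * √((p + 1) * v) := by
  classical
  refine deviation_le (cellWeight_mem_stdSimplex P₀ hκ) (F := cellMean P₀ s κ X) ht hp hv₀ ?_
    (squareFunctionBound_cellMean P₀ s hκ hX hv₀.le hv)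
  have hset : MeasurableSet
      {ω | ∫ ω, X ω ∂siteLaw I P₀ + t ≤ cellMean P₀ s κ X (quant s κ ω)} :=
    measurableSet_le measurable_const
      ((measurable_of_finite (cellMean P₀ s κ X)).comp (measurable_quant s hκ))
  rw [mean_cellMean P₀ s hκ hX, mean_cellWeight P₀ s hκ, ← hA, ← integral_indicator_one hset]
  rfl

end CellDeviation

/-! ### Tails and exponential moments -/

section ExpRpow

/-- `exp (u ^ a)` with values in `[0, ∞]`. -/
noncomputable def expRpow (a : ℝ) (u : ℝ≥0∞) : ℝ≥0∞ := EReal.exp ((u ^ a : ℝ≥0∞) : EReal)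

variable {a : ℝ}

lemma expRpow_ofReal (ha : 0 ≤ a) {x : ℝ} (hx : 0 ≤ x) :
    expRpow a (ENNReal.ofReal x) = ENNReal.ofReal (Real.exp (x ^ a)) := by
  rw [expRpow, ENNReal.ofReal_rpow_of_nonneg hx ha, EReal.coe_ennreal_ofReal,
    max_eq_left (Real.rpow_nonneg hx a), EReal.exp_coe]

lemma expRpow_top (ha : 0 < a) : expRpow a ∞ = ∞ := by
  simp [expRpow, ENNReal.top_rpow_of_pos ha]

lemma one_le_expRpow (a : ℝ) (u : ℝ≥0∞) : 1 ≤ expRpow a u := by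
  rw [← EReal.exp_zero]
  exact EReal.exp_monotone (EReal.coe_ennreal_nonneg _)

lemma one_le_lintegral_expRpow {Ω : Type*} [MeasurableSpace Ω] {μ : Measure Ω}
    [IsProbabilityMeasure μ] (a : ℝ) (V : Ω → ℝ≥0∞) : 1 ≤ ∫⁻ ω, expRpow a (V ω) ∂μ := by
  simpa using lintegral_mono (μ := μ) fun ω => one_le_expRpow a (V ω)

lemma one_le_of_lintegral_expRpow_le {Ω : Type*} [MeasurableSpace Ω] {μ : Measure Ω}
    [IsProbabilityMeasure μ] {V : Ω → ℝ≥0∞} {A : ℝ}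
    (hV : ∫⁻ ω, expRpow a (V ω) ∂μ ≤ ENNReal.ofReal A) : 1 ≤ A :=
  ENNReal.one_le_ofReal.1 ((one_le_lintegral_expRpow a V).trans hV)

lemma le_mul_exp_rpow_half (ha : 0 < a) {u : ℝ} (hu : 0 ≤ u) :
    u ≤ (2 / a) ^ a⁻¹ * Real.exp (u ^ a / 2) := by
  have hexp : a * u ^ a / 2 ≤ Real.exp (a * u ^ a / 2) := by
    linarith [Real.add_one_le_exp (a * u ^ a / 2)]
  have hbase : u ^ a ≤ 2 / a * Real.exp (a * u ^ a / 2) := by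
    rw [div_mul_eq_mul_div, le_div_iff₀ ha]
    linarith
  calc u = (u ^ a) ^ a⁻¹ := (Real.rpow_rpow_inv hu ha.ne').symm
    _ ≤ (2 / a * Real.exp (a * u ^ a / 2)) ^ a⁻¹ := by gcongr
    _ = (2 / a) ^ a⁻¹ * Real.exp (u ^ a / 2) := by
      rw [Real.mul_rpow (by positivity) (by positivity), ← Real.exp_mul]
      congr 2
      field_simp

lemma le_mul_expRpow_of_lt (ha : 0 < a) {C A y M : ℝ} (hC : 0 < C) (hA : 0 < A) (hM₀ : 0 ≤ M)
    (hM : 2 * (y + Real.log A) ≤ M ^ a) {u : ℝ≥0∞} (hu : ENNReal.ofReal (M / C) < u) :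
    u ≤ ENNReal.ofReal ((2 / a) ^ a⁻¹ / C * (Real.exp (-y) * A⁻¹))
      * expRpow a (ENNReal.ofReal C * u) := by
  obtain rfl | hut := eq_or_ne u ∞
  · rw [ENNReal.mul_top (ENNReal.ofReal_pos.2 hC).ne', expRpow_top ha,
      ENNReal.mul_top (ENNReal.ofReal_pos.2 (by positivity)).ne']
  obtain ⟨x, hx, rfl⟩ : ∃ x : ℝ, 0 ≤ x ∧ u = ENNReal.ofReal x :=
    ⟨u.toReal, ENNReal.toReal_nonneg, (ENNReal.ofReal_toReal hut).symm⟩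
  rw [ENNReal.ofReal_lt_ofReal_iff_of_nonneg (by positivity), div_lt_iff₀' hC] at hu
  rw [← ENNReal.ofReal_mul hC.le, expRpow_ofReal ha.le (by positivity),
    ← ENNReal.ofReal_mul (by positivity)]
  refine ENNReal.ofReal_le_ofReal ?_
  have hrpow : M ^ a ≤ (C * x) ^ a := by gcongr
  have hexp : Real.exp ((C * x) ^ a / 2) ≤ Real.exp (-y) * A⁻¹ * Real.exp ((C * x) ^ a) := by
    rw [← Real.exp_log (inv_pos.2 hA), Real.log_inv, ← Real.exp_add, ← Real.exp_add]
    exact Real.exp_le_exp.2 (by linarith)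
  calc x = C * x / C := by field_simp
    _ ≤ (2 / a) ^ a⁻¹ * (Real.exp (-y) * A⁻¹ * Real.exp ((C * x) ^ a)) / C := by
        refine div_le_div_of_nonneg_right ?_ hC.le
        exact (le_mul_exp_rpow_half ha (by positivity)).trans (by gcongr)
    _ = (2 / a) ^ a⁻¹ / C * (Real.exp (-y) * A⁻¹) * Real.exp ((C * x) ^ a) := by ring

lemma exp_mul_lintegral_indicator_le {Ω : Type*} [MeasurableSpace Ω] {μ : Measure Ω}
    {V : Ω → ℝ≥0∞} (ha : 0 < a) {C A y M : ℝ} (hC : 0 < C) (hA : 0 < A) (hM₀ : 0 ≤ M)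
    (hM : 2 * (y + Real.log A) ≤ M ^ a)
    (hV : ∫⁻ ω, expRpow a (ENNReal.ofReal C * V ω) ∂μ ≤ ENNReal.ofReal A) :
    ENNReal.ofReal (Real.exp y) * ∫⁻ ω, {ω | ENNReal.ofReal (M / C) < V ω}.indicator V ω ∂μ
      ≤ ENNReal.ofReal ((2 / a) ^ a⁻¹ / C) := by
  set δ := (2 / a) ^ a⁻¹ / C * (Real.exp (-y) * A⁻¹) with hδ
  have hpointwise (ω) : {ω | ENNReal.ofReal (M / C) < V ω}.indicator V ω
      ≤ ENNReal.ofReal δ * expRpow a (ENNReal.ofReal C * V ω) := by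
    by_cases hω : ω ∈ {ω | ENNReal.ofReal (M / C) < V ω}
    · rw [Set.indicator_of_mem hω]
      exact le_mul_expRpow_of_lt ha hC hA hM₀ hM hω
    · rw [Set.indicator_of_notMem hω]
      exact zero_le
  calc ENNReal.ofReal (Real.exp y) * ∫⁻ ω, {ω | ENNReal.ofReal (M / C) < V ω}.indicator V ω ∂μ
      ≤ ENNReal.ofReal (Real.exp y) * (ENNReal.ofReal δ * ENNReal.ofReal A) := by
        gcongr
        refine (lintegral_mono hpointwise).trans ?_
        rw [lintegral_const_mul' _ _ ENNReal.ofReal_ne_top]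
        gcongr
    _ = ENNReal.ofReal ((2 / a) ^ a⁻¹ / C) := by
        rw [← ENNReal.ofReal_mul (by positivity), ← ENNReal.ofReal_mul (by positivity), hδ,
          Real.exp_neg]
        congr 1
        field_simp

end ExpRpow

section Tail

variable {I Ω₀ : Type*} [MeasurableSpace Ω₀] (P₀ : Measure Ω₀) [IsProbabilityMeasure P₀]
  {X : (I → Ω₀) → ℝ} {a C A : ℝ}

/-- The constant `K` such that `X` has stretched-exponential tails at scale `100 √(K / C)` when
`exp ((C 𝕍[X]) ^ a)` is integrable. The summands come from the level at which `𝕍[X]` is clipped and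
from the part of `𝕍[X]` above that level. -/
noncomputable def tailConst (a : ℝ) : ℝ := 12 ^ a⁻¹ + (2 / a) ^ a⁻¹

/-- The scale of the tails of `X` when `exp ((C 𝕍[X]) ^ a)` is integrable. -/
noncomputable def tailScale (a C : ℝ) : ℝ := 100 * √(tailConst a / C)

lemma tailConst_pos (ha : 0 < a) : 0 < tailConst a := by
  unfold tailConst
  positivity

lemma tailScale_pos (ha : 0 < a) (hC : 0 < C) : 0 < tailScale a C := by
  have := tailConst_pos ha
  unfold tailScale
  positivity

lemma cellMean_deviation_le_of_expRpow (s : Finset I) {k : ℕ} {κ : Ω₀ → Fin k}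
    (hκ : Measurable κ) (hX : Integrable X (siteLaw I P₀)) (ha : 0 < a) (hC : 0 < C)
    (hV : ∫⁻ ω, expRpow a (ENNReal.ofReal C * squareFn P₀ X ω) ∂siteLaw I P₀ ≤ ENNReal.ofReal A)
    {t p : ℝ} (ht : 0 < t) (hp : 0 ≤ p)
    (htail : (siteLaw I P₀).real
      {ω | ∫ ω, X ω ∂siteLaw I P₀ + t ≤ cellMean P₀ s κ X (quant s κ ω)} = Real.exp (-p)) :
    (t / tailScale a C) ^ (2 / (1 + a⁻¹)) ≤ p + 1 + Real.log A := by
  set y := p + 1 + Real.log A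
  have hA := one_le_of_lintegral_expRpow_le hV
  have hlogA : 0 ≤ Real.log A := Real.log_nonneg hA
  have hy₁ : 1 ≤ y := by linarith
  have ha' : 0 < a⁻¹ := inv_pos.2 ha
  set M := (2 * (2 * p + 6 + Real.log A)) ^ a⁻¹ with hM
  have hM₀ : 0 ≤ M := by positivity
  have hMa : 2 * (2 * p + 6 + Real.log A) ≤ M ^ a := by
    rw [hM, Real.rpow_inv_rpow (by positivity) ha.ne']
  have hMK : M + (2 / a) ^ a⁻¹ ≤ tailConst a * y ^ a⁻¹ := by
    have hM_le : M ≤ 12 ^ a⁻¹ * y ^ a⁻¹ := by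
      rw [← Real.mul_rpow (by norm_num) (by linarith)]
      exact Real.rpow_le_rpow (by positivity) (by linarith) ha'.le
    rw [tailConst, add_mul]
    exact add_le_add hM_le (le_mul_of_one_le_right (by positivity) (Real.one_le_rpow hy₁ ha'.le))
  have hK := tailConst_pos ha
  have hdev : t ≤ tailScale a C * √(y ^ (1 + a⁻¹)) := by
    rw [tailScale, mul_assoc, ← Real.sqrt_mul (by positivity)]
    refine (cellMean_deviation_le P₀ s hκ hX ht hp (v := tailConst a * y ^ a⁻¹ / C) (by positivity)
      (M := ENNReal.ofReal (M / C)) htail ?_).trans ?_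
    · refine (add_le_add_right (exp_mul_lintegral_indicator_le ha hC (by linarith) hM₀ hMa hV)
        _).trans ?_
      rw [← ENNReal.ofReal_add (by positivity) (by positivity), ← add_div]
      gcongr
    · rw [Real.rpow_add (by linarith), Real.rpow_one, mul_left_comm, mul_div_right_comm]
      gcongr
      linarith
  rw [← div_le_iff₀' (tailScale_pos ha hC)] at hdev
  calc (t / tailScale a C) ^ (2 / (1 + a⁻¹)) ≤ √(y ^ (1 + a⁻¹)) ^ (2 / (1 + a⁻¹)) := by
        have := tailScale_pos ha hC
        gcongr
    _ = y := by
        rw [Real.sqrt_eq_rpow, ← Real.rpow_mul (by positivity), ← Real.rpow_mul (by positivity)]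
        field_simp
        exact Real.rpow_one y

lemma measureReal_cellMean_deviation_le (s : Finset I) {k : ℕ} {κ : Ω₀ → Fin k}
    (hκ : Measurable κ) (hX : Integrable X (siteLaw I P₀)) (ha : 0 < a) (hC : 0 < C)
    (hV : ∫⁻ ω, expRpow a (ENNReal.ofReal C * squareFn P₀ X ω) ∂siteLaw I P₀ ≤ ENNReal.ofReal A)
    {t : ℝ} (ht : 0 < t) :
    (siteLaw I P₀).real {ω | ∫ ω, X ω ∂siteLaw I P₀ + t ≤ cellMean P₀ s κ X (quant s κ ω)}
      ≤ Real.exp 1 * A * Real.exp (-(t / tailScale a C) ^ (2 / (1 + a⁻¹))) := by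
  set m := (siteLaw I P₀).real
    {ω | ∫ ω, X ω ∂siteLaw I P₀ + t ≤ cellMean P₀ s κ X (quant s κ ω)}
  have hA : 0 < A := one_pos.trans_le (one_le_of_lintegral_expRpow_le hV)
  have hm₀ : 0 ≤ m := measureReal_nonneg
  obtain hm | hm := hm₀.eq_or_lt
  · rw [← hm]
    positivity
  have hp : 0 ≤ -Real.log m :=
    neg_nonneg.2 (Real.log_nonpos measureReal_nonneg measureReal_le_one)
  have hle := cellMean_deviation_le_of_expRpow P₀ s hκ hX ha hC hV ht hp
    (by rw [neg_neg, Real.exp_log hm])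
  calc m = Real.exp (Real.log m) := (Real.exp_log hm).symm
    _ ≤ Real.exp (1 + Real.log A + -(t / tailScale a C) ^ (2 / (1 + a⁻¹))) :=
        Real.exp_le_exp.2 (by linarith)
    _ = _ := by rw [Real.exp_add, Real.exp_add, Real.exp_log hA]

lemma exists_measure_le_enorm_sub_cellMean_le (hX : Integrable X (siteLaw I P₀)) {r η : ℝ≥0∞}
    (hr₀ : r ≠ 0) (hr : r ≠ ∞) (hη : η ≠ 0) :
    ∃ (s : Finset I) (k : ℕ) (κ : Ω₀ → Fin k), Measurable κ ∧
      siteLaw I P₀ {ω | r ≤ ‖X ω - cellMean P₀ s κ X (quant s κ ω)‖ₑ} ≤ η := by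
  obtain ⟨Y, hY, s, k, κ, g, hκ, rfl⟩ := exists_isDiscrete_eLpNorm_sub_le (siteLaw I P₀) hX
    (ε := r * η / 2) (by simp [hr₀, hη])
  refine ⟨s, k, κ, hκ, ?_⟩
  have hm := measurable_quant (I := I) s hκ
  have happrox : ∫⁻ ω, ‖X ω - cellMean P₀ s κ X (quant s κ ω)‖ₑ ∂siteLaw I P₀ ≤ η * r := by
    rw [eLpNorm_one_eq_lintegral_enorm] at hY
    refine (lintegral_enorm_sub_fiberMean_le hm hX g).trans ((mul_le_mul_right hY 2).trans_eq ?_)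
    rw [ENNReal.mul_div_cancel (by norm_num) (by norm_num), mul_comm]
  have hmeas : AEMeasurable (fun ω => ‖X ω - cellMean P₀ s κ X (quant s κ ω)‖ₑ) (siteLaw I P₀) :=
    (hX.aemeasurable.sub ((measurable_of_finite _).comp hm).aemeasurable).enorm
  exact (meas_ge_le_lintegral_div hmeas hr₀ hr).trans (ENNReal.div_le_of_le_mul happrox)

lemma measure_upper_deviation_le_of_lt (hX : Integrable X (siteLaw I P₀)) (ha : 0 < a)
    (hC : 0 < C)
    (hV : ∫⁻ ω, expRpow a (ENNReal.ofReal C * squareFn P₀ X ω) ∂siteLaw I P₀ ≤ ENNReal.ofReal A)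
    {t₀ t : ℝ} (ht₀ : 0 < t₀) (ht : t₀ < t) :
    siteLaw I P₀ {ω | ∫ ω, X ω ∂siteLaw I P₀ + t ≤ X ω}
      ≤ ENNReal.ofReal
        (Real.exp 1 * A * Real.exp (-(t₀ / tailScale a C) ^ (2 / (1 + a⁻¹)))) := by
  refine ENNReal.le_of_forall_pos_le_add fun η hη _ => ?_
  obtain ⟨s, k, κ, hκ, happrox⟩ := exists_measure_le_enorm_sub_cellMean_le P₀ hX
    (r := ENNReal.ofReal (t - t₀)) (η := η) (by simpa using ht) ENNReal.ofReal_ne_top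
    (by exact_mod_cast hη.ne')
  have hsub : {ω | ∫ ω, X ω ∂siteLaw I P₀ + t ≤ X ω}
      ⊆ {ω | ∫ ω, X ω ∂siteLaw I P₀ + t₀ ≤ cellMean P₀ s κ X (quant s κ ω)}
        ∪ {ω | ENNReal.ofReal (t - t₀) ≤ ‖X ω - cellMean P₀ s κ X (quant s κ ω)‖ₑ} := by
    intro ω (hω : ∫ ω, X ω ∂siteLaw I P₀ + t ≤ X ω)
    refine or_iff_not_imp_left.2
      fun (h : ¬ ∫ ω, X ω ∂siteLaw I P₀ + t₀ ≤ cellMean P₀ s κ X (quant s κ ω)) => ?_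
    change _ ≤ ‖_‖ₑ
    rw [Real.enorm_eq_ofReal_abs]
    exact ENNReal.ofReal_le_ofReal (le_trans (by linarith) (le_abs_self _))
  refine (measure_mono hsub).trans ((measure_union_le _ _).trans (add_le_add ?_ happrox))
  rw [← ofReal_measureReal]
  exact ENNReal.ofReal_le_ofReal (measureReal_cellMean_deviation_le P₀ s hκ hX ha hC hV ht₀)

lemma measure_upper_deviation_le (hX : Integrable X (siteLaw I P₀)) (ha : 0 < a) (hC : 0 < C)
    (hV : ∫⁻ ω, expRpow a (ENNReal.ofReal C * squareFn P₀ X ω) ∂siteLaw I P₀ ≤ ENNReal.ofReal A)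
    {t : ℝ} (ht : 0 < t) :
    siteLaw I P₀ {ω | ∫ ω, X ω ∂siteLaw I P₀ + t ≤ X ω}
      ≤ ENNReal.ofReal
        (Real.exp 1 * A * Real.exp (-(t / tailScale a C) ^ (2 / (1 + a⁻¹)))) := by
  have hq : 0 ≤ 2 / (1 + a⁻¹) := by positivity
  have hcont : Continuous fun t₀ : ℝ => ENNReal.ofReal
      (Real.exp 1 * A * Real.exp (-(t₀ / tailScale a C) ^ (2 / (1 + a⁻¹)))) :=
    ENNReal.continuous_ofReal.comp (continuous_const.mul (Real.continuous_exp.comp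
      ((Real.continuous_rpow_const hq).comp (continuous_id.div_const _)).neg))
  refine ge_of_tendsto (hcont.continuousWithinAt (s := Set.Iio t) (x := t)) ?_
  filter_upwards [Ioo_mem_nhdsLT ht] with t₀ ht₀
  exact measure_upper_deviation_le_of_lt P₀ hX ha hC hV ht₀.1 ht₀.2

omit [IsProbabilityMeasure P₀] in
lemma squareFn_neg [Countable I] (X : (I → Ω₀) → ℝ) :
    squareFn P₀ (-X) =ᵐ[siteLaw I P₀] squareFn P₀ X := by
  have hneg : ∀ᵐ ω ∂siteLaw I P₀, ∀ i, siteCondExp P₀ (-X) i ω = -siteCondExp P₀ X i ω :=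
    ae_all_iff.2 fun i => condExp_neg X _
  filter_upwards [hneg] with ω hω
  refine tsum_congr fun i => ?_
  rw [hω i, Pi.neg_apply, ← neg_sq (X ω - _)]
  congr 2
  ring

lemma measure_abs_deviation_le [Countable I] (hX : Integrable X (siteLaw I P₀)) (ha : 0 < a)
    (hC : 0 < C)
    (hV : ∫⁻ ω, expRpow a (ENNReal.ofReal C * squareFn P₀ X ω) ∂siteLaw I P₀ ≤ ENNReal.ofReal A)
    {t : ℝ} (ht : 0 < t) :
    siteLaw I P₀ {ω | t ≤ |X ω - ∫ ω, X ω ∂siteLaw I P₀|}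
      ≤ ENNReal.ofReal
        (2 * Real.exp 1 * A * Real.exp (-(t / tailScale a C) ^ (2 / (1 + a⁻¹)))) := by
  have hA : 0 < A := one_pos.trans_le (one_le_of_lintegral_expRpow_le hV)
  have hV_neg : ∫⁻ ω, expRpow a (ENNReal.ofReal C * squareFn P₀ (-X) ω) ∂siteLaw I P₀
      ≤ ENNReal.ofReal A := by
    refine (lintegral_congr_ae ?_).trans_le hV
    filter_upwards [squareFn_neg P₀ X] with ω hω
    rw [hω]
  have hsub : {ω | t ≤ |X ω - ∫ ω, X ω ∂siteLaw I P₀|}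
      ⊆ {ω | ∫ ω, X ω ∂siteLaw I P₀ + t ≤ X ω}
        ∪ {ω | ∫ ω, (-X) ω ∂siteLaw I P₀ + t ≤ (-X) ω} := by
    intro ω (hω : t ≤ |X ω - ∫ ω, X ω ∂siteLaw I P₀|)
    simp only [Set.mem_union, Set.mem_ofPred_eq, Pi.neg_apply, integral_neg]
    exact (le_abs.1 hω).imp (fun h => by linarith) fun h => by linarith
  refine (measure_mono hsub).trans ((measure_union_le _ _).trans ((add_le_add
    (measure_upper_deviation_le P₀ hX ha hC hV ht)
    (measure_upper_deviation_le P₀ hX.neg ha hC hV_neg ht)).trans_eq ?_))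
  rw [← ENNReal.ofReal_add (by positivity) (by positivity)]
  ring_nf

end Tail

section Moment

lemma lintegral_exp_mul_le_of_tail {Ω : Type*} [MeasurableSpace Ω] {μ : Measure Ω}
    [IsProbabilityMeasure μ] {Z : Ω → ℝ} (hZm : AEMeasurable Z μ) (hZ : ∀ ω, 0 ≤ Z ω) {b B : ℝ}
    (hb : 0 ≤ b) (hB : 0 ≤ B)
    (htail : ∀ t, 0 < t → μ {ω | t ≤ Z ω} ≤ ENNReal.ofReal (B * Real.exp (-((b + 1) * t)))) :
    ∫⁻ ω, ENNReal.ofReal (Real.exp (b * Z ω)) ∂μ ≤ ENNReal.ofReal (1 + b * B) := by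
  have hprimitive (x : ℝ) : ∫ t in 0..x, b * Real.exp (b * t) = Real.exp (b * x) - 1 := by
    have hderiv (t : ℝ) : HasDerivAt (fun t => Real.exp (b * t)) (b * Real.exp (b * t)) t := by
      simpa [mul_comm] using ((hasDerivAt_id t).const_mul b).exp
    rw [intervalIntegral.integral_eq_sub_of_hasDerivAt (fun t _ => hderiv t)
      (Continuous.intervalIntegrable (by fun_prop) _ _)]
    simp
  have hone_le (ω) : 1 ≤ Real.exp (b * Z ω) := Real.one_le_exp (mul_nonneg hb (hZ ω))
  have hlayer : ∫⁻ ω, ENNReal.ofReal (Real.exp (b * Z ω) - 1) ∂μ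
      = ∫⁻ t in Set.Ioi 0, μ {ω | t ≤ Z ω} * ENNReal.ofReal (b * Real.exp (b * t)) := by
    simp only [← hprimitive]
    exact lintegral_comp_eq_lintegral_meas_le_mul μ (.of_forall hZ) hZm
      (fun t _ => Continuous.intervalIntegrable (by fun_prop) _ _)
      (.of_forall fun t => by positivity)
  calc ∫⁻ ω, ENNReal.ofReal (Real.exp (b * Z ω)) ∂μ
      = 1 + ∫⁻ ω, ENNReal.ofReal (Real.exp (b * Z ω) - 1) ∂μ := by
        rw [← measure_univ (μ := μ), ← lintegral_one, ← lintegral_add_left measurable_const]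
        refine lintegral_congr fun ω => ?_
        rw [← ENNReal.ofReal_one, ← ENNReal.ofReal_add zero_le_one
          (sub_nonneg.2 (hone_le ω)), add_sub_cancel]
    _ ≤ 1 + ∫⁻ t in Set.Ioi (0 : ℝ), ENNReal.ofReal (b * B * Real.exp (-t)) := by
        rw [hlayer]
        refine add_le_add_right (setLIntegral_mono (by fun_prop) fun t ht => ?_) _
        refine (mul_le_mul_left (htail t ht) _).trans_eq ?_
        rw [← ENNReal.ofReal_mul (by positivity), mul_mul_mul_comm, mul_comm B, ← Real.exp_add]
        congr 3
        ring
    _ = ENNReal.ofReal (1 + b * B) := by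
        rw [← ofReal_integral_eq_lintegral_ofReal
          ((integrableOn_exp_neg_Ioi 0).const_mul _) (.of_forall fun t => by positivity),
          integral_const_mul, integral_exp_neg_Ioi_zero, mul_one,
          ENNReal.ofReal_add zero_le_one (by positivity), ENNReal.ofReal_one]

lemma lintegral_exp_le_rpow {Ω : Type*} [MeasurableSpace Ω] {μ : Measure Ω}
    [IsProbabilityMeasure μ] {Z : Ω → ℝ} (hZ : AEMeasurable Z μ) {b : ℝ} (hb : 1 ≤ b) :
    ∫⁻ ω, ENNReal.ofReal (Real.exp (Z ω)) ∂μ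
      ≤ (∫⁻ ω, ENNReal.ofReal (Real.exp (b * Z ω)) ∂μ) ^ b⁻¹ := by
  have hexp (ω) : ENNReal.ofReal (Real.exp (b * Z ω)) = ‖Real.exp (Z ω)‖ₑ ^ b := by
    rw [Real.enorm_of_nonneg (Real.exp_pos _).le,
      ENNReal.ofReal_rpow_of_nonneg (Real.exp_pos _).le (by linarith), ← Real.exp_mul, mul_comm]
  simpa [hexp, eLpNorm', Real.enorm_of_nonneg (Real.exp_pos _).le] using
    eLpNorm'_le_eLpNorm'_of_exponent_le one_pos hb μ hZ.exp.aestronglyMeasurable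

variable {I Ω₀ : Type*} [Countable I] [MeasurableSpace Ω₀] (P₀ : Measure Ω₀)
  [IsProbabilityMeasure P₀] {X : (I → Ω₀) → ℝ} {a C : ℝ}

lemma mul_tailScale_rpow_le_one (ha : 0 < a) {r : ℝ} (hr : 0 < r)
    (hC : tailConst a * 100 ^ 2 * r ^ (1 + a⁻¹) ≤ C) :
    r * tailScale a C ^ (2 / (1 + a⁻¹)) ≤ 1 := by
  have hK := tailConst_pos ha
  have hC₀ : 0 < C := lt_of_lt_of_le (by positivity) hC
  have hσ := tailScale_pos ha hC₀
  have hbase : r ^ (1 + a⁻¹) * tailScale a C ^ 2 ≤ 1 := by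
    rw [tailScale, mul_pow, Real.sq_sqrt (by positivity), ← mul_assoc, mul_div_assoc',
      div_le_one hC₀]
    linarith
  calc r * tailScale a C ^ (2 / (1 + a⁻¹))
      = (r ^ (1 + a⁻¹) * tailScale a C ^ 2) ^ (1 + a⁻¹)⁻¹ := by
        rw [Real.mul_rpow (by positivity) (by positivity), Real.rpow_rpow_inv hr.le (by positivity),
          div_eq_mul_inv, Real.rpow_mul hσ.le, Real.rpow_two]
    _ ≤ 1 := Real.rpow_le_one (by positivity) hbase (by positivity)

lemma lintegral_exp_mul_abs_deviation_le (hX : Integrable X (siteLaw I P₀)) (ha : 0 < a) {b : ℝ}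
    (hb : 0 ≤ b) (hC : tailConst a * 100 ^ 2 * (b + 1) ^ (1 + a⁻¹) ≤ C) {A : ℝ}
    (hV : ∫⁻ ω, expRpow a (ENNReal.ofReal C * squareFn P₀ X ω) ∂siteLaw I P₀
      ≤ ENNReal.ofReal A) :
    ∫⁻ ω, ENNReal.ofReal (Real.exp (b * |X ω - ∫ ω, X ω ∂siteLaw I P₀| ^ (2 / (1 + a⁻¹))))
      ∂siteLaw I P₀ ≤ ENNReal.ofReal ((1 + 2 * Real.exp 1 * b) * A) := by
  have hA := one_le_of_lintegral_expRpow_le hV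
  have hC₀ : 0 < C := by
    have := tailConst_pos ha
    exact lt_of_lt_of_le (by positivity) hC
  have hσ := tailScale_pos ha hC₀
  have hq : 0 < 2 / (1 + a⁻¹) := by positivity
  refine (lintegral_exp_mul_le_of_tail
    ((hX.aemeasurable.sub_const _).abs.pow_const _) (fun ω => by positivity) hb
    (B := 2 * Real.exp 1 * A) (by positivity) fun t ht => ?_).trans
    (ENNReal.ofReal_le_ofReal (by linarith))
  have hle : (b + 1) * t ≤ (t ^ (2 / (1 + a⁻¹))⁻¹ / tailScale a C) ^ (2 / (1 + a⁻¹)) := by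
    rw [Real.div_rpow (by positivity) hσ.le, Real.rpow_inv_rpow ht.le hq.ne',
      le_div_iff₀ (by positivity), mul_right_comm]
    exact mul_le_of_le_one_left ht.le (mul_tailScale_rpow_le_one ha (by linarith) hC)
  simp only [← Real.rpow_inv_le_iff_of_pos ht.le (abs_nonneg _) hq]
  refine (measure_abs_deviation_le P₀ hX ha hC₀ hV (by positivity)).trans ?_
  gcongr

/-- The constant `C` of the theorem, for the exponent `a = β / (2 - β)`. Exponential moments are
taken with the factor `max 1 a`, so that Jensen's inequality leaves the power `a⁻¹` of the
right-hand side. -/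
noncomputable def momentConst (a : ℝ) : ℝ :=
  max (1 + 2 * Real.exp 1 * max 1 a) (tailConst a * 100 ^ 2 * (max 1 a + 1) ^ (1 + a⁻¹))

lemma one_le_momentConst (a : ℝ) : 1 ≤ momentConst a := by
  have : 0 ≤ max 1 a := le_max_of_le_left zero_le_one
  exact le_max_of_le_left (by linarith [show 0 ≤ 2 * Real.exp 1 * max 1 a by positivity])

theorem lintegral_exp_abs_deviation_le (hX : Integrable X (siteLaw I P₀)) (ha : 0 < a) :
    ∫⁻ ω, ENNReal.ofReal (Real.exp (|X ω - ∫ ω, X ω ∂siteLaw I P₀| ^ (2 / (1 + a⁻¹))))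
      ∂siteLaw I P₀
      ≤ ENNReal.ofReal (momentConst a)
        * (∫⁻ ω, expRpow a (ENNReal.ofReal (momentConst a) * squareFn P₀ X ω)
            ∂siteLaw I P₀) ^ a⁻¹ := by
  set b := max 1 a
  set C := momentConst a
  have hb : 1 ≤ b := le_max_left 1 a
  have hC : 1 ≤ C := one_le_momentConst a
  set A := ∫⁻ ω, expRpow a (ENNReal.ofReal C * squareFn P₀ X ω) ∂siteLaw I P₀
  have hA : 1 ≤ A := one_le_lintegral_expRpow _ _
  obtain hAtop | hAtop := eq_or_ne A ∞
  · rw [hAtop, ENNReal.top_rpow_of_pos (inv_pos.2 ha),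
      ENNReal.mul_top (ENNReal.ofReal_pos.2 (by linarith)).ne']
    exact le_top
  have hmoment := lintegral_exp_mul_abs_deviation_le P₀ hX ha (zero_le_one.trans hb)
    (le_max_right _ _) (ENNReal.ofReal_toReal hAtop).ge
  rw [ENNReal.ofReal_mul (by positivity), ENNReal.ofReal_toReal hAtop] at hmoment
  calc ∫⁻ ω, ENNReal.ofReal (Real.exp (|X ω - ∫ ω, X ω ∂siteLaw I P₀| ^ (2 / (1 + a⁻¹))))
        ∂siteLaw I P₀
      ≤ (ENNReal.ofReal (1 + 2 * Real.exp 1 * b) * A) ^ b⁻¹ :=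
        (lintegral_exp_le_rpow ((hX.aemeasurable.sub_const _).abs.pow_const _) hb).trans
          (ENNReal.rpow_le_rpow hmoment (by positivity))
    _ ≤ (ENNReal.ofReal C * A) ^ b⁻¹ := by
        gcongr
        exact le_max_left _ _
    _ = ENNReal.ofReal C ^ b⁻¹ * A ^ b⁻¹ := ENNReal.mul_rpow_of_nonneg _ _ (by positivity)
    _ ≤ ENNReal.ofReal C * A ^ a⁻¹ := by
        gcongr
        · exact (ENNReal.rpow_le_rpow_of_exponent_le (ENNReal.one_le_ofReal.2 hC)
            (inv_le_one_of_one_le₀ hb)).trans_eq (ENNReal.rpow_one _)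
        · exact le_max_right 1 a

end Moment

end NoiseSemigroup

open NoiseSemigroup in
theorem proposition2p2_general (β : ℝ) (hβ₀ : 0 < β) (hβ₂ : β < 2) :
    ∃ C : ℝ, 1 ≤ C ∧
      ∀ (I : Type*) [Countable I] (Ω₀ : Type*) [MeasurableSpace Ω₀] (P₀ : Measure Ω₀)
        [IsProbabilityMeasure P₀] (X : (I → Ω₀) → ℝ), Integrable X (siteLaw I P₀) →
        ∫⁻ ω, ENNReal.ofReal (Real.exp (|X ω - ∫ ω', X ω' ∂siteLaw I P₀| ^ β)) ∂siteLaw I P₀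
          ≤ ENNReal.ofReal C *
            (∫⁻ ω, expRpow (β / (2 - β)) (ENNReal.ofReal C * squareFn P₀ X ω)
              ∂siteLaw I P₀) ^ ((2 - β) / β) := by
  refine ⟨momentConst (β / (2 - β)), one_le_momentConst _, fun I _ Ω₀ _ P₀ _ X hX => ?_⟩
  have hexp : 2 / (1 + (β / (2 - β))⁻¹) = β := by
    rw [inv_div]
    field_simp
    ring
  have hmoment := lintegral_exp_abs_deviation_le P₀ hX (div_pos hβ₀ (sub_pos.2 hβ₂))
  rwa [hexp, inv_div] at hmoment

theorem proposition2p2 (β : ℝ) (hβ₀ : 0 < β) (hβ₂ : β < 2) :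
    ∃ C : ℝ, 1 ≤ C ∧
      ∀ (d : ℕ) (Ω₀ : Type*) [MeasurableSpace Ω₀] (P₀ : Measure Ω₀) [IsProbabilityMeasure P₀]
        (X : ((Fin d → ℤ) → Ω₀) → ℝ), Measurable X → Integrable X (productLaw d P₀) →
        ∫⁻ ω, ENNReal.ofReal (Real.exp (|X ω - ∫ ω', X ω' ∂(productLaw d P₀)| ^ β))
            ∂(productLaw d P₀)
          ≤ ENNReal.ofReal C *
            (∫⁻ ω, EReal.exp
                (((ENNReal.ofReal C * verticalVar P₀ X ω) ^ (β / (2 - β)) : ℝ≥0∞) : EReal)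
              ∂(productLaw d P₀)) ^ ((2 - β) / β) := by
  obtain ⟨C, hC, h⟩ := proposition2p2_general β hβ₀ hβ₂
  exact ⟨C, hC, fun d Ω₀ _ P₀ _ X _ hX => h (Fin d → ℤ) Ω₀ P₀ X hX⟩
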